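/- Identify weights of $\mathfrak{sl}_3$ with traceless diagonal matrices $\lambda=\operatorname{diag}(\lambda^1,\lambda^2,\lambda^3)$; the fundamental weights are $\omega_1=\operatorname{diag}(\tfrac23,-\tfrac13,-\tfrac13)$ and $\omega_2=\operatorname{diag}(\tfrac13,\tfrac13,-\tfrac23)$, $\bar\rho=\omega_1+\omega_2=\operatorname{diag}(1,0,-1)$ is the half-sum of the positive roots, and the Weyl group $W=S_3$ permutes the diagonal entries. Put $c^1(\lambda)=\tfrac12(\lambda,\lambda+2\bar\rho)=\tfrac12\sum_k\lambda^k(\lambda^k+2\bar\rho^k)$ and $c^2(\lambda)=\prod_{k}(\lambda^k+\bar\rho^k+1)=(\lambda^1+2)(\lambda^2+1)\lambda^3$ (the values on the Verma module $M_\lambda$ of suitably normalized central elements of $U(\mathfrak{sl}_3)$ of orders $2$ and $3$). Let $z_1,\dots,z_N\in\mathbb C$ be distinct, let $\lambda_1,\dots,\lambda_N$ be integral dominant weights of $\mathfrak{sl}_3$, let $\mu_i,\nu_i,\kappa_i\in\mathbb C$, and let $$\rho=\partial_t^3-\sum_{i=1}^N\Big(\frac{c^1(\lambda_i)}{(t-z_i)^2}+\frac{\mu_i}{t-z_i}\Big)\partial_t-\sum_{i=1}^N\Big(\frac{c^2(\lambda_i)}{(t-z_i)^3}+\frac{\nu_i}{(t-z_i)^2}+\frac{\kappa_i}{t-z_i}\Big).$$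 Assume that $\rho$ has at most a regular singularity at $\infty$, i.e. that the coefficient of $\partial_t$ is $O(t^{-2})$ and the free coefficient is $O(t^{-3})$ as $t\to\infty$. (i) The monodromy representation $\pi_1(\mathbb P^1\setminus\{z_1,\dots,z_N,\infty\})\to PGL_3$ on the local solutions of $\rho\,\phi=0$ is trivial if and only if there are rational functions $\chi_1,\chi_2,\chi_3$ of $t$ such that $$\rho=(\partial_t-\chi_1(t))(\partial_t-\chi_2(t))(\partial_t-\chi_3(t))$$ and $\chi=\operatorname{diag}(\chi_1,\chi_2,\chi_3)$ has the form $$\chi(t)=\sum_{i=1}^N\frac{\lambda_i}{t-z_i}+\sum_{s\in W,\,s\ne1}\ \sum_{j=1}^{m_s}\frac{s(\bar\rho)-\bar\rho}{t-w^{(s)}_j}$$ with finitely many points $w^{(s)}_j\in\mathbb C$, all distinct from each other and from $z_1,\dots,z_N$. (ii) Whenever $\rho=(\partial_t-\chi_1)(\partial_t-\chi_2)(\partial_t-\chi_3)$ with rational functions $\chi_k$, there are $\sigma_1,\dots,\sigma_N\in W$ such that $$\chi(t)=\sum_{i=1}^N\frac{\sigma_i(\lambda_i+\bar\rho)-\bar\rho}{t-z_i}+\sum_{s\in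 W,\,s\ne1}\ \sum_{j=1}^{m_s}\frac{s(\bar\rho)-\bar\rho}{t-w^{(s)}_j}$$ with finitely many points $w^{(s)}_j$ as in (i). In particular, if the residue of $\chi$ at each $z_i$ is $\lambda_i$, then $\chi$ has the form displayed in (i). -/

import Mathlib

open Filter Topology

namespace SL3Oper

noncomputable section

/-! ### Weights of `sl_3`, written as traceless diagonal matrices (their diagonals) -/

/-- The fundamental weight `ω₁ = diag(2/3, -1/3, -1/3)`. -/
def omega1 : Fin 3 → ℂ := ![2 / 3, -1 / 3, -1 / 3]

/-- The fundamental weight `ω₂ = diag(1/3, 1/3, -2/3)`. -/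
def omega2 : Fin 3 → ℂ := ![1 / 3, 1 / 3, -2 / 3]

/-- The half-sum of the positive roots, `ω₁ + ω₂ = diag(1, 0, -1)`. -/
def rhoBar : Fin 3 → ℂ := ![1, 0, -1]

/-- Integral dominant weights: `n₁ ω₁ + n₂ ω₂` with `n₁, n₂` nonnegative integers. -/
def IsDominantIntegral (lam : Fin 3 → ℂ) : Prop :=
  ∃ n₁ n₂ : ℕ, lam = (n₁ : ℂ) • omega1 + (n₂ : ℂ) • omega2

/-- The action of the Weyl group `W = S₃` of `sl_3` on weights, by permuting diagonal entries. -/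
def weyl (s : Equiv.Perm (Fin 3)) (lam : Fin 3 → ℂ) : Fin 3 → ℂ := fun k => lam (s⁻¹ k)

/-- The shifted action `s(λ + ρ̄) - ρ̄`. -/
def weylDot (s : Equiv.Perm (Fin 3)) (lam : Fin 3 → ℂ) : Fin 3 → ℂ :=
  weyl s (lam + rhoBar) - rhoBar

/-- The value on the Verma module `M_λ` of the central element of order 2 of `U(sl_3)`:
half the Casimir element, `(λ, λ + 2ρ̄) / 2`. -/
def c1 (lam : Fin 3 → ℂ) : ℂ := (∑ k, lam k * (lam k + 2 * rhoBar k)) / 2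

/-- The value on the Verma module `M_λ` of the central element of order 3 of `U(sl_3)` whose
Harish-Chandra image is the symmetric polynomial `∏ₖ (xₖ + 1)` in `x = λ + ρ̄`. -/
def c2 (lam : Fin 3 → ℂ) : ℂ := ∏ k, (lam k + rhoBar k + 1)

/-- The normalization of `c1` and `c2` is the one for which the most singular part of the oper
`∂³ - (c1/t² + …)∂ - (c2/t³ + …)` is that of `(∂ - λ₀/t)(∂ - λ₁/t)(∂ - λ₂/t)`: the two indicial
polynomials agree. -/
theorem indicial (lam : Fin 3 → ℂ) (h : ∑ k, lam k = 0) (e : ℂ) :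
    e * (e - 1) * (e - 2) - c1 lam * e - c2 lam =
      (e - lam 2) * (e - 1 - lam 1) * (e - 2 - lam 0) := by
  have h2 : lam 2 = -lam 0 - lam 1 := by
    rw [Fin.sum_univ_three] at h
    linear_combination h
  simp only [c1, c2, rhoBar, Fin.sum_univ_three, Fin.prod_univ_three, h2, Matrix.cons_val]
  ring

/-! ### The oper `∂³ - u ∂ - v` -/

/-- The coefficient `u = ∑ᵢ c¹(λᵢ)/(t - zᵢ)² + μᵢ/(t - zᵢ)`. -/
def coeffU {N : ℕ} (z : Fin N → ℂ) (lam : Fin N → Fin 3 → ℂ) (μ : Fin N → ℂ) (t : ℂ) : ℂ :=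
  ∑ i, (c1 (lam i) / (t - z i) ^ 2 + μ i / (t - z i))

/-- The coefficient `v = ∑ᵢ c²(λᵢ)/(t - zᵢ)³ + νᵢ/(t - zᵢ)² + κᵢ/(t - zᵢ)`. -/
def coeffV {N : ℕ} (z : Fin N → ℂ) (lam : Fin N → Fin 3 → ℂ) (ν κ : Fin N → ℂ) (t : ℂ) : ℂ :=
  ∑ i, (c2 (lam i) / (t - z i) ^ 3 + ν i / (t - z i) ^ 2 + κ i / (t - z i))

/-- The operator `∂³ - u ∂ - v` applied to a function. -/
def oper (u v : ℂ → ℂ) (f : ℂ → ℂ) (t : ℂ) : ℂ :=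
  deriv (deriv (deriv f)) t - u t * deriv f t - v t * f t

/-- `∂³ - u ∂ - v` has (at most) a regular singularity at `∞` (Fuchs' condition). -/
def RegularSingularAtInfty (u v : ℂ → ℂ) : Prop :=
  u =O[Bornology.cobounded ℂ] (fun t => (t ^ 2)⁻¹) ∧
    v =O[Bornology.cobounded ℂ] (fun t => (t ^ 3)⁻¹)

/-! ### Monodromy -/

/-- The space of germs at `x` of holomorphic solutions of `(∂³ - u ∂ - v) f = 0`. -/
def solGerm (u v : ℂ → ℂ) (x : ℂ) : Submodule ℂ (Germ (𝓝 x) ℂ) where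
  carrier := {φ | ∃ f : ℂ → ℂ, AnalyticAt ℂ f x ∧ (∀ᶠ t in 𝓝 x, oper u v f t = 0) ∧
    (f : Germ (𝓝 x) ℂ) = φ}
  zero_mem' := by
    have h0 : deriv (0 : ℂ → ℂ) = 0 := by ext t; simp
    exact ⟨0, analyticAt_const, Eventually.of_forall fun t => by simp [oper, h0], rfl⟩
  add_mem' := by
    rintro _ _ ⟨f, hf, hf', rfl⟩ ⟨g, hg, hg', rfl⟩
    refine ⟨f + g, hf.add hg, ?_, rfl⟩
    have e1 : deriv (f + g) =ᶠ[𝓝 x] deriv f + deriv g := by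
      filter_upwards [hf.eventually_analyticAt, hg.eventually_analyticAt] with t h1 h2
      exact deriv_add h1.differentiableAt h2.differentiableAt
    have e2 : deriv (deriv (f + g)) =ᶠ[𝓝 x] deriv (deriv f) + deriv (deriv g) := by
      refine e1.deriv.trans ?_
      filter_upwards [hf.deriv.eventually_analyticAt, hg.deriv.eventually_analyticAt] with t h1 h2
      exact deriv_add h1.differentiableAt h2.differentiableAt
    have e3 : deriv (deriv (deriv (f + g))) =ᶠ[𝓝 x]
        deriv (deriv (deriv f)) + deriv (deriv (deriv g)) := by
      refine e2.deriv.trans ?_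
      filter_upwards [hf.deriv.deriv.eventually_analyticAt,
        hg.deriv.deriv.eventually_analyticAt] with t h1 h2
      exact deriv_add h1.differentiableAt h2.differentiableAt
    filter_upwards [hf', hg', e1, e3] with t h1 h2 h3 h4
    simp only [oper, Pi.add_apply] at *
    rw [h3, h4]
    linear_combination h1 + h2
  smul_mem' := by
    rintro c _ ⟨f, hf, hf', rfl⟩
    refine ⟨c • f, hf.const_smul, ?_, rfl⟩
    have e : ∀ g : ℂ → ℂ, deriv (c • g) = c • deriv g := fun g => by
      ext t; exact deriv_const_smul_field c g
    filter_upwards [hf'] with t h1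
    simp only [oper, e, Pi.smul_apply, smul_eq_mul] at *
    linear_combination c * h1

/-- The germ `ψ` at `y` is the analytic continuation of the germ `φ` at `x` along `γ`. -/
def Continues {x y : ℂ} (γ : Path x y) (φ : Germ (𝓝 x) ℂ) (ψ : Germ (𝓝 y) ℂ) : Prop :=
  ∃ F : unitInterval → ℂ → ℂ, (∀ s, AnalyticAt ℂ (F s) (γ s)) ∧
    (∀ s, ∀ᶠ s' in 𝓝 s, F s' =ᶠ[𝓝 (γ s')] F s) ∧
    (F 0 : Germ (𝓝 x) ℂ) = φ ∧ (F 1 : Germ (𝓝 y) ℂ) = ψ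

/-- `PGL(V)`, the general linear group modulo its center. -/
abbrev PGL (V : Type) [AddCommGroup V] [Module ℂ V] : Type :=
  LinearMap.GeneralLinearGroup ℂ V ⧸ Subgroup.center (LinearMap.GeneralLinearGroup ℂ V)

/-- `M` is the monodromy along the loop `γ`: analytic continuation along `γ` takes every germ `φ`
of a solution at the base point to `M φ`. -/
def IsMonodromy (u v : ℂ → ℂ) {x : ℂ} (γ : Path x x)
    (M : LinearMap.GeneralLinearGroup ℂ (solGerm u v x)) : Prop :=
  ∀ φ : solGerm u v x, Continues γ (φ : Germ (𝓝 x) ℂ)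
    ((M : solGerm u v x →ₗ[ℂ] solGerm u v x) φ : Germ (𝓝 x) ℂ)

/-- The monodromy representation of `π₁(ℂ \ S, x)` in the projective linear group of the space of
local solutions at `x` is trivial, for every base point `x`. -/
def TrivialProjectiveMonodromy (u v : ℂ → ℂ) (S : Set ℂ) : Prop :=
  ∀ (x : ℂ) (γ : Path x x), (∀ s, γ s ∉ S) →
    ∃ M : LinearMap.GeneralLinearGroup ℂ (solGerm u v x),
      IsMonodromy u v γ M ∧ (QuotientGroup.mk M : PGL (solGerm u v x)) = 1

/-! ### The Miura transformation -/

/-- The first order operator `∂ - χ`, for a rational function `χ`. -/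
def firstOrder (χ : RatFunc ℂ) (f : ℂ → ℂ) (t : ℂ) : ℂ :=
  deriv f t - χ.eval (RingHom.id ℂ) t * f t

/-- `∂³ - u ∂ - v = (∂ - χ₀)(∂ - χ₁)(∂ - χ₂)` as differential operators: they agree on all
functions that are holomorphic near a point outside `S` and outside the poles of the `χₖ`. -/
def IsMiura (u v : ℂ → ℂ) (S : Set ℂ) (χ : Fin 3 → RatFunc ℂ) : Prop :=
  ∀ t : ℂ, t ∉ S → (∀ k, (χ k).denom.eval t ≠ 0) → ∀ f : ℂ → ℂ, AnalyticAt ℂ f t →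
    oper u v f t = firstOrder (χ 0) (firstOrder (χ 1) (firstOrder (χ 2) f)) t

/-- `χ(t) = ∑ᵢ resᵢ/(t - zᵢ) + ∑_{s ∈ W, s ≠ 1} ∑_{w ∈ P s} (s(ρ̄) - ρ̄)/(t - w)` for some finite
sets `P s` of points, pairwise disjoint and not containing any `zᵢ`. -/
def HasDiagonalForm {N : ℕ} (z : Fin N → ℂ) (res : Fin N → Fin 3 → ℂ)
    (χ : Fin 3 → RatFunc ℂ) : Prop :=
  ∃ P : {s : Equiv.Perm (Fin 3) // s ≠ 1} → Finset ℂ,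
    Pairwise (fun s s' => Disjoint (P s) (P s')) ∧ (∀ s i, z i ∉ P s) ∧
    ∀ k, χ k = (∑ i, RatFunc.C (res i k) / (RatFunc.X - RatFunc.C (z i))) +
      ∑ s, ∑ w ∈ P s,
        RatFunc.C (weyl s.1 rhoBar k - rhoBar k) / (RatFunc.X - RatFunc.C w)

end

end SL3Oper

/-! Part (ii) is local. Comparing coefficients in a factorization (`MiuraEqs`) expresses `u` and `v`
through the factors. At a pole of order greater than one the leading coefficients would have
vanishing elementary symmetric functions, so all poles are simple
(`exists_simple_pole_of_miuraEqs`). The residue vector at `p` has the same `c1` and `c2` as the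
local weight (`lam i` at `z i`, zero elsewhere), hence the same indicial roots, so after adding
`rhoBar` the two differ by a permutation (`exists_weylDot_eq`). The symmetric function argument at
infinity excludes a polynomial part, so `χ` is the sum of its simple fractions
(`IsMiura.hasDiagonalForm`).

From trivial monodromy to a factorization: continuation along a loop multiplies all solutions by a
common scalar. The Wronskian is constant, so this scalar is a cube root of unity, and products of
three solutions or derivatives of solutions are single-valued. A Grönwall estimate bounds their
growth at the `z i` and at infinity, so those with derivatives of order at most one are rational
(`BranchSystem.isRational_triple`). For solutions `f`, `g` put `W = f g' - f' g`. Then `f ^ 3` and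
`W f` are rational, hence so are the factors of `(∂ + W'/W)(∂ - W'/W + f'/f)(∂ - f'/f)`. A vector
space over `ℂ` is not a finite union of proper subspaces, so `f` can be chosen with the lowest
exponent at every `z i` simultaneously, and then `g` with `W` of lowest order at every `z i`. These
minimal choices force the residues `lam i`.

From a factorization with residues `lam i` to trivial monodromy: let `Φ₀`, `Φ₁`, `Φ₂` be annihilated
by `∂ - χ₂`, `∂ - χ₁`, `∂ - χ₀`. The solutions are `Φ₀ (k₀ + k₁ A + k₂ C)` with `A' = Φ₁/Φ₀`, `B' =
Φ₂/Φ₁`, `C' = (Φ₁/Φ₀) B`. The two ratios are rational, and at `z i` their exponents `n₂`, `n₁` are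
nonnegative by dominance, so no logarithm arises there. At the other poles the equation is regular;
its three holomorphic solutions supply local meromorphic primitives. Thus `A`, `B`, `C` are globally
meromorphic, and every solution is `∏ (t - z i) ^ (lam i 2)` times a single-valued function, so a
loop acts by one scalar. -/

open Filter Topology

namespace SL3Oper

noncomputable section

/-! ### The Miura transformation in terms of coefficients -/

/-- The first order operator `∂ - g`. -/
def factorOp (g f : ℂ → ℂ) (t : ℂ) : ℂ := deriv f t - g t * f t

/-- The relations between coefficients that express
`∂³ - u ∂ - v = (∂ - a)(∂ - b)(∂ - c)` at `t`. -/
def MiuraEqs (u v a b c : ℂ → ℂ) (t : ℂ) : Prop :=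
  a t + b t + c t = 0 ∧
  u t = deriv b t + 2 * deriv c t - (a t * b t + a t * c t + b t * c t) ∧
  v t = deriv (deriv c) t - (deriv b t * c t + b t * deriv c t) - a t * deriv c t
    + a t * b t * c t

theorem AnalyticAt.factorOp {g f : ℂ → ℂ} {t : ℂ} (hg : AnalyticAt ℂ g t)
    (hf : AnalyticAt ℂ f t) : AnalyticAt ℂ (factorOp g f) t :=
  hf.deriv.sub (hg.mul hf)

theorem deriv_factorOp {g f : ℂ → ℂ} {t : ℂ} (hg : AnalyticAt ℂ g t) (hf : AnalyticAt ℂ f t) :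
    deriv (factorOp g f) t = deriv (deriv f) t - (deriv g t * f t + g t * deriv f t) := by
  have h1 := hf.deriv.differentiableAt.hasDerivAt
  have h2 := hg.differentiableAt.hasDerivAt.mul hf.differentiableAt.hasDerivAt
  exact (h1.sub h2).deriv

theorem factorOp_factorOp_factorOp {a b c f : ℂ → ℂ} {t : ℂ} (hb : AnalyticAt ℂ b t)
    (hc : AnalyticAt ℂ c t) (hf : AnalyticAt ℂ f t) :
    factorOp a (factorOp b (factorOp c f)) t =
      deriv (deriv (deriv f)) t - (a t + b t + c t) * deriv (deriv f) t
      - (deriv b t + 2 * deriv c t - (a t * b t + a t * c t + b t * c t)) * deriv f t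
      - (deriv (deriv c) t - (deriv b t * c t + b t * deriv c t) - a t * deriv c t
        + a t * b t * c t) * f t := by
  have h1 : deriv (factorOp c f) =ᶠ[𝓝 t] fun s =>
      deriv (deriv f) s - (deriv c s * f s + c s * deriv f s) := by
    filter_upwards [hc.eventually_analyticAt, hf.eventually_analyticAt] with s h1 h2
    exact deriv_factorOp h1 h2
  have h2 : deriv (deriv (factorOp c f)) t = deriv (deriv (deriv f)) t -
      ((deriv (deriv c) t * f t + deriv c t * deriv f t) +
        (deriv c t * deriv f t + c t * deriv (deriv f) t)) := by
    rw [h1.deriv_eq]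
    exact (hf.deriv.deriv.differentiableAt.hasDerivAt.sub
      ((hc.deriv.differentiableAt.hasDerivAt.mul hf.differentiableAt.hasDerivAt).add
        (hc.differentiableAt.hasDerivAt.mul hf.deriv.differentiableAt.hasDerivAt))).deriv
  have e : ∀ g : ℂ → ℂ, factorOp a g t = deriv g t - a t * g t := fun _ => rfl
  rw [e, deriv_factorOp hb (AnalyticAt.factorOp hc hf), h2]
  simp only [factorOp] at h1 ⊢
  rw [deriv_factorOp hc hf]
  ring

theorem MiuraEqs.oper_eq {u v a b c f : ℂ → ℂ} {t : ℂ} (h : MiuraEqs u v a b c t)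
    (hb : AnalyticAt ℂ b t) (hc : AnalyticAt ℂ c t) (hf : AnalyticAt ℂ f t) :
    oper u v f t = factorOp a (factorOp b (factorOp c f)) t := by
  rw [factorOp_factorOp_factorOp hb hc hf, h.1, ← h.2.1, ← h.2.2, oper]
  ring

/-- The test functions `1`, `s - t`, `(s - t) ^ 2` isolate, at `t`, the coefficients of orders 0, 1
and 2. -/
theorem MiuraEqs.of_forall_oper_eq {u v a b c : ℂ → ℂ} {t : ℂ}
    (hb : AnalyticAt ℂ b t) (hc : AnalyticAt ℂ c t)
    (h : ∀ f, AnalyticAt ℂ f t → oper u v f t = factorOp a (factorOp b (factorOp c f)) t) :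
    MiuraEqs u v a b c t := by
  have d1 : deriv (fun s : ℂ => s - t) = fun _ => 1 := by ext s; simp
  have d2 : deriv (fun s : ℂ => (s - t) ^ 2) = fun s => 2 * (s - t) := by
    ext s; simp
  have d3 : deriv (fun s : ℂ => 2 * (s - t)) = fun s => 2 := by ext s; simp
  have h0 := h (fun _ => 1) analyticAt_const
  have h1 := h (fun s => s - t) (by fun_prop)
  have h2 := h (fun s => (s - t) ^ 2) (by fun_prop)
  rw [factorOp_factorOp_factorOp hb hc (by fun_prop)] at h0 h1 h2
  simp only [oper, d1, d2, d3, deriv_const'] at h0 h1 h2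
  refine ⟨by linear_combination h2 / 2, ?_, ?_⟩
  · linear_combination -h1
  · linear_combination -h0

/-! ### Local analysis at a point -/

theorem deriv_div_pow {g h : ℂ → ℂ} {p : ℂ} {m : ℕ} (hh : AnalyticAt ℂ h p)
    (hg : g =ᶠ[𝓝[≠] p] fun s => h s / (s - p) ^ m) :
    deriv g =ᶠ[𝓝[≠] p] fun s => ((s - p) * deriv h s - m * h s) / (s - p) ^ (m + 1) := by
  filter_upwards [hg.nhdsNE_deriv, hh.eventually_analyticAt.filter_mono nhdsWithin_le_nhds,
    self_mem_nhdsWithin] with s h1 h2 h3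
  have h4 : s - p ≠ 0 := sub_ne_zero.2 h3
  rw [h1]
  have h5 := (h2.differentiableAt.hasDerivAt.div (((hasDerivAt_id s).sub_const p).pow m)
    (pow_ne_zero m h4)).deriv
  have h6 : deriv (fun s => h s / (s - p) ^ m) s =
    (deriv h s * (s - p) ^ m - h s * (m * (s - p) ^ (m - 1) * 1)) / ((s - p) ^ m) ^ 2 := h5
  rw [h6]
  rcases m with _ | m
  · field_simp
    simp
  · field_simp
    simp
    ring

theorem eq_of_eventuallyEq_nhdsNE {f g : ℂ → ℂ} {p : ℂ} (hf : ContinuousAt f p)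
    (hg : ContinuousAt g p) (h : f =ᶠ[𝓝[≠] p] g) : f p = g p :=
  tendsto_nhds_unique (hf.tendsto.mono_left nhdsWithin_le_nhds)
    ((hg.tendsto.mono_left nhdsWithin_le_nhds).congr' h.symm)

/-- The three Miura equations are multiplied by `(s - p)` to the powers `n + 1`, `2 (n + 1)`, `3 (n
+ 1)` and evaluated at `p`. The powers of `0` treat two cases at once: for `n = 0` every term
survives and the indicial relations result; for `n > 0` only the elementary symmetric functions
remain. -/
theorem miuraEqs_leading {u v U V a b c A B C : ℂ → ℂ} {p : ℂ} {n : ℕ}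
    (hU : AnalyticAt ℂ U p) (hV : AnalyticAt ℂ V p)
    (hu : u =ᶠ[𝓝[≠] p] fun s => U s / (s - p) ^ 2) (hv : v =ᶠ[𝓝[≠] p] fun s => V s / (s - p) ^ 3)
    (hA : AnalyticAt ℂ A p) (hB : AnalyticAt ℂ B p) (hC : AnalyticAt ℂ C p)
    (ha : a =ᶠ[𝓝[≠] p] fun s => A s / (s - p) ^ (n + 1))
    (hb : b =ᶠ[𝓝[≠] p] fun s => B s / (s - p) ^ (n + 1))
    (hc : c =ᶠ[𝓝[≠] p] fun s => C s / (s - p) ^ (n + 1))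
    (h : ∀ᶠ s in 𝓝[≠] p, MiuraEqs u v a b c s) :
    A p + B p + C p = 0 ∧
    0 ^ (2 * n) * U p = -0 ^ n * (n + 1) * (B p + 2 * C p)
      - (A p * B p + A p * C p + B p * C p) ∧
    0 ^ (3 * n) * V p = 0 ^ (2 * n) * ((n + 1) * (n + 2)) * C p
      + 0 ^ n * (n + 1) * (2 * B p * C p + A p * C p) + A p * B p * C p := by
  have hb' := deriv_div_pow hB hb
  have hc' := deriv_div_pow hC hc
  have hC1 : AnalyticAt ℂ (fun s => (s - p) * deriv C s - ((n + 1 : ℕ) : ℂ) * C s) p := by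
    have := hC.deriv
    fun_prop
  have hc'' := deriv_div_pow hC1 hc'
  have hA0 := hA.continuousAt
  have hB0 := hB.continuousAt
  have hC0 := hC.continuousAt
  have hB1 := hB.deriv.continuousAt
  have hC2 := hC.deriv.continuousAt
  have hC3 := hC1.deriv.continuousAt
  have hU0 := hU.continuousAt
  have hV0 := hV.continuousAt
  refine ⟨?_, ?_, ?_⟩
  · refine eq_of_eventuallyEq_nhdsNE (f := fun s => A s + B s + C s) (g := fun _ => 0)
      (by fun_prop) (by fun_prop) ?_
    filter_upwards [h, ha, hb, hc, self_mem_nhdsWithin] with s h1 h2 h3 h4 h5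
    have h6 : s - p ≠ 0 := sub_ne_zero.2 h5
    have := h1.1
    rw [h2, h3, h4] at this
    field_simp at this
    simpa using this
  · have := eq_of_eventuallyEq_nhdsNE (p := p) (f := fun s => (s - p) ^ (2 * n) * U s)
      (g := fun s => (s - p) ^ n * (((s - p) * deriv B s - (n + 1 : ℕ) * B s) +
        2 * ((s - p) * deriv C s - (n + 1 : ℕ) * C s))
        - (A s * B s + A s * C s + B s * C s))
      (by fun_prop) (by fun_prop) ?_
    · simp only [sub_self] at this
      push_cast at this
      rw [this]; ring
    filter_upwards [h, ha, hb, hc, hb', hc', hu, self_mem_nhdsWithin] with s h1 h2 h3 h4 h5 h6 h7 h8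
    have h9 : s - p ≠ 0 := sub_ne_zero.2 h8
    have := h1.2.1
    rw [h2, h3, h4, h5, h6, h7] at this
    rw [show 2 * n = n + n by ring]
    simp only [pow_succ, pow_zero, pow_add, one_mul] at this ⊢
    field_simp at this ⊢
    linear_combination this
  · have := eq_of_eventuallyEq_nhdsNE (p := p) (f := fun s => (s - p) ^ (3 * n) * V s)
      (g := fun s => (s - p) ^ (2 * n) *
        ((s - p) * deriv (fun s => (s - p) * deriv C s - ((n + 1 : ℕ) : ℂ) * C s) s -
          (n + 1 + 1 : ℕ) * ((s - p) * deriv C s - ((n + 1 : ℕ) : ℂ) * C s))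
        - (s - p) ^ n * (((s - p) * deriv B s - (n + 1 : ℕ) * B s) * C s +
        (B s + A s) * ((s - p) * deriv C s - (n + 1 : ℕ) * C s))
        + A s * B s * C s)
      (by fun_prop) (by fun_prop) ?_
    · simp only [sub_self] at this
      push_cast at this
      rw [this]; ring
    filter_upwards [h, ha, hb, hc, hb', hc', hc'', hv, self_mem_nhdsWithin]
      with s h1 h2 h3 h4 h5 h6 h6' h7 h8
    have h9 : s - p ≠ 0 := sub_ne_zero.2 h8
    have := h1.2.2
    rw [h2, h3, h4, h5, h6, h6', h7] at this
    rw [show 3 * n = n + n + n by ring, show 2 * n = n + n by ring]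
    simp only [pow_succ, pow_zero, pow_add, one_mul] at this ⊢
    field_simp at this ⊢
    linear_combination this

/-- Each of the three numbers is a root of the monic cubic with these coefficients, which is `X ^
3`. -/
theorem eq_zero_of_esymm_eq_zero {x y w : ℂ} (h1 : x + y + w = 0) (h2 : x * y + x * w + y * w = 0)
    (h3 : x * y * w = 0) : x = 0 ∧ y = 0 ∧ w = 0 := by
  have hx : x ^ 3 = 0 := by linear_combination x ^ 2 * h1 - x * h2 + h3
  have hy : y ^ 3 = 0 := by linear_combination y ^ 2 * h1 - y * h2 + h3
  have hw : w ^ 3 = 0 := by linear_combination w ^ 2 * h1 - w * h2 + h3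
  simp only [ne_eq, OfNat.ofNat_ne_zero, not_false_eq_true, pow_eq_zero_iff] at hx hy hw
  exact ⟨hx, hy, hw⟩

theorem exists_div_pow_of_eq_zero {g h : ℂ → ℂ} {p : ℂ} {m : ℕ} (hh : AnalyticAt ℂ h p)
    (hg : g =ᶠ[𝓝[≠] p] fun s => h s / (s - p) ^ (m + 1)) (h0 : h p = 0) :
    ∃ k, AnalyticAt ℂ k p ∧ g =ᶠ[𝓝[≠] p] fun s => k s / (s - p) ^ m := by
  obtain ⟨q, hq⟩ := hh
  refine ⟨dslope h p, hq.has_fpower_series_dslope_fslope.analyticAt, ?_⟩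
  filter_upwards [hg, self_mem_nhdsWithin] with s h1 h2
  have h3 : s - p ≠ 0 := sub_ne_zero.2 h2
  have h4 := sub_smul_dslope h p s
  rw [h0, sub_zero, smul_eq_mul] at h4
  rw [h1, ← h4]
  field_simp
  ring

/-- At a regular singular point the factors of `∂³ - u ∂ - v` have at most simple poles. -/
theorem exists_simple_pole_of_miuraEqs {u v U V a b c : ℂ → ℂ} {p : ℂ}
    (hU : AnalyticAt ℂ U p) (hV : AnalyticAt ℂ V p)
    (hu : u =ᶠ[𝓝[≠] p] fun s => U s / (s - p) ^ 2) (hv : v =ᶠ[𝓝[≠] p] fun s => V s / (s - p) ^ 3)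
    (ha : MeromorphicAt a p) (hb : MeromorphicAt b p) (hc : MeromorphicAt c p)
    (h : ∀ᶠ s in 𝓝[≠] p, MiuraEqs u v a b c s) :
    ∃ A B C : ℂ → ℂ, AnalyticAt ℂ A p ∧ AnalyticAt ℂ B p ∧ AnalyticAt ℂ C p ∧
      (a =ᶠ[𝓝[≠] p] fun s => A s / (s - p)) ∧ (b =ᶠ[𝓝[≠] p] fun s => B s / (s - p)) ∧
      (c =ᶠ[𝓝[≠] p] fun s => C s / (s - p)) ∧ A p + B p + C p = 0 ∧
      U p = c1 ![A p, B p, C p] ∧ V p = c2 ![A p, B p, C p] := by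
  -- Descent on the common pole order: above order one the leading coefficients vanish, so a factor
  -- `s - p` cancels.
  have key : ∀ n : ℕ, (∃ A B C : ℂ → ℂ, AnalyticAt ℂ A p ∧ AnalyticAt ℂ B p ∧ AnalyticAt ℂ C p ∧
      (a =ᶠ[𝓝[≠] p] fun s => A s / (s - p) ^ (n + 1)) ∧
      (b =ᶠ[𝓝[≠] p] fun s => B s / (s - p) ^ (n + 1)) ∧
      (c =ᶠ[𝓝[≠] p] fun s => C s / (s - p) ^ (n + 1))) →
      ∃ A B C : ℂ → ℂ, AnalyticAt ℂ A p ∧ AnalyticAt ℂ B p ∧ AnalyticAt ℂ C p ∧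
      (a =ᶠ[𝓝[≠] p] fun s => A s / (s - p) ^ (0 + 1)) ∧
      (b =ᶠ[𝓝[≠] p] fun s => B s / (s - p) ^ (0 + 1)) ∧
      (c =ᶠ[𝓝[≠] p] fun s => C s / (s - p) ^ (0 + 1)) := by
    intro n
    induction n with
    | zero => exact id
    | succ n ih =>
      rintro ⟨A, B, C, hA, hB, hC, ha', hb', hc'⟩
      obtain ⟨e1, e2, e3⟩ := miuraEqs_leading hU hV hu hv hA hB hC ha' hb' hc' h
      obtain ⟨z1, z2, z3⟩ := eq_zero_of_esymm_eq_zero e1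
        (by simp [pow_succ, mul_add] at e2; linear_combination e2)
        (by simpa [pow_succ, mul_add] using e3)
      obtain ⟨A', hA', ha''⟩ := exists_div_pow_of_eq_zero hA ha' z1
      obtain ⟨B', hB', hb''⟩ := exists_div_pow_of_eq_zero hB hb' z2
      obtain ⟨C', hC', hc''⟩ := exists_div_pow_of_eq_zero hC hc' z3
      exact ih ⟨A', B', C', hA', hB', hC', ha'', hb'', hc''⟩
  have start : ∀ {g : ℂ → ℂ} {n : ℕ} (m : ℕ), AnalyticAt ℂ (fun s => (s - p) ^ n • g s) p → n ≤ m →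
      ∃ A, AnalyticAt ℂ A p ∧ g =ᶠ[𝓝[≠] p] fun s => A s / (s - p) ^ m := by
    intro g n m hg hnm
    refine ⟨fun s => (s - p) ^ (m - n) * ((s - p) ^ n • g s), by fun_prop, ?_⟩
    filter_upwards [self_mem_nhdsWithin] with s hs
    have : s - p ≠ 0 := sub_ne_zero.2 hs
    rw [smul_eq_mul, ← mul_assoc, ← pow_add, Nat.sub_add_cancel hnm]
    field_simp
  obtain ⟨n1, h1⟩ := ha
  obtain ⟨n2, h2⟩ := hb
  obtain ⟨n3, h3⟩ := hc
  -- This exponent dominates all three pole orders and is a successor, as `key` requires.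
  obtain ⟨A, hA, ha⟩ := start (n1 + n2 + n3 + 1) h1 (by omega)
  obtain ⟨B, hB, hb⟩ := start (n1 + n2 + n3 + 1) h2 (by omega)
  obtain ⟨C, hC, hc⟩ := start (n1 + n2 + n3 + 1) h3 (by omega)
  obtain ⟨A, B, C, hA, hB, hC, ha, hb, hc⟩ := key _ ⟨A, B, C, hA, hB, hC, ha, hb, hc⟩
  obtain ⟨e1, e2, e3⟩ := miuraEqs_leading hU hV hu hv hA hB hC ha hb hc h
  refine ⟨A, B, C, hA, hB, hC, by simpa using ha, by simpa using hb, by simpa using hc, e1, ?_, ?_⟩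
  · simp [c1, rhoBar, Fin.sum_univ_three] at e2 ⊢
    linear_combination e2 - (A p + B p + C p) * e1 / 2 - e1
  · simp [c2, rhoBar, Fin.prod_univ_three] at e3 ⊢
    linear_combination e3 

section

/-! ### The coefficients near a point -/

section Coeff

variable {N : ℕ} {z : Fin N → ℂ} {lam : Fin N → Fin 3 → ℂ} {μ ν κ : Fin N → ℂ}

/-- The weight attached to a point: `λᵢ` at `zᵢ`, and `0` elsewhere. -/
def localWeight (z : Fin N → ℂ) (lam : Fin N → Fin 3 → ℂ) (p : ℂ) : Fin 3 → ℂ :=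
  ∑ i, if z i = p then lam i else 0

theorem localWeight_apply (hz : Function.Injective z) (i : Fin N) :
    localWeight z lam (z i) = lam i := by
  simp [localWeight, hz.eq_iff]

theorem localWeight_of_notMem {p : ℂ} (hp : p ∉ Set.range z) : localWeight z lam p = 0 :=
  Finset.sum_eq_zero fun i _ => if_neg fun h => hp ⟨i, h⟩

theorem IsDominantIntegral.sum_eq_zero {l : Fin 3 → ℂ} (h : IsDominantIntegral l) :
    ∑ k, l k = 0 := by
  obtain ⟨a, b, rfl⟩ := h
  simp [Fin.sum_univ_three, omega1, omega2]
  ring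

theorem sum_localWeight (hlam : ∀ i, ∑ k, lam i k = 0) (p : ℂ) :
    ∑ k, localWeight z lam p k = 0 := by
  simp only [localWeight, Finset.sum_apply]
  rw [Finset.sum_comm]
  refine Finset.sum_eq_zero fun i _ => ?_
  split_ifs
  · exact hlam i
  · simp

theorem c1_zero : c1 0 = 0 := by simp [c1]

theorem c2_zero : c2 0 = 0 := by simp [c2, rhoBar, Fin.prod_univ_three]

theorem sum_localWeight_eq {F : (Fin 3 → ℂ) → ℂ} (hF : F 0 = 0) (hz : Function.Injective z)
    (p : ℂ) : ∑ i, (if z i = p then F (lam i) else 0) = F (localWeight z lam p) := by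
  by_cases hp : p ∈ Set.range z
  · obtain ⟨j, rfl⟩ := hp
    simp [localWeight_apply hz, hz.eq_iff]
  · rw [localWeight_of_notMem hp, hF]
    exact Finset.sum_eq_zero fun i _ => if_neg fun h => hp ⟨i, h⟩

/-- Every point is treated as a possible double pole, with weight `0` off the `z i`. Singular and
regular points then share one local analysis. -/
theorem exists_coeffU_eq (hz : Function.Injective z) (p : ℂ) :
    ∃ U, AnalyticAt ℂ U p ∧ (coeffU z lam μ =ᶠ[𝓝[≠] p] fun s => U s / (s - p) ^ 2) ∧
      U p = c1 (localWeight z lam p) := by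
  refine ⟨fun s => ∑ i, if z i = p then c1 (lam i) + μ i * (s - p) else
    (s - p) ^ 2 * (c1 (lam i) / (s - z i) ^ 2 + μ i / (s - z i)), ?_, ?_, ?_⟩
  · refine Finset.analyticAt_fun_sum _ fun i _ => ?_
    split_ifs with h
    · fun_prop
    · have : p - z i ≠ 0 := sub_ne_zero.2 (Ne.symm h)
      fun_prop (disch := simpa)
  · filter_upwards [self_mem_nhdsWithin] with s hs
    have : s - p ≠ 0 := sub_ne_zero.2 hs
    rw [coeffU, Finset.sum_div]
    refine Finset.sum_congr rfl fun i _ => ?_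
    split_ifs with h
    · rw [h]; field_simp
    · field_simp
  · rw [← sum_localWeight_eq c1_zero hz]
    refine Finset.sum_congr rfl fun i _ => ?_
    split_ifs <;> simp

theorem exists_coeffV_eq (hz : Function.Injective z) (p : ℂ) :
    ∃ V, AnalyticAt ℂ V p ∧ (coeffV z lam ν κ =ᶠ[𝓝[≠] p] fun s => V s / (s - p) ^ 3) ∧
      V p = c2 (localWeight z lam p) := by
  refine ⟨fun s => ∑ i, if z i = p then c2 (lam i) + ν i * (s - p) + κ i * (s - p) ^ 2 else
    (s - p) ^ 3 * (c2 (lam i) / (s - z i) ^ 3 + ν i / (s - z i) ^ 2 + κ i / (s - z i)), ?_, ?_, ?_⟩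
  · refine Finset.analyticAt_fun_sum _ fun i _ => ?_
    split_ifs with h
    · fun_prop
    · have : p - z i ≠ 0 := sub_ne_zero.2 (Ne.symm h)
      fun_prop (disch := simpa)
  · filter_upwards [self_mem_nhdsWithin] with s hs
    have : s - p ≠ 0 := sub_ne_zero.2 hs
    rw [coeffV, Finset.sum_div]
    refine Finset.sum_congr rfl fun i _ => ?_
    split_ifs with h
    · rw [h]; field_simp
    · field_simp
  · rw [← sum_localWeight_eq c2_zero hz]
    refine Finset.sum_congr rfl fun i _ => ?_
    split_ifs <;> simp

theorem analyticAt_coeffU {p : ℂ} (hp : p ∉ Set.range z) : AnalyticAt ℂ (coeffU z lam μ) p := by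
  refine Finset.analyticAt_fun_sum _ fun i _ => ?_
  have : p - z i ≠ 0 := sub_ne_zero.2 fun h => hp ⟨i, h.symm⟩
  fun_prop (disch := simpa)

theorem analyticAt_coeffV {p : ℂ} (hp : p ∉ Set.range z) : AnalyticAt ℂ (coeffV z lam ν κ) p := by
  refine Finset.analyticAt_fun_sum _ fun i _ => ?_
  have : p - z i ≠ 0 := sub_ne_zero.2 fun h => hp ⟨i, h.symm⟩
  fun_prop (disch := simpa)

end Coeff

/-! ### Permutations of exponents -/

/-- The values at `e = 0, 1, -1` give equality of the elementary symmetric functions. The value at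
`e = x 0` matches `x 0` with some `y a`, and the two remaining roots have equal sum and product. -/
theorem exists_perm_of_prod_eq {x y : Fin 3 → ℂ}
    (h : ∀ e, (e - x 0) * (e - x 1) * (e - x 2) = (e - y 0) * (e - y 1) * (e - y 2)) :
    ∃ σ : Equiv.Perm (Fin 3), ∀ k, x k = y (σ k) := by
  have h0 := h 0
  have h1 := h 1
  have h2 := h (-1)
  have s1 : x 0 + x 1 + x 2 = y 0 + y 1 + y 2 := by linear_combination h0 - (h1 + h2) / 2
  have s3 : x 0 * x 1 * x 2 = y 0 * y 1 * y 2 := by linear_combination -h0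
  have s2 : x 0 * x 1 + x 0 * x 2 + x 1 * x 2 = y 0 * y 1 + y 0 * y 2 + y 1 * y 2 := by
    linear_combination (h1 - h2) / 2
  have main : ∀ a b c : Fin 3, x 0 = y a → y a + y b + y c = y 0 + y 1 + y 2 →
      y a * y b + y a * y c + y b * y c = y 0 * y 1 + y 0 * y 2 + y 1 * y 2 →
      x 1 = y b ∧ x 2 = y c ∨ x 1 = y c ∧ x 2 = y b := by
    intro a b c ha e1 e2
    have e3 : (x 1 - y b) * (x 1 - y c) = 0 := by
      linear_combination (x 1 + y a) * s1 - s2 - (x 1 + y a) * e1 + e2 + (x 2 - y a) * ha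
    rcases mul_eq_zero.1 e3 with e4 | e4
    · exact .inl ⟨sub_eq_zero.1 e4, by linear_combination s1 - e1 - e4 - ha⟩
    · exact .inr ⟨sub_eq_zero.1 e4, by linear_combination s1 - e1 - e4 - ha⟩
  have h3 := h (x 0)
  rw [sub_self, zero_mul, zero_mul, eq_comm, mul_eq_zero, mul_eq_zero, sub_eq_zero, sub_eq_zero,
    sub_eq_zero] at h3
  rcases h3 with (h3 | h3) | h3
  · rcases main 0 1 2 h3 (by ring) (by ring) with ⟨h4, h5⟩ | ⟨h4, h5⟩
    · exact ⟨1, fun k => by fin_cases k <;> assumption⟩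
    · exact ⟨Equiv.swap 1 2, fun k => by fin_cases k <;> assumption⟩
  · rcases main 1 0 2 h3 (by ring) (by ring) with ⟨h4, h5⟩ | ⟨h4, h5⟩
    · exact ⟨Equiv.swap 0 1, fun k => by fin_cases k <;> assumption⟩
    · exact ⟨Equiv.swap 0 1 * Equiv.swap 1 2, fun k => by fin_cases k <;> assumption⟩
  · rcases main 2 0 1 h3 (by ring) (by ring) with ⟨h4, h5⟩ | ⟨h4, h5⟩
    · exact ⟨Equiv.swap 1 2 * Equiv.swap 0 1, fun k => by fin_cases k <;> assumption⟩
    · exact ⟨Equiv.swap 0 2, fun k => by fin_cases k <;> assumption⟩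

/-- By `indicial`, the numbers `c1 l`, `c2 l` determine the monic cubic whose roots are the entries
of `l + rhoBar + 1`. -/
theorem exists_weylDot_eq {r l : Fin 3 → ℂ} (hr : ∑ k, r k = 0) (hl : ∑ k, l k = 0)
    (h1 : c1 r = c1 l) (h2 : c2 r = c2 l) : ∃ σ, r = weylDot σ l := by
  obtain ⟨σ, hσ⟩ := exists_perm_of_prod_eq (x := r + rhoBar + 1) (y := l + rhoBar + 1) fun e => by
    have e1 := indicial r hr e
    have e2 := indicial l hl e
    rw [h1, h2, e2] at e1
    simp only [rhoBar, Pi.add_apply, Pi.one_apply, Matrix.cons_val]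
    linear_combination -e1
  -- `weyl s` reads the entry at `s⁻¹ k`, so the matching permutation has to be inverted.
  refine ⟨σ⁻¹, funext fun k => ?_⟩
  have := hσ k
  simp only [weylDot, weyl, Pi.sub_apply, Pi.add_apply, inv_inv, Pi.one_apply] at this ⊢
  linear_combination this

/-! ### Rational functions as functions -/

/-- The function defined by a rational function. -/
abbrev ev (χ : RatFunc ℂ) (t : ℂ) : ℂ := χ.eval (RingHom.id ℂ) t

theorem ev_eq (χ : RatFunc ℂ) (t : ℂ) : ev χ t = χ.num.eval t / χ.denom.eval t := rfl

theorem analyticAt_eval (p : Polynomial ℂ) (t : ℂ) : AnalyticAt ℂ (fun s => p.eval s) t :=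
  (Polynomial.differentiable p).analyticAt t

theorem analyticAt_ev {χ : RatFunc ℂ} {t : ℂ} (h : χ.denom.eval t ≠ 0) : AnalyticAt ℂ (ev χ) t :=
  (analyticAt_eval _ t).div (analyticAt_eval _ t) h

theorem meromorphicAt_ev (χ : RatFunc ℂ) (t : ℂ) : MeromorphicAt (ev χ) t :=
  (analyticAt_eval _ t).meromorphicAt.div (analyticAt_eval _ t).meromorphicAt

theorem eventually_eval_ne_zero {p : Polynomial ℂ} (hp : p ≠ 0) :
    ∀ᶠ t in cofinite, p.eval t ≠ 0 := by
  have := p.roots.toFinset.finite_toSet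
  filter_upwards [this.compl_mem_cofinite] with t ht h
  exact ht (by simp [hp, h])

theorem eventually_denom_ne_zero (χ : RatFunc ℂ) : ∀ᶠ t in cofinite, χ.denom.eval t ≠ 0 :=
  eventually_eval_ne_zero χ.denom_ne_zero

/-- Evaluation takes a default value at a pole, so it respects sums and products only off a finite
set. All passages between rational functions and functions are therefore made along `cofinite`. -/
theorem ev_add (χ ψ : RatFunc ℂ) : ev (χ + ψ) =ᶠ[cofinite] fun t => ev χ t + ev ψ t := by
  filter_upwards [eventually_denom_ne_zero χ, eventually_denom_ne_zero ψ] with t h1 h2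
  exact RatFunc.eval_add (RingHom.id ℂ) t h1 h2

theorem ev_mul (χ ψ : RatFunc ℂ) : ev (χ * ψ) =ᶠ[cofinite] fun t => ev χ t * ev ψ t := by
  filter_upwards [eventually_denom_ne_zero χ, eventually_denom_ne_zero ψ] with t h1 h2
  exact RatFunc.eval_mul (RingHom.id ℂ) t h1 h2

theorem ev_sum {ι : Type*} (s : Finset ι) (χ : ι → RatFunc ℂ) :
    ev (∑ i ∈ s, χ i) =ᶠ[cofinite] fun t => ∑ i ∈ s, ev (χ i) t := by
  classical
  induction s using Finset.induction_on with
  | empty => exact .of_forall fun t => by simp [ev]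
  | insert a s ha ih =>
    filter_upwards [ih, ev_add (χ a) (∑ i ∈ s, χ i)] with t h1 h2
    rw [Finset.sum_insert ha, Finset.sum_insert ha, h2, h1]

theorem ev_algebraMap (p : Polynomial ℂ) (t : ℂ) :
    ev (algebraMap (Polynomial ℂ) (RatFunc ℂ) p) t = p.eval t := by
  simp [ev, RatFunc.eval]

theorem ev_div_algebraMap (p q : Polynomial ℂ) (hq : q ≠ 0) :
    ev (algebraMap (Polynomial ℂ) (RatFunc ℂ) p / algebraMap (Polynomial ℂ) (RatFunc ℂ) q)
      =ᶠ[cofinite] fun t => p.eval t / q.eval t := by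
  have hq' : algebraMap (Polynomial ℂ) (RatFunc ℂ) q ≠ 0 := RatFunc.algebraMap_ne_zero hq
  filter_upwards [ev_mul (algebraMap (Polynomial ℂ) (RatFunc ℂ) p /
    algebraMap (Polynomial ℂ) (RatFunc ℂ) q)
    (algebraMap (Polynomial ℂ) (RatFunc ℂ) q), eventually_eval_ne_zero hq] with t h1 h2
  rw [div_mul_cancel₀ _ hq', ev_algebraMap, ev_algebraMap] at h1
  rw [eq_div_iff h2, h1]

theorem ev_simpleFraction (c p : ℂ) :
    ev (RatFunc.C c / (RatFunc.X - RatFunc.C p)) =ᶠ[cofinite] fun t => c / (t - p) := by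
  have := ev_div_algebraMap (Polynomial.C c) (Polynomial.X - Polynomial.C p)
    (Polynomial.X_sub_C_ne_zero p)
  simpa using this

/-- A rational function that is bounded near every point is a polynomial. -/
theorem exists_algebraMap_eq_of_bounded (χ : RatFunc ℂ)
    (h : ∀ p, ∃ M : ℝ, ∀ᶠ t in 𝓝[≠] p, ‖ev χ t‖ ≤ M) :
    ∃ q : Polynomial ℂ, χ = algebraMap (Polynomial ℂ) (RatFunc ℂ) q := by
  have hroot : ∀ p, χ.denom.eval p ≠ 0 := by
    intro p hp
    obtain ⟨M, hM⟩ := h p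
    -- Numerator and denominator are coprime, so at a root of the denominator the quotient is
    -- unbounded.
    have hnum : χ.num.eval p ≠ 0 := by
      intro hn
      obtain ⟨a, b, hab⟩ := χ.isCoprime_num_denom
      have := congrArg (Polynomial.eval p) hab
      simp [hn, hp] at this
    have h1 : ∀ᶠ t in 𝓝[≠] p, ‖χ.num.eval t‖ ≤ M * ‖χ.denom.eval t‖ := by
      filter_upwards [hM, (eventually_denom_ne_zero χ).filter_mono (nhdsNE_le_cofinite p)]
        with t h2 h3
      rw [ev_eq, norm_div, div_le_iff₀ (norm_pos_iff.2 h3)] at h2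
      exact h2
    have h2 : Tendsto (fun t => ‖χ.num.eval t‖) (𝓝[≠] p) (𝓝 ‖χ.num.eval p‖) :=
      (analyticAt_eval χ.num p).continuousAt.norm.tendsto.mono_left nhdsWithin_le_nhds
    have h3 : Tendsto (fun t => M * ‖χ.denom.eval t‖) (𝓝[≠] p) (𝓝 (M * ‖χ.denom.eval p‖)) :=
      ((analyticAt_eval χ.denom p).continuousAt.norm.const_mul M).tendsto.mono_left
        nhdsWithin_le_nhds
    have h4 := le_of_tendsto_of_tendsto h2 h3 h1
    rw [hp, norm_zero, mul_zero] at h4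
    exact hnum (norm_le_zero_iff.1 h4)
  have hdeg : χ.denom.degree = 0 := by
    by_contra hd
    obtain ⟨p, hp⟩ := IsAlgClosed.exists_root χ.denom hd
    exact hroot p hp
  have hd1 : χ.denom = 1 := by
    rw [Polynomial.eq_C_of_degree_eq_zero hdeg]
    have := χ.monic_denom
    rw [Polynomial.eq_C_of_degree_eq_zero hdeg] at this
    rw [show χ.denom.coeff 0 = 1 by simpa [Polynomial.Monic] using this, map_one]
  refine ⟨χ.num, ?_⟩
  conv_lhs => rw [← RatFunc.num_div_denom χ]
  rw [hd1, map_one, div_one]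

end

section

/-! ### Behaviour at infinity -/

/-- A set with finite complement is open, so equality on it passes to derivatives. -/
theorem EventuallyEq.cofinite_deriv {f g : ℂ → ℂ} (h : f =ᶠ[cofinite] g) :
    deriv f =ᶠ[cofinite] deriv g := by
  have hfin : {t | f t = g t}ᶜ.Finite := h
  have ho : IsOpen {t | f t = g t} := by
    rw [← compl_compl {t | f t = g t}]
    exact hfin.isClosed.isOpen_compl
  filter_upwards [h] with t ht
  exact EventuallyEq.deriv_eq (ho.mem_nhds ht)

theorem tendsto_div_sub_pow_cobounded (c p : ℂ) (n : ℕ) :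
    Tendsto (fun t => c / (t - p) ^ (n + 1)) (Bornology.cobounded ℂ) (𝓝 0) := by
  have h1 : Tendsto (fun t : ℂ => t - p) (Bornology.cobounded ℂ) (Bornology.cobounded ℂ) := by
    simp
  have h2 := ((tendsto_inv₀_cobounded.comp h1).pow (n + 1)).const_mul c
  simpa [div_eq_mul_inv] using h2

theorem tendsto_eval_div_pow_cobounded {q : Polynomial ℂ} {m : ℕ} (hq : q.natDegree ≤ m) :
    Tendsto (fun t => q.eval t * t⁻¹ ^ m) (Bornology.cobounded ℂ) (𝓝 (q.coeff m)) := by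
  have h1 : ∀ j ∈ Finset.range (m + 1), Tendsto (fun t : ℂ => q.coeff j * t⁻¹ ^ (m - j))
      (Bornology.cobounded ℂ) (𝓝 (if j = m then q.coeff m else 0)) := by
    intro j hj
    have h2 := ((tendsto_inv₀_cobounded (α := ℂ)).pow (m - j)).const_mul (q.coeff j)
    rw [Finset.mem_range] at hj
    split_ifs with h
    · subst h
      simp
    · rw [zero_pow (by omega), mul_zero] at h2
      exact h2
  have h2 := tendsto_finsetSum _ h1
  rw [Finset.sum_ite_eq' , if_pos (by simp)] at h2
  refine h2.congr' ?_
  filter_upwards [Bornology.le_cofinite ℂ (Set.finite_singleton (0 : ℂ)).compl_mem_cofinite]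
    with t ht
  have ht : t ≠ 0 := ht
  rw [Polynomial.eval_eq_sum_range' (Nat.lt_succ_of_le hq), Finset.sum_mul]
  refine Finset.sum_congr rfl fun j hj => ?_
  rw [Finset.mem_range] at hj
  rw [mul_assoc]
  congr 1
  obtain ⟨d, rfl⟩ := Nat.exists_eq_add_of_le (Nat.lt_succ_iff.1 hj)
  rw [pow_add, Nat.add_sub_cancel_left, ← mul_assoc, ← mul_pow, mul_inv_cancel₀ ht, one_pow, one_mul]

/-- A polynomial plus simple fractions. -/
def polyFrac (T : Finset ℂ) (r : ℂ → ℂ) (q : Polynomial ℂ) (n : ℕ) (t : ℂ) : ℂ :=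
  q.eval t + ∑ p ∈ T, r p / (t - p) ^ (n + 1)

theorem deriv_polyFrac (T : Finset ℂ) (r : ℂ → ℂ) (q : Polynomial ℂ) (n : ℕ) :
    deriv (polyFrac T r q n) =ᶠ[cofinite]
      polyFrac T (fun p => -(n + 1) * r p) (Polynomial.derivative q) (n + 1) := by
  filter_upwards [T.finite_toSet.compl_mem_cofinite] with t ht
  refine ((Polynomial.hasDerivAt q t).add (HasDerivAt.fun_sum fun p hp => ?_)).deriv
  have h0 : t - p ≠ 0 := sub_ne_zero.2 fun h => ht (h ▸ hp)
  refine ((hasDerivAt_const t (r p)).div (((hasDerivAt_id t).sub_const p).pow (n + 1))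
    (pow_ne_zero _ h0)).congr_deriv ?_
  simp
  field_simp
  ring

theorem tendsto_polyFrac (T : Finset ℂ) (r : ℂ → ℂ) {q : Polynomial ℂ} (n : ℕ) {m : ℕ}
    (hq : q.natDegree ≤ m) :
    Tendsto (fun t => polyFrac T r q n t * t⁻¹ ^ m) (Bornology.cobounded ℂ) (𝓝 (q.coeff m)) := by
  have h1 := tendsto_finsetSum T fun p _ => tendsto_div_sub_pow_cobounded (r p) p n
  have h2 := (tendsto_eval_div_pow_cobounded hq).add
    (h1.mul ((tendsto_inv₀_cobounded (α := ℂ)).pow m))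
  simpa [polyFrac, add_mul] using h2

theorem tendsto_zero_of_regularSingularAtInfty {u : ℂ → ℂ} {n : ℕ}
    (h : u =O[Bornology.cobounded ℂ] fun t => (t ^ (n + 1))⁻¹) :
    Tendsto u (Bornology.cobounded ℂ) (𝓝 0) := by
  refine h.trans_tendsto ?_
  simpa using tendsto_div_sub_pow_cobounded 1 0 n

/-- The counterpart at infinity of `miuraEqs_leading`. The Miura equations are divided by `t ^ m`,
`t ^ (2 m)`, `t ^ (3 m)`. Derivatives do not contribute, and `u`, `v` tend to zero, so the
elementary symmetric functions of the coefficients of degree `m` vanish. Decay of `u` and `v` is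
what makes this work for constants, `m = 0`. -/
theorem coeff_eq_zero_of_miuraEqs {u v : ℂ → ℂ} (huv : RegularSingularAtInfty u v) {T : Finset ℂ}
    {r : Fin 3 → ℂ → ℂ} {q : Fin 3 → Polynomial ℂ} {m : ℕ} (hq : ∀ k, (q k).natDegree ≤ m)
    {g : Fin 3 → ℂ → ℂ} (hg : ∀ k, g k =ᶠ[cofinite] polyFrac T (r k) (q k) 0)
    (h : ∀ᶠ t in cofinite, MiuraEqs u v (g 0) (g 1) (g 2) t) (k : Fin 3) : (q k).coeff m = 0 := by
  have hd : ∀ k, deriv (g k) =ᶠ[cofinite] _ := fun k =>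
    (EventuallyEq.cofinite_deriv (hg k)).trans (deriv_polyFrac _ _ _ _)
  have hdd : ∀ k, deriv (deriv (g k)) =ᶠ[cofinite] _ := fun k =>
    (EventuallyEq.cofinite_deriv (hd k)).trans (deriv_polyFrac _ _ _ _)
  have hle := Bornology.le_cofinite ℂ
  have hdeg : ∀ {p : Polynomial ℂ}, p.natDegree ≤ m → (Polynomial.derivative p).natDegree ≤ m :=
    fun hp => (Polynomial.natDegree_derivative_le _).trans ((Nat.sub_le _ _).trans hp)
  have hcoe : ∀ {p : Polynomial ℂ}, p.natDegree ≤ m → (Polynomial.derivative p).coeff m = 0 :=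
    fun {p} hp => by
      rw [Polynomial.coeff_derivative, Polynomial.coeff_eq_zero_of_natDegree_lt (by omega), zero_mul]
  have t0 : ∀ k, Tendsto (fun t => g k t * t⁻¹ ^ m) (Bornology.cobounded ℂ) (𝓝 ((q k).coeff m)) :=
    fun k => (tendsto_polyFrac T (r k) 0 (hq k)).congr'
      (((hg k).filter_mono hle).mono fun t ht => by simp only [ht])
  have t1 : ∀ k, Tendsto (fun t => deriv (g k) t * t⁻¹ ^ m) (Bornology.cobounded ℂ) (𝓝 0) :=
    fun k => hcoe (hq k) ▸ (tendsto_polyFrac T (fun p => -((0 : ℕ) + 1) * r k p) (0 + 1)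
      (hdeg (hq k))).congr' (((hd k).filter_mono hle).mono fun t ht => by simp only [ht])
  have t2 : ∀ k, Tendsto (fun t => deriv (deriv (g k)) t * t⁻¹ ^ m) (Bornology.cobounded ℂ) (𝓝 0) :=
    fun k => hcoe (hdeg (hq k)) ▸ (tendsto_polyFrac T
      (fun p => -((0 + 1 : ℕ) + 1) * (-((0 : ℕ) + 1) * r k p)) (0 + 1 + 1)
      (hdeg (hdeg (hq k)))).congr' (((hdd k).filter_mono hle).mono fun t ht => by simp only [ht])
  have tm := (tendsto_inv₀_cobounded (α := ℂ)).pow m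
  have tu := (tendsto_zero_of_regularSingularAtInfty huv.1).mul (tm.mul tm)
  have tv := (tendsto_zero_of_regularSingularAtInfty huv.2).mul (tm.mul (tm.mul tm))
  have h' := h.filter_mono hle
  have e1 : (q 0).coeff m + (q 1).coeff m + (q 2).coeff m = 0 := by
    refine tendsto_nhds_unique (((t0 0).add (t0 1)).add (t0 2)) (tendsto_const_nhds.congr' ?_)
    filter_upwards [h'] with t ht
    linear_combination (-t⁻¹ ^ m) * ht.1
  have e2 : (q 0).coeff m * (q 1).coeff m + (q 0).coeff m * (q 2).coeff m +
      (q 1).coeff m * (q 2).coeff m = 0 := by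
    have e := tendsto_nhds_unique tu (((((t1 1).mul tm).add
      (((t1 2).mul tm).const_mul 2)).sub ((((t0 0).mul (t0 1)).add ((t0 0).mul (t0 2))).add
      ((t0 1).mul (t0 2)))).congr' ?_)
    · linear_combination e
    filter_upwards [h'] with t ht
    linear_combination (-(t⁻¹ ^ m * t⁻¹ ^ m)) * ht.2.1
  have e3 : (q 0).coeff m * (q 1).coeff m * (q 2).coeff m = 0 := by
    have e := tendsto_nhds_unique tv ((((((t2 2).mul (tm.mul tm)).sub
      ((((t1 1).mul (t0 2)).mul tm).add (((t0 1).mul (t1 2)).mul tm))).sub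
      (((t0 0).mul (t1 2)).mul tm)).add (((t0 0).mul (t0 1)).mul (t0 2))).congr' ?_)
    · linear_combination -e
    filter_upwards [h'] with t ht
    linear_combination (-(t⁻¹ ^ m * t⁻¹ ^ m * t⁻¹ ^ m)) * ht.2.2
  obtain ⟨z0, z1, z2⟩ := eq_zero_of_esymm_eq_zero e1 e2 e3
  fin_cases k <;> assumption

theorem polynomial_eq_zero_of_miuraEqs {u v : ℂ → ℂ} (huv : RegularSingularAtInfty u v)
    {T : Finset ℂ} {r : Fin 3 → ℂ → ℂ} {q : Fin 3 → Polynomial ℂ}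
    {g : Fin 3 → ℂ → ℂ} (hg : ∀ k, g k =ᶠ[cofinite] polyFrac T (r k) (q k) 0)
    (h : ∀ᶠ t in cofinite, MiuraEqs u v (g 0) (g 1) (g 2) t) (k : Fin 3) : q k = 0 := by
  have key : ∀ m : ℕ, (∀ k, (q k).natDegree ≤ m) → ∀ k, q k = 0 := by
    intro m
    induction m with
    | zero =>
      intro hm k
      have := coeff_eq_zero_of_miuraEqs huv hm hg h k
      rw [Polynomial.eq_C_of_natDegree_le_zero (hm k), this, map_zero]
    | succ m ih =>
      refine fun hm => ih fun k => ?_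
      have := coeff_eq_zero_of_miuraEqs huv hm hg h k
      refine Polynomial.natDegree_le_iff_coeff_eq_zero.2 fun n hn => ?_
      rcases (Nat.succ_le_of_lt hn).eq_or_lt with rfl | hn'
      · exact this
      · exact Polynomial.coeff_eq_zero_of_natDegree_lt ((hm k).trans_lt hn')
  exact key _ (fun k => Finset.le_sup (f := fun k => (q k).natDegree) (Finset.mem_univ k)) k

/-! ### Partial fractions of the factors -/

theorem bounded_of_continuousAt {f g : ℂ → ℂ} {p : ℂ} (hg : ContinuousAt g p)
    (h : f =ᶠ[𝓝[≠] p] g) : ∃ M : ℝ, ∀ᶠ t in 𝓝[≠] p, ‖f t‖ ≤ M := by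
  refine ⟨‖g p‖ + 1, ?_⟩
  filter_upwards [h, (hg.norm.eventually_le_const (lt_add_one _)).filter_mono nhdsWithin_le_nhds]
    with t h1 h2
  rwa [h1]

section Main

variable {N : ℕ} {z : Fin N → ℂ} {lam : Fin N → Fin 3 → ℂ} {μ ν κ : Fin N → ℂ}
  {χ : Fin 3 → RatFunc ℂ}

theorem IsMiura.eventually_miuraEqs {u v : ℂ → ℂ} {S : Set ℂ} (hS : S.Finite)
    (h : IsMiura u v S χ) :
    ∀ᶠ t in cofinite, MiuraEqs u v (ev (χ 0)) (ev (χ 1)) (ev (χ 2)) t := by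
  filter_upwards [hS.compl_mem_cofinite, eventually_denom_ne_zero (χ 0),
    eventually_denom_ne_zero (χ 1), eventually_denom_ne_zero (χ 2)] with t h1 h2 h3 h4
  refine MiuraEqs.of_forall_oper_eq (analyticAt_ev h3) (analyticAt_ev h4) fun f hf => ?_
  exact h t h1 (fun k => by fin_cases k <;> assumption) f hf

/-- `r` is the vector of residues of `χ` at `p`, where the `χₖ` have at most simple poles. -/
def HasResidue (χ : Fin 3 → RatFunc ℂ) (p : ℂ) (r : Fin 3 → ℂ) : Prop :=
  ∀ k, ∃ A : ℂ → ℂ, AnalyticAt ℂ A p ∧ (ev (χ k) =ᶠ[𝓝[≠] p] fun s => A s / (s - p)) ∧ A p = r k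

/-- The local core of part (ii). At a regular point the weight is `0` and the residue is `σ(ρ̄) -
ρ̄`: these are the additional poles `w`. -/
theorem IsMiura.exists_hasResidue (hz : Function.Injective z) (hlam : ∀ i, ∑ k, lam i k = 0)
    (h : IsMiura (coeffU z lam μ) (coeffV z lam ν κ) (Set.range z) χ) (p : ℂ) :
    ∃ σ, HasResidue χ p (weylDot σ (localWeight z lam p)) := by
  obtain ⟨U, hU, hu, hU0⟩ := exists_coeffU_eq (lam := lam) (μ := μ) hz p
  obtain ⟨V, hV, hv, hV0⟩ := exists_coeffV_eq (lam := lam) (ν := ν) (κ := κ) hz p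
  obtain ⟨A, B, C, hA, hB, hC, ha, hb, hc, e0, e1, e2⟩ := exists_simple_pole_of_miuraEqs hU hV hu hv
    (meromorphicAt_ev (χ 0) p) (meromorphicAt_ev (χ 1) p) (meromorphicAt_ev (χ 2) p)
    ((h.eventually_miuraEqs (Set.finite_range z)).filter_mono (nhdsNE_le_cofinite p))
  obtain ⟨σ, hσ⟩ := exists_weylDot_eq (r := ![A p, B p, C p]) (l := localWeight z lam p)
    (by simpa [Fin.sum_univ_three] using e0) (sum_localWeight hlam p) (by rw [← e1, hU0])
    (by rw [← e2, hV0])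
  refine ⟨σ, hσ ▸ fun k => ?_⟩
  fin_cases k
  · exact ⟨A, hA, ha, rfl⟩
  · exact ⟨B, hB, hb, rfl⟩
  · exact ⟨C, hC, hc, rfl⟩

theorem HasResidue.eq_zero {p : ℂ} {r : Fin 3 → ℂ} (h : HasResidue χ p r) {k : Fin 3}
    (hp : (χ k).denom.eval p ≠ 0) : r k = 0 := by
  obtain ⟨A, hA, ha, hr⟩ := h k
  have := eq_of_eventuallyEq_nhdsNE (f := A) (g := fun s => (s - p) * ev (χ k) s) hA.continuousAt
    (((analyticAt_id.sub analyticAt_const).mul (analyticAt_ev hp)).continuousAt) ?_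
  · rw [← hr, this, sub_self, zero_mul]
  · filter_upwards [ha, self_mem_nhdsWithin] with s h1 h2
    have : s - p ≠ 0 := sub_ne_zero.2 h2
    rw [h1]; field_simp

theorem HasResidue.unique {p : ℂ} {r r' : Fin 3 → ℂ} (h : HasResidue χ p r)
    (h' : HasResidue χ p r') : r = r' := by
  ext k
  obtain ⟨A, hA, ha, hr⟩ := h k
  obtain ⟨B, hB, hb, hr'⟩ := h' k
  rw [← hr, ← hr']
  refine eq_of_eventuallyEq_nhdsNE hA.continuousAt hB.continuousAt ?_
  filter_upwards [ha, hb, self_mem_nhdsWithin] with s h1 h2 h3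
  have : s - p ≠ 0 := sub_ne_zero.2 h3
  rw [h1] at h2
  field_simp at h2
  exact h2

/-- The poles of the `χₖ`. -/
def poles (χ : Fin 3 → RatFunc ℂ) : Finset ℂ :=
  Finset.univ.biUnion fun k => (χ k).denom.roots.toFinset

theorem notMem_poles {p : ℂ} : p ∉ poles χ ↔ ∀ k, (χ k).denom.eval p ≠ 0 := by
  simp [poles, RatFunc.denom_ne_zero]

/-- After subtraction of the simple fractions each `χ k` is bounded near every point, hence a
polynomial, and the condition at infinity makes it zero. The set `T` may exceed the set of poles, so
that the `z i` can be included even where a residue vanishes. -/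
theorem eq_sum_of_hasResidue {u v : ℂ → ℂ} (huv : RegularSingularAtInfty u v) {S : Set ℂ}
    (hS : S.Finite) (h : IsMiura u v S χ) {r : ℂ → Fin 3 → ℂ} (hr : ∀ p, HasResidue χ p (r p))
    {T : Finset ℂ} (hT : poles χ ⊆ T) (k : Fin 3) :
    χ k = ∑ p ∈ T, RatFunc.C (r p k) / (RatFunc.X - RatFunc.C p) := by
  have hsum : ∀ k, ev (∑ p ∈ T, RatFunc.C (r p k) / (RatFunc.X - RatFunc.C p)) =ᶠ[cofinite]
      fun t => ∑ p ∈ T, r p k / (t - p) := by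
    intro k
    refine (ev_sum _ _).trans ?_
    have := (Filter.eventually_all_finset T).2 fun p _ => ev_simpleFraction (r p k) p
    filter_upwards [this] with t ht
    exact Finset.sum_congr rfl ht
  have hpoly : ∀ k, ∃ q : Polynomial ℂ,
      χ k - ∑ p ∈ T, RatFunc.C (r p k) / (RatFunc.X - RatFunc.C p) =
        algebraMap (Polynomial ℂ) (RatFunc ℂ) q := by
    intro k
    refine exists_algebraMap_eq_of_bounded _ fun p => ?_
    obtain ⟨A, hA, ha, hAr⟩ := hr p k
    have hrp : p ∉ T → r p k = 0 := fun hp =>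
      (hr p).eq_zero (notMem_poles.1 (fun h => hp (hT h)) k)
    -- `dslope A p` is what remains of `A s / (s - p)` once the polar term at `p` is removed.
    refine bounded_of_continuousAt (g := fun s => dslope A p s - ∑ p' ∈ T.erase p, r p' k / (s - p'))
      ?_ ?_
    · refine (continuousAt_dslope_same.2 hA.differentiableAt).sub ?_
      refine tendsto_finsetSum _ fun p' hp' => ?_
      have : p - p' ≠ 0 := sub_ne_zero.2 (Finset.ne_of_mem_erase hp').symm
      exact ContinuousAt.div (by fun_prop) (by fun_prop) this
    · have hadd := ev_add (χ k - ∑ p ∈ T, RatFunc.C (r p k) / (RatFunc.X - RatFunc.C p))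
        (∑ p ∈ T, RatFunc.C (r p k) / (RatFunc.X - RatFunc.C p))
      rw [sub_add_cancel] at hadd
      filter_upwards [hadd.filter_mono (nhdsNE_le_cofinite p),
        (hsum k).filter_mono (nhdsNE_le_cofinite p), ha, self_mem_nhdsWithin] with s h1 h2 h3 h4
      have h5 : s - p ≠ 0 := sub_ne_zero.2 h4
      have h6 : ∑ p ∈ T, r p k / (s - p) = r p k / (s - p) + ∑ p' ∈ T.erase p, r p' k / (s - p') := by
        by_cases hp : p ∈ T
        · exact (Finset.add_sum_erase _ _ hp).symm
        · rw [hrp hp, zero_div, zero_add, Finset.erase_eq_of_notMem hp]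
      have h7 := sub_smul_dslope A p s
      rw [smul_eq_mul, hAr] at h7
      have h8 : dslope A p s = (A s - r p k) / (s - p) := by
        rw [eq_div_iff h5, ← h7, mul_comm]
      rw [h2, h3, h6] at h1
      rw [h8, sub_div, h1]
      ring
  choose q hq using hpoly
  have hq0 := polynomial_eq_zero_of_miuraEqs huv (T := T) (r := fun k p => r p k) (q := q)
    (g := fun k => ev (χ k)) ?_ (h.eventually_miuraEqs hS) k
  · have := hq k
    rw [hq0, map_zero, sub_eq_zero] at this
    exact this
  · intro k
    have hadd := ev_add (χ k - ∑ p ∈ T, RatFunc.C (r p k) / (RatFunc.X - RatFunc.C p))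
      (∑ p ∈ T, RatFunc.C (r p k) / (RatFunc.X - RatFunc.C p))
    rw [sub_add_cancel, hq k] at hadd
    filter_upwards [hadd, hsum k] with t h1 h2
    rw [h1, h2, ev_algebraMap, polyFrac]
    simp

theorem weylDot_zero (s : Equiv.Perm (Fin 3)) : weylDot s 0 = weyl s rhoBar - rhoBar := by
  simp [weylDot]

/-- The residues of the factors determine their diagonal form. -/
theorem IsMiura.hasDiagonalForm (hz : Function.Injective z) (hlam : ∀ i, ∑ k, lam i k = 0)
    (huv : RegularSingularAtInfty (coeffU z lam μ) (coeffV z lam ν κ))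
    (h : IsMiura (coeffU z lam μ) (coeffV z lam ν κ) (Set.range z) χ)
    {res : Fin N → Fin 3 → ℂ} (hres : ∀ i, HasResidue χ (z i) (res i)) :
    HasDiagonalForm z res χ := by
  classical
  choose σ hσ using fun p => h.exists_hasResidue hz hlam p
  set r := fun p => weylDot (σ p) (localWeight z lam p) with hr
  set I : Finset ℂ := Finset.univ.image z
  have hI : ∀ p, p ∈ I ↔ p ∈ Set.range z := by simp [I]
  set T := poles χ ∪ I
  have hsum := eq_sum_of_hasResidue huv (Set.finite_range z) h hσ (T := T)
    Finset.subset_union_left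
  -- Each point outside the `z i` is filed under the permutation chosen for its residue, which makes
  -- the sets disjoint.
  refine ⟨fun s => (T \ I).filter fun p => σ p = s.1, ?_, ?_, fun k => ?_⟩
  · intro s s' hss
    rw [Finset.disjoint_left]
    intro p hp hp'
    rw [Finset.mem_filter] at hp hp'
    exact hss (Subtype.ext (hp.2.symm.trans hp'.2))
  · intro s i hi
    simp [I] at hi
  · rw [hsum k, ← Finset.sum_sdiff (Finset.subset_union_right : I ⊆ T), add_comm]
    congr 1
    · rw [Finset.sum_image fun i _ j _ hij => hz hij]
      refine Finset.sum_congr rfl fun i _ => ?_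
      rw [(hσ (z i)).unique (hres i)]
    · have h0 : ∀ p ∈ T \ I, weylDot (σ p) (localWeight z lam p) k
          = weyl (σ p) rhoBar k - rhoBar k := by
        intro p hp
        rw [Finset.mem_sdiff, hI] at hp
        rw [localWeight_of_notMem hp.2, weylDot_zero, Pi.sub_apply]
      have h1 : ∑ p ∈ T \ I, RatFunc.C (weylDot (σ p) (localWeight z lam p) k) /
          (RatFunc.X - RatFunc.C p) = ∑ s : Equiv.Perm (Fin 3), ∑ p ∈ T \ I with σ p = s,
            RatFunc.C (weyl s rhoBar k - rhoBar k) / (RatFunc.X - RatFunc.C p) := by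
        rw [← Finset.sum_fiberwise (T \ I) σ]
        refine Finset.sum_congr rfl fun s _ => Finset.sum_congr rfl fun p hp => ?_
        rw [Finset.mem_filter] at hp
        rw [h0 p hp.1, hp.2]
      -- Points with `σ p = 1` have residue zero and may be dropped.
      rw [h1, ← Finset.sum_erase Finset.univ (a := (1 : Equiv.Perm (Fin 3))) (by simp [weyl])]
      exact Finset.sum_subtype (Finset.univ.erase 1) (p := fun s => s ≠ 1) (by simp) _

end Main

end

/-! ### Linear differential equations with holomorphic coefficients -/

/-- Picard iteration in the form of a series: each term is the primitive, vanishing at `p`, of `A`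
applied to the preceding one. Primitives exist because the domain is a disc. -/
theorem exists_hasDerivAt_clm_apply {E : Type*} [NormedAddCommGroup E] [NormedSpace ℂ E]
    [CompleteSpace E] {A : ℂ → E →L[ℂ] E} {p : ℂ} (hA : AnalyticAt ℂ A p) (y₀ : E) :
    ∃ Y : ℂ → E, Y p = y₀ ∧ ∀ᶠ t in 𝓝 p, HasDerivAt Y (A t (Y t)) t := by
  set K := ‖A p‖ + 1 with hK
  have hK0 : 0 < K := by positivity
  obtain ⟨r₁, hr₁, hball⟩ := Metric.eventually_nhds_iff_ball.1 (hA.eventually_analyticAt.and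
    (hA.continuousAt.norm.eventually_le_const (lt_add_one ‖A p‖)))
  -- With `‖A‖ ≤ K`, this radius makes each integration at least halve the bound.
  set r := min r₁ (1 / (2 * K)) with hr
  have hr0 : 0 < r := by positivity
  have hp : p ∈ Metric.ball p r := Metric.mem_ball_self hr0
  have hsub : Metric.ball p r ⊆ Metric.ball p r₁ := Metric.ball_subset_ball (min_le_left _ _)
  have hAd : DifferentiableOn ℂ A (Metric.ball p r) := fun t ht =>
    (hball t (hsub ht)).1.differentiableAt.differentiableWithinAt
  have hAK : ∀ t ∈ Metric.ball p r, ‖A t‖ ≤ K := fun t ht => (hball t (hsub ht)).2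
  have step : ∀ Y : {Y : ℂ → E // DifferentiableOn ℂ Y (Metric.ball p r)},
      ∃ Z : {Y : ℂ → E // DifferentiableOn ℂ Y (Metric.ball p r)}, Z.1 p = 0 ∧
        ∀ t ∈ Metric.ball p r, HasDerivAt Z.1 (A t (Y.1 t)) t := by
    intro Y
    obtain ⟨Z, hZ, hZ'⟩ := ((hAd.clm_apply Y.2).isExactOn_ball).with_val_at p 0
    exact ⟨⟨Z, fun t ht => (hZ' t ht).differentiableAt.differentiableWithinAt⟩, hZ, hZ'⟩
  choose next hnext0 hnext using step
  let W : ℕ → {Y : ℂ → E // DifferentiableOn ℂ Y (Metric.ball p r)} := fun n =>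
    Nat.rec ⟨fun _ => y₀, by fun_prop⟩ (fun _ Y => next Y) n
  have hW : ∀ n, W (n + 1) = next (W n) := fun n => rfl
  have hbound : ∀ n, ∀ t ∈ Metric.ball p r, ‖(W n).1 t‖ ≤ ‖y₀‖ * (1 / 2) ^ n := by
    intro n
    induction n with
    | zero => intro t _; simp [W]
    | succ n ih =>
      intro t ht
      have h1 := (convex_ball p r).norm_image_sub_le_of_norm_hasDerivWithin_le
        (f := (W (n + 1)).1) (C := K * (‖y₀‖ * (1 / 2) ^ n))
        (fun s hs => (hnext (W n) s hs).hasDerivWithinAt)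
        (fun s hs => (ContinuousLinearMap.le_opNorm _ _).trans
          (mul_le_mul (hAK s hs) (ih s hs) (norm_nonneg _) hK0.le)) hp ht
      rw [hW, hnext0, sub_zero] at h1
      have h2 : ‖t - p‖ ≤ 1 / (2 * K) :=
        (mem_ball_iff_norm.1 ht).le.trans (min_le_right _ _)
      refine h1.trans ?_
      calc _ ≤ K * (‖y₀‖ * (1 / 2) ^ n) * (1 / (2 * K)) := by gcongr
        _ = _ := by rw [pow_succ]; field_simp
  have hsum : Summable fun n : ℕ => ‖y₀‖ * (1 / 2 : ℝ) ^ n :=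
    (summable_geometric_of_lt_one (by norm_num) (by norm_num)).mul_left _
  refine ⟨fun t => ∑' n, (W n).1 t, ?_, ?_⟩
  · change ∑' n, (W n).1 p = y₀
    refine (tsum_eq_single 0 fun n hn => ?_).trans rfl
    obtain ⟨m, rfl⟩ := Nat.exists_eq_succ_of_ne_zero hn
    exact hnext0 _
  · filter_upwards [Metric.isOpen_ball.mem_nhds hp] with t ht
    have hd := (Complex.differentiableOn_tsum_of_summable_norm hsum (fun n => (W n).2)
      Metric.isOpen_ball hbound).differentiableAt (Metric.isOpen_ball.mem_nhds ht)
    have h1 := Complex.hasSum_deriv_of_summable_norm hsum (fun n => (W n).2)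
      Metric.isOpen_ball hbound ht
    have h2 : HasSum (fun n => (W n).1 t) (∑' n, (W n).1 t) :=
      (Summable.of_norm_bounded hsum fun n => hbound n t ht).hasSum
    have h3 := h2.mapL (A t)
    have h4 : HasSum (fun n => deriv (W n).1 t) (A t (∑' n, (W n).1 t)) := by
      rw [← hasSum_nat_add_iff' 1]
      have h0 : deriv (W 0).1 t = 0 := by
        change deriv (fun _ => y₀) t = 0
        simp
      simp only [Finset.range_one, Finset.sum_singleton, h0, sub_zero]
      rw [show (fun n => deriv (W (n + 1)).1 t) = fun n => A t ((W n).1 t) from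
        funext fun n => (hnext (W n) t ht).deriv]
      exact h3
    rw [← h1.unique h4]
    exact hd.hasDerivAt

/-- Existence of solutions of `f''' = u f' + v f` with given initial data. -/
theorem exists_solution {u v : ℂ → ℂ} {p : ℂ} (hu : AnalyticAt ℂ u p) (hv : AnalyticAt ℂ v p)
    (y : Fin 3 → ℂ) : ∃ f : ℂ → ℂ, AnalyticAt ℂ f p ∧ (∀ᶠ t in 𝓝 p, oper u v f t = 0) ∧
      f p = y 0 ∧ deriv f p = y 1 ∧ deriv (deriv f) p = y 2 := by
  -- Matrix units; `A` is the companion matrix acting on `(f, f', f'')`.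
  let B (i j : Fin 3) : (Fin 3 → ℂ) →L[ℂ] (Fin 3 → ℂ) :=
    (ContinuousLinearMap.single ℂ (fun _ : Fin 3 => ℂ) i).comp (ContinuousLinearMap.proj j)
  let A : ℂ → (Fin 3 → ℂ) →L[ℂ] (Fin 3 → ℂ) := fun t => B 0 1 + B 1 2 + u t • B 2 1 + v t • B 2 0
  have hA : AnalyticAt ℂ A p := by fun_prop
  obtain ⟨Y, hY, hY'⟩ := exists_hasDerivAt_clm_apply hA y
  have hA0 : ∀ t w, A t w 0 = w 1 := fun t w => by simp [A, B]
  have hA1 : ∀ t w, A t w 1 = w 2 := fun t w => by simp [A, B]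
  have hA2 : ∀ t w, A t w 2 = u t * w 1 + v t * w 0 := fun t w => by simp [A, B]
  have hc : ∀ k, ∀ᶠ t in 𝓝 p, HasDerivAt (fun s => Y s k) (A t (Y t) k) t := fun k => by
    filter_upwards [hY'] with t ht
    exact hasDerivAt_pi.1 ht k
  have d0 : deriv (fun s => Y s 0) =ᶠ[𝓝 p] fun s => Y s 1 := by
    filter_upwards [hc 0] with t ht
    rw [ht.deriv, hA0]
  have d1 : deriv (fun s => Y s 1) =ᶠ[𝓝 p] fun s => Y s 2 := by
    filter_upwards [hc 1] with t ht
    rw [ht.deriv, hA1]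
  have d01 := d0.deriv.trans d1
  refine ⟨fun s => Y s 0, ?_, ?_, congrFun hY 0, by rw [d0.eq_of_nhds, hY], by rw [d01.eq_of_nhds, hY]⟩
  · obtain ⟨s, hs, hs'⟩ := eventually_iff_exists_mem.1 (hc 0)
    exact DifferentiableOn.analyticAt
      (fun t ht => (hs' t ht).differentiableAt.differentiableWithinAt) hs
  · filter_upwards [d01.deriv, d0, hc 2] with t h1 h2 h3
    rw [oper, h1, h2, h3.deriv, hA2]
    ring

/-! ### Riccati equation and exponents -/

/-- The equation in Riccati form involves `f` only through `f'/f`. This quantity stays single-valued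
when `f` is determined up to a constant factor, which is the situation for branches. -/
theorem oper_eq_of_logDeriv {u v f : ℂ → ℂ} {t : ℂ} (hf : AnalyticAt ℂ f t) (h0 : f t ≠ 0) :
    oper u v f t = f t * (deriv (deriv (logDeriv f)) t + 3 * logDeriv f t * deriv (logDeriv f) t +
      logDeriv f t ^ 3 - u t * logDeriv f t - v t) := by
  have hg : AnalyticAt ℂ (logDeriv f) t := hf.deriv.div hf h0
  have e1 : deriv f =ᶠ[𝓝 t] fun s => logDeriv f s * f s := by
    filter_upwards [hf.continuousAt.eventually_ne h0] with s hs
    rw [logDeriv_apply, div_mul_cancel₀ _ hs]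
  have e2 : deriv (deriv f) =ᶠ[𝓝 t] fun s =>
      deriv (logDeriv f) s * f s + logDeriv f s * deriv f s := by
    refine e1.deriv.trans ?_
    filter_upwards [hf.eventually_analyticAt, hg.eventually_analyticAt] with s h1 h2
    exact (h2.differentiableAt.hasDerivAt.mul h1.differentiableAt.hasDerivAt).deriv
  have e3 : deriv (deriv (deriv f)) t = deriv (deriv (logDeriv f)) t * f t +
      deriv (logDeriv f) t * deriv f t + (deriv (logDeriv f) t * deriv f t +
      logDeriv f t * deriv (deriv f) t) := by
    rw [e2.deriv_eq]
    exact ((hg.deriv.differentiableAt.hasDerivAt.mul hf.differentiableAt.hasDerivAt).add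
      (hg.differentiableAt.hasDerivAt.mul hf.deriv.differentiableAt.hasDerivAt)).deriv
  rw [oper, e3, e2.eq_of_nhds, e1.eq_of_nhds]
  ring

/-- The residue of a solution with a simple pole of the Riccati equation attached to
`∂³ - u ∂ - v` is a root of the indicial polynomial. -/
theorem indicial_of_riccati {u v U V g A : ℂ → ℂ} {p : ℂ} (hU : AnalyticAt ℂ U p)
    (hV : AnalyticAt ℂ V p) (hu : u =ᶠ[𝓝[≠] p] fun s => U s / (s - p) ^ 2)
    (hv : v =ᶠ[𝓝[≠] p] fun s => V s / (s - p) ^ 3) (hA : AnalyticAt ℂ A p)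
    (hg : g =ᶠ[𝓝[≠] p] fun s => A s / (s - p))
    (h : ∀ᶠ t in 𝓝[≠] p,
      deriv (deriv g) t + 3 * g t * deriv g t + g t ^ 3 - u t * g t - v t = 0) :
    A p * (A p - 1) * (A p - 2) - U p * A p - V p = 0 := by
  have hg0 : g =ᶠ[𝓝[≠] p] fun s => A s / (s - p) ^ 1 := by simpa using hg
  have hg1 := deriv_div_pow hA hg0
  have hA1 : AnalyticAt ℂ (fun s => (s - p) * deriv A s - ((1 : ℕ) : ℂ) * A s) p := by
    have := hA.deriv
    fun_prop
  have hg2 := deriv_div_pow hA1 hg1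
  have c0 := hA.continuousAt
  have c1 := hA.deriv.continuousAt
  have c2 := hA1.deriv.continuousAt
  have c3 := hU.continuousAt
  have c4 := hV.continuousAt
  have := eq_of_eventuallyEq_nhdsNE (p := p) (f := fun s =>
    ((s - p) * deriv (fun s => (s - p) * deriv A s - ((1 : ℕ) : ℂ) * A s) s -
      ((1 + 1 : ℕ) : ℂ) * ((s - p) * deriv A s - ((1 : ℕ) : ℂ) * A s)) +
      3 * A s * ((s - p) * deriv A s - ((1 : ℕ) : ℂ) * A s) + A s ^ 3 - U s * A s - V s)
    (g := fun _ => 0) (by fun_prop) (by fun_prop) ?_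
  · simp only [sub_self] at this
    push_cast at this
    linear_combination this
  · filter_upwards [h, hg0, hg1, hg2, hu, hv, self_mem_nhdsWithin] with s h1 h2 h3 h4 h5 h6 h7
    have h8 : s - p ≠ 0 := sub_ne_zero.2 h7
    rw [h2, h3, h4, h5, h6] at h1
    field_simp at h1
    refine mul_left_cancel₀ (pow_ne_zero 5 h8) ?_
    linear_combination h1

theorem exists_logDeriv_eq {f : ℂ → ℂ} {p : ℂ} (hf : MeromorphicAt f p) {m : ℤ}
    (hm : meromorphicOrderAt f p = m) :
    ∃ A : ℂ → ℂ, AnalyticAt ℂ A p ∧ A p = m ∧ logDeriv f =ᶠ[𝓝[≠] p] fun s => A s / (s - p) := by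
  obtain ⟨g, hg, hg0, hfg⟩ := (meromorphicOrderAt_eq_int_iff hf).1 hm
  refine ⟨fun s => m + (s - p) * (deriv g s / g s), ?_, by simp, ?_⟩
  · have := hg.deriv.div hg hg0
    fun_prop
  have h1 : f =ᶠ[𝓝[≠] p] fun s => (s - p) ^ m * g s := hfg
  filter_upwards [h1, h1.nhdsNE_deriv, self_mem_nhdsWithin,
    (hg.continuousAt.eventually_ne hg0).filter_mono nhdsWithin_le_nhds,
    hg.eventually_analyticAt.filter_mono nhdsWithin_le_nhds] with s h2 h3 h4 h5 h6
  have h7 : s - p ≠ 0 := sub_ne_zero.2 h4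
  have h8 : deriv (fun s => (s - p) ^ m * g s) s =
      m * (s - p) ^ (m - 1) * g s + (s - p) ^ m * deriv g s :=
    ((HasDerivAt.comp_sub_const s p (hasDerivAt_zpow m (s - p) (.inl h7))).mul
      h6.differentiableAt.hasDerivAt).deriv
  rw [logDeriv_apply, h2, h3, h8, zpow_sub_one₀ h7]
  have h9 : (s - p) ^ m ≠ 0 := zpow_ne_zero m h7
  field_simp

theorem indicial_of_solution {u v U V f : ℂ → ℂ} {p : ℂ} (hU : AnalyticAt ℂ U p)
    (hV : AnalyticAt ℂ V p) (hu : u =ᶠ[𝓝[≠] p] fun s => U s / (s - p) ^ 2)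
    (hv : v =ᶠ[𝓝[≠] p] fun s => V s / (s - p) ^ 3) (hf : MeromorphicAt f p) {m : ℤ}
    (hm : meromorphicOrderAt f p = m) (h : ∀ᶠ t in 𝓝[≠] p, oper u v f t = 0) :
    (m : ℂ) * (m - 1) * (m - 2) - U p * m - V p = 0 := by
  obtain ⟨A, hA, hAm, hlog⟩ := exists_logDeriv_eq hf hm
  have := indicial_of_riccati hU hV hu hv hA hlog ?_
  · rwa [hAm] at this
  · have hne := (meromorphicOrderAt_ne_top_iff_eventually_ne_zero hf).1 (by simp [hm])
    filter_upwards [h, hne, hf.eventually_analyticAt] with t h1 h2 h3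
    rw [oper_eq_of_logDeriv h3 h2] at h1
    exact (mul_eq_zero.1 h1).resolve_left h2

/-- An ordinary point is a singular one with `U p = V p = 0`, where the indicial polynomial is `m (m
- 1) (m - 2)`. In particular a meromorphic solution has no pole there. -/
theorem order_of_solution {u v f : ℂ → ℂ} {p : ℂ} (hu : AnalyticAt ℂ u p) (hv : AnalyticAt ℂ v p)
    (hf : MeromorphicAt f p) {m : ℤ} (hm : meromorphicOrderAt f p = m)
    (h : ∀ᶠ t in 𝓝[≠] p, oper u v f t = 0) : m = 0 ∨ m = 1 ∨ m = 2 := by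
  have := indicial_of_solution (U := fun s => (s - p) ^ 2 * u s) (V := fun s => (s - p) ^ 3 * v s)
    (by fun_prop) (by fun_prop) ?_ ?_ hf hm h
  · simp only [sub_self, ne_eq, OfNat.ofNat_ne_zero, not_false_eq_true, zero_pow, zero_mul,
      sub_zero, mul_eq_zero, sub_eq_zero, or_assoc] at this
    exact_mod_cast this
  all_goals
    filter_upwards [self_mem_nhdsWithin] with s hs
    have : s - p ≠ 0 := sub_ne_zero.2 hs
    field_simp

section

/-! ### Analytic continuation along paths -/

/-- By isolation of zeros, the vanishing of the germ at `q` is a locally constant property of `q`.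
Along a path, together with `forall_of_eventually_iff`, this propagates identities from one end to
the other. -/
theorem eventually_eventuallyEq_zero_iff {f : ℂ → ℂ} {p : ℂ} (hf : AnalyticAt ℂ f p) :
    ∀ᶠ q in 𝓝 p, ((∀ᶠ t in 𝓝 q, f t = 0) ↔ ∀ᶠ t in 𝓝 p, f t = 0) := by
  rcases hf.eventually_eq_zero_or_eventually_ne_zero with h | h
  · filter_upwards [h.eventually_nhds] with q hq
    exact iff_of_true hq h
  · have hp : ¬ ∀ᶠ t in 𝓝 p, f t = 0 := fun h' => by
      obtain ⟨t, h1, h2⟩ := ((h'.filter_mono nhdsWithin_le_nhds).and h).exists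
      exact h2 h1
    filter_upwards [eventually_nhdsWithin_iff.1 h] with q hq
    refine iff_of_false (fun h' => ?_) hp
    by_cases hqp : q = p
    · exact hp (hqp ▸ h')
    · exact hq hqp h'.self_of_nhds

theorem forall_of_eventually_iff {X : Type*} [TopologicalSpace X] [PreconnectedSpace X]
    {P : X → Prop} (h : ∀ s, ∀ᶠ s' in 𝓝 s, (P s' ↔ P s)) {a : X} (ha : P a) (b : X) : P b := by
  have hl : IsLocallyConstant P := (IsLocallyConstant.iff_eventually_eq P).2 fun s =>
    (h s).mono fun s' hs' => propext hs'
  exact hl.apply_eq_of_preconnectedSpace b a ▸ ha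

variable {x y w : ℂ}

/-- A single reparametrization principle yields both reversal of a path and restriction to the
halves of a concatenation. -/
theorem continues_comp {γ : Path x y} {F : unitInterval → ℂ → ℂ}
    (h1 : ∀ s, AnalyticAt ℂ (F s) (γ s)) (h2 : ∀ s, ∀ᶠ s' in 𝓝 s, F s' =ᶠ[𝓝 (γ s')] F s)
    {a b : ℂ} (δ : Path a b) {e : unitInterval → unitInterval} (he : Continuous e)
    (hδ : ∀ s, δ s = γ (e s)) : Continues δ (F (e 0) : Germ (𝓝 a) ℂ) (F (e 1) : Germ (𝓝 b) ℂ) := by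
  refine ⟨fun s => F (e s), fun s => hδ s ▸ h1 (e s), fun s => ?_, rfl, rfl⟩
  filter_upwards [he.continuousAt.eventually (h2 (e s))] with s' hs'
  rw [hδ s']
  exact hs'

theorem Continues.symm {γ : Path x y} {φ : Germ (𝓝 x) ℂ} {ψ : Germ (𝓝 y) ℂ}
    (h : Continues γ φ ψ) : Continues γ.symm ψ φ := by
  obtain ⟨F, h1, h2, h3, h4⟩ := h
  have := continues_comp h1 h2 γ.symm unitInterval.continuous_symm fun s => rfl
  rw [unitInterval.symm_zero, unitInterval.symm_one, h3, h4] at this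
  exact this

theorem Continues.exists_of_trans {γ : Path x y} {δ : Path y w} {φ : Germ (𝓝 x) ℂ}
    {ψ : Germ (𝓝 w) ℂ} (h : Continues (γ.trans δ) φ ψ) :
    ∃ θ : Germ (𝓝 y) ℂ, Continues γ φ θ ∧ Continues δ θ ψ := by
  obtain ⟨F, h1, h2, h3, h4⟩ := h
  have m1 : ∀ s : unitInterval, (s : ℝ) / 2 ∈ unitInterval := fun s =>
    ⟨by linarith [s.2.1], by linarith [s.2.2]⟩
  have m2 : ∀ s : unitInterval, ((s : ℝ) + 1) / 2 ∈ unitInterval := fun s =>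
    ⟨by linarith [s.2.1], by linarith [s.2.2]⟩
  have c1 := continues_comp h1 h2 γ (e := fun s => ⟨s / 2, m1 s⟩)
    (Continuous.subtype_mk (by fun_prop) _) fun s => by
      rw [Path.trans_apply, dif_pos (by simp only; linarith [s.2.2])]
      congr 1
      exact Subtype.ext (by simp only; ring)
  have c2 := continues_comp h1 h2 δ (e := fun s => ⟨(s + 1) / 2, m2 s⟩)
    (Continuous.subtype_mk (by fun_prop) _) fun s => by
      rw [Path.trans_apply]
      split_ifs with hs
      · simp only at hs
        -- Only the midpoint of the concatenation falls into the first half, and there the two paths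
        -- meet.
        have hs0 : s = 0 := Subtype.ext (by simp only [Set.Icc.coe_zero]; linarith [s.2.1])
        subst hs0
        rw [δ.source]
        symm
        convert γ.target
        simp
      · congr 1
        exact Subtype.ext (by simp only; ring)
  have e1 : (⟨((0 : unitInterval) : ℝ) / 2, m1 0⟩ : unitInterval) = 0 := Subtype.ext (by simp)
  have e2 : (⟨(((1 : unitInterval) : ℝ) + 1) / 2, m2 1⟩ : unitInterval) = 1 :=
    Subtype.ext (by norm_num)
  have e3 : (⟨(((0 : unitInterval) : ℝ) + 1) / 2, m2 0⟩ : unitInterval) =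
    ⟨((1 : unitInterval) : ℝ) / 2, m1 1⟩ := Subtype.ext (by simp)
  simp only [e1, e2, e3, h3, h4] at c1 c2
  exact ⟨_, c1, c2⟩

theorem Continues.unique {γ : Path x y} {φ : Germ (𝓝 x) ℂ} {ψ ψ' : Germ (𝓝 y) ℂ}
    (h : Continues γ φ ψ) (h' : Continues γ φ ψ') : ψ = ψ' := by
  obtain ⟨F, h1, h2, h3, rfl⟩ := h
  obtain ⟨G, g1, g2, g3, rfl⟩ := h'
  have key := forall_of_eventually_iff (P := fun s => ∀ᶠ t in 𝓝 (γ s), F s t - G s t = 0) ?_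
    (a := 0) ?_ 1
  · rw [γ.target] at key
    exact Germ.coe_eq.2 (key.mono fun t ht => sub_eq_zero.1 ht)
  · intro s
    filter_upwards [h2 s, g2 s, γ.continuous.continuousAt.eventually
      (eventually_eventuallyEq_zero_iff ((h1 s).sub (g1 s)))] with s' k1 k2 k3
    refine Iff.trans (eventually_congr ?_) k3
    filter_upwards [k1, k2] with t k4 k5
    rw [k4, k5]; rfl
  · rw [γ.source]
    filter_upwards [Germ.coe_eq.1 (h3.trans g3.symm)] with t ht
    rw [ht, sub_self]

theorem Continues.smul {γ : Path x y} {φ : Germ (𝓝 x) ℂ} {ψ : Germ (𝓝 y) ℂ}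
    (h : Continues γ φ ψ) (c : ℂ) : Continues γ (c • φ) (c • ψ) := by
  obtain ⟨F, h1, h2, rfl, rfl⟩ := h
  refine ⟨fun s => c • F s, fun s => (h1 s).const_smul, fun s => ?_, rfl, rfl⟩
  filter_upwards [h2 s] with s' hs'
  exact hs'.const_smul c

theorem continues_of_analyticAt {f : ℂ → ℂ} (γ : Path x y) (hf : ∀ s, AnalyticAt ℂ f (γ s)) :
    Continues γ (f : Germ (𝓝 x) ℂ) (f : Germ (𝓝 y) ℂ) :=
  ⟨fun _ => f, hf, fun _ => .of_forall fun _ => .rfl, rfl, rfl⟩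

theorem Continues.analyticAt {γ : Path x y} {φ : Germ (𝓝 x) ℂ} {f : ℂ → ℂ}
    (h : Continues γ φ (f : Germ (𝓝 y) ℂ)) : AnalyticAt ℂ f y := by
  obtain ⟨F, h1, -, -, h4⟩ := h
  have := h1 1
  rw [γ.target] at this
  exact this.congr (Germ.coe_eq.1 h4)

theorem analyticAt_oper {u v f : ℂ → ℂ} {t : ℂ} (hu : AnalyticAt ℂ u t) (hv : AnalyticAt ℂ v t)
    (hf : AnalyticAt ℂ f t) : AnalyticAt ℂ (oper u v f) t :=
  (hf.deriv.deriv.deriv.sub (hu.mul hf.deriv)).sub (hv.mul hf)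

theorem oper_congr {u v f g : ℂ → ℂ} {t : ℂ} (h : f =ᶠ[𝓝 t] g) :
    oper u v f =ᶠ[𝓝 t] oper u v g := by
  filter_upwards [h, h.deriv, h.deriv.deriv.deriv] with s h1 h2 h3
  rw [oper, oper, h1, h2, h3]

/-- The Wronskian of three functions. -/
def wronskian (ψ : Fin 3 → ℂ → ℂ) (t : ℂ) : ℂ :=
  ψ 0 t * (deriv (ψ 1) t * deriv (deriv (ψ 2)) t - deriv (deriv (ψ 1)) t * deriv (ψ 2) t)
  - deriv (ψ 0) t * (ψ 1 t * deriv (deriv (ψ 2)) t - deriv (deriv (ψ 1)) t * ψ 2 t)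
  + deriv (deriv (ψ 0)) t * (ψ 1 t * deriv (ψ 2) t - deriv (ψ 1) t * ψ 2 t)

/-- The operator has no term in `∂²`, so Abel's formula gives a constant Wronskian. -/
theorem hasDerivAt_wronskian {u v : ℂ → ℂ} {ψ : Fin 3 → ℂ → ℂ} {t : ℂ}
    (hψ : ∀ j, AnalyticAt ℂ (ψ j) t) (h : ∀ j, oper u v (ψ j) t = 0) :
    HasDerivAt (wronskian ψ) 0 t := by
  have d0 := fun j => (hψ j).differentiableAt.hasDerivAt
  have d1 := fun j => (hψ j).deriv.differentiableAt.hasDerivAt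
  have d2 := fun j => (hψ j).deriv.deriv.differentiableAt.hasDerivAt
  refine ((((d0 0).mul (((d1 1).mul (d2 2)).sub ((d2 1).mul (d1 2)))).sub
    ((d1 0).mul (((d0 1).mul (d2 2)).sub ((d2 1).mul (d0 2))))).add
    ((d2 0).mul (((d0 1).mul (d1 2)).sub ((d1 1).mul (d0 2))))).congr_deriv ?_
  have e : ∀ j, deriv (deriv (deriv (ψ j))) t = u t * deriv (ψ j) t + v t * ψ j t := fun j => by
    have := h j
    rw [oper] at this
    linear_combination this
  simp only [e, Pi.mul_apply, Pi.sub_apply]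
  ring

theorem wronskian_congr {ψ ψ' : Fin 3 → ℂ → ℂ} {t : ℂ} (h : ∀ j, ψ j =ᶠ[𝓝 t] ψ' j) :
    wronskian ψ t = wronskian ψ' t := by
  have h0 := fun j => (h j).eq_of_nhds
  have h1 := fun j => (h j).deriv.eq_of_nhds
  have h2 := fun j => (h j).deriv.deriv.eq_of_nhds
  simp only [wronskian, h0, h1, h2]

/-- Combined with constancy of the Wronskian, the cube is what forces monodromy scalars to be cube
roots of unity. -/
theorem wronskian_const_mul (c : ℂ) (ψ : Fin 3 → ℂ → ℂ) (t : ℂ) :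
    wronskian (fun j s => c * ψ j s) t = c ^ 3 * wronskian ψ t := by
  have h1 : ∀ f : ℂ → ℂ, deriv (fun s => c * f s) = fun s => c * deriv f s := fun f => by
    ext s; exact deriv_const_mul_field c
  simp only [wronskian, h1]
  ring

theorem eventually_wronskian_eq {u v : ℂ → ℂ} {ψ : Fin 3 → ℂ → ℂ} {t : ℂ}
    (hψ : ∀ j, AnalyticAt ℂ (ψ j) t) (h : ∀ j, ∀ᶠ s in 𝓝 t, oper u v (ψ j) s = 0) :
    ∀ᶠ s in 𝓝 t, wronskian ψ s = wronskian ψ t := by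
  obtain ⟨r, hr, hball⟩ := Metric.eventually_nhds_iff_ball.1
    ((eventually_all.2 fun j => (hψ j).eventually_analyticAt).and (eventually_all.2 h))
  filter_upwards [Metric.ball_mem_nhds t hr] with s hs
  refine Metric.isOpen_ball.is_const_of_deriv_eq_zero (convex_ball t r).isPreconnected
    (fun q hq => ?_) (fun q hq => ?_) hs (Metric.mem_ball_self hr)
  · exact (hasDerivAt_wronskian (hball q hq).1 (hball q hq).2).differentiableAt.differentiableWithinAt
  · exact (hasDerivAt_wronskian (hball q hq).1 (hball q hq).2).deriv

section Continuation

variable {u v : ℂ → ℂ} {S : Set ℂ}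

/-- The property of `F s` being a solution is the vanishing of the germ of an analytic function,
hence locally constant in `s`. -/
theorem forall_solution_of_continuation (hu : ∀ t ∉ S, AnalyticAt ℂ u t)
    (hv : ∀ t ∉ S, AnalyticAt ℂ v t) {γ : Path x y} (hγ : ∀ s, γ s ∉ S)
    {F : unitInterval → ℂ → ℂ} (h1 : ∀ s, AnalyticAt ℂ (F s) (γ s))
    (h2 : ∀ s, ∀ᶠ s' in 𝓝 s, F s' =ᶠ[𝓝 (γ s')] F s)
    (h0 : ∀ᶠ t in 𝓝 x, oper u v (F 0) t = 0) (s : unitInterval) :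
    ∀ᶠ t in 𝓝 (γ s), oper u v (F s) t = 0 := by
  refine forall_of_eventually_iff (P := fun s => ∀ᶠ t in 𝓝 (γ s), oper u v (F s) t = 0) ?_
    (a := 0) (by rwa [γ.source]) s
  intro s
  filter_upwards [h2 s, γ.continuous.continuousAt.eventually (eventually_eventuallyEq_zero_iff
    (analyticAt_oper (hu _ (hγ s)) (hv _ (hγ s)) (h1 s)))] with s' k1 k2
  refine Iff.trans (eventually_congr ?_) k2
  filter_upwards [oper_congr (u := u) (v := v) k1] with t k4
  rw [k4]

theorem Continues.solution (hu : ∀ t ∉ S, AnalyticAt ℂ u t)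
    (hv : ∀ t ∉ S, AnalyticAt ℂ v t) {γ : Path x y} (hγ : ∀ s, γ s ∉ S) {φ ψ : ℂ → ℂ}
    (hφ : ∀ᶠ t in 𝓝 x, oper u v φ t = 0)
    (h : Continues γ (φ : Germ (𝓝 x) ℂ) (ψ : Germ (𝓝 y) ℂ)) : ∀ᶠ t in 𝓝 y, oper u v ψ t = 0 := by
  obtain ⟨F, h1, h2, h3, h4⟩ := h
  have := forall_solution_of_continuation hu hv hγ h1 h2 ?_ 1
  · rw [γ.target] at this
    filter_upwards [this, oper_congr (u := u) (v := v) (Germ.coe_eq.1 h4)] with t k1 k2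
    rw [← k2, k1]
  · filter_upwards [hφ, oper_congr (u := u) (v := v) (Germ.coe_eq.1 h3)] with t k1 k2
    rw [k2, k1]

theorem Continues.wronskian_eq (hu : ∀ t ∉ S, AnalyticAt ℂ u t)
    (hv : ∀ t ∉ S, AnalyticAt ℂ v t) {γ : Path x y} (hγ : ∀ s, γ s ∉ S) {φ ψ : Fin 3 → ℂ → ℂ}
    (hφ : ∀ j, ∀ᶠ t in 𝓝 x, oper u v (φ j) t = 0)
    (h : ∀ j, Continues γ (φ j : Germ (𝓝 x) ℂ) (ψ j : Germ (𝓝 y) ℂ)) :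
    wronskian ψ y = wronskian φ x := by
  choose F h1 h2 h3 h4 using h
  have hsol := fun j => forall_solution_of_continuation hu hv hγ (h1 j) (h2 j) (by
    filter_upwards [hφ j, oper_congr (u := u) (v := v) (Germ.coe_eq.1 (h3 j))] with t k1 k2
    rw [k2, k1])
  have key := forall_of_eventually_iff
    (P := fun s => wronskian (fun j => F j s) (γ s) = wronskian φ x) ?_ (a := 0) ?_ 1
  · rw [← key, γ.target]
    exact (wronskian_congr fun j => Germ.coe_eq.1 (h4 j)).symm
  · intro s
    filter_upwards [eventually_all.2 fun j => h2 j s, γ.continuous.continuousAt.eventually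
      (eventually_wronskian_eq (fun j => h1 j s) (fun j => hsol j s))] with s' k1 k2
    rw [wronskian_congr k1, k2]
  · rw [γ.source]
    exact wronskian_congr fun j => Germ.coe_eq.1 (h3 j)

end Continuation

end

/-! ### Trivial projective monodromy -/

/-- If `v` and `M v` were independent, a transvection along `v` fixing `v` but moving `M v` would
fail to commute with `M`. So every vector is an eigenvector, and `M` is a scalar. -/
theorem exists_smul_of_mem_center {V : Type*} [AddCommGroup V] [Module ℂ V]
    {M : LinearMap.GeneralLinearGroup ℂ V}
    (hM : M ∈ Subgroup.center (LinearMap.GeneralLinearGroup ℂ V)) :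
    ∃ c : ℂ, ∀ v, (M : V →ₗ[ℂ] V) v = c • v := by
  obtain ⟨c, hc⟩ := LinearMap.exists_eq_smul_id_of_forall_notLinearIndependent
    (f := (M : V →ₗ[ℂ] V)) fun v hv => by
    have hv0 : v ≠ 0 := hv.ne_zero 0
    have hnot : (M : V →ₗ[ℂ] V) v ∉ Submodule.span ℂ {v} := by
      rw [Submodule.mem_span_singleton]
      rintro ⟨a, ha⟩
      have := LinearIndependent.pair_iff.1 hv a (-1) (by rw [← ha]; simp)
      norm_num at this
    obtain ⟨l, hl, hl'⟩ := Submodule.exists_le_ker_of_notMem hnot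
    have hlv : l v = 0 := hl' (Submodule.mem_span_singleton_self v)
    have := congrArg (fun A : LinearMap.GeneralLinearGroup ℂ V => (A : V →ₗ[ℂ] V) v)
      (Subgroup.mem_center_iff.1 hM
        (LinearMap.GeneralLinearGroup.ofLinearEquiv (LinearEquiv.transvection hlv)))
    simp [LinearMap.GeneralLinearGroup.ofLinearEquiv, LinearMap.transvection.apply, hlv, hl, hv0] at this
  exact ⟨c, fun v => by rw [hc]; simp⟩

theorem TrivialProjectiveMonodromy.exists_continues_smul {u v : ℂ → ℂ} {S : Set ℂ}
    (h : TrivialProjectiveMonodromy u v S) {x : ℂ} (γ : Path x x) (hγ : ∀ s, γ s ∉ S) :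
    ∃ c : ℂ, ∀ φ ∈ solGerm u v x, Continues γ φ (c • φ) := by
  obtain ⟨M, hM, hM1⟩ := h x γ hγ
  obtain ⟨c, hc⟩ := exists_smul_of_mem_center ((QuotientGroup.eq_one_iff M).1 hM1)
  refine ⟨c, fun φ hφ => ?_⟩
  have := hM ⟨φ, hφ⟩
  rw [hc] at this
  exact this

/-- A multivalued basis of solutions of `∂³ - u ∂ - v` outside `S` with unit Wronskian, whose
branches differ by cube roots of unity; `Br t ψ` means that `ψ` is a branch near `t`. -/
structure BranchSystem (u v : ℂ → ℂ) (S : Set ℂ) (Br : ℂ → (Fin 3 → ℂ → ℂ) → Prop) : Prop where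
  exists_branch : ∀ t ∉ S, ∃ ψ, Br t ψ
  analyticAt : ∀ {t ψ}, Br t ψ → ∀ j, AnalyticAt ℂ (ψ j) t
  solution : ∀ {t ψ}, Br t ψ → ∀ j, ∀ᶠ s in 𝓝 t, oper u v (ψ j) s = 0
  wronskian_eq_one : ∀ {t ψ}, Br t ψ → wronskian ψ t = 1
  unique : ∀ {t ψ ψ'}, Br t ψ → Br t ψ' →
    ∃ c : ℂ, c ^ 3 = 1 ∧ ∀ j, ψ' j =ᶠ[𝓝 t] fun s => c * ψ j s
  eventually : ∀ {t ψ}, Br t ψ → ∀ᶠ s in 𝓝 t, Br s ψ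

theorem path_trans_notMem {S : Set ℂ} {x y w : ℂ} {γ : Path x y} {δ : Path y w}
    (hγ : ∀ s, γ s ∉ S) (hδ : ∀ s, δ s ∉ S) (s : unitInterval) : γ.trans δ s ∉ S := by
  rw [Path.trans_apply]
  split_ifs
  · exact hγ _
  · exact hδ _

/-- The branches at `t` are the continuations, along all paths avoiding `S`, of one basis with unit
Wronskian at a base point. -/
theorem exists_branchSystem {u v : ℂ → ℂ} {S : Set ℂ} (hS : S.Finite)
    (hu : ∀ t ∉ S, AnalyticAt ℂ u t) (hv : ∀ t ∉ S, AnalyticAt ℂ v t)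
    (h : TrivialProjectiveMonodromy u v S) : ∃ Br, BranchSystem u v S Br := by
  obtain ⟨x, hx⟩ := hS.infinite_compl.nonempty
  choose φ hφa hφs hφ0 hφ1 hφ2 using fun j : Fin 3 =>
    exists_solution (hu x hx) (hv x hx) (Pi.single j 1)
  have hmem : ∀ j, (φ j : Germ (𝓝 x) ℂ) ∈ solGerm u v x := fun j => ⟨φ j, hφa j, hφs j, rfl⟩
  have hw : wronskian φ x = 1 := by
    simp [wronskian, hφ0, hφ1, hφ2]
  have hcont : ∀ {t : ℂ} (γ : Path x t), (∀ s, γ s ∉ S) →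
      ∃ ψ : Fin 3 → ℂ → ℂ, ∀ j, Continues γ (φ j : Germ (𝓝 x) ℂ) (ψ j : Germ (𝓝 t) ℂ) := by
    intro t γ hγ
    -- Triviality of the monodromy includes continuability along loops. The first half of the loop
    -- `γ γ⁻¹` gives continuation along an arbitrary path.
    obtain ⟨c, hc⟩ := h.exists_continues_smul (γ.trans γ.symm)
      (path_trans_notMem hγ fun s => hγ _)
    choose θ hθ _ using fun j => (hc _ (hmem j)).exists_of_trans
    exact ⟨fun j => (θ j).out, fun j => by
      rw [show (((θ j).out : ℂ → ℂ) : Germ (𝓝 t) ℂ) = θ j from Quotient.out_eq _]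
      exact hθ j⟩
  refine ⟨fun t ψ => ∃ γ : Path x t, (∀ s, γ s ∉ S) ∧
    ∀ j, Continues γ (φ j : Germ (𝓝 x) ℂ) (ψ j : Germ (𝓝 t) ℂ), ?_, ?_, ?_, ?_, ?_, ?_⟩
  · intro t ht
    have hpc := hS.countable.isPathConnected_compl_of_one_lt_rank (E := ℂ) (by simp)
    have hj := hpc.joinedIn x hx t ht
    obtain ⟨ψ, hψ⟩ := hcont hj.somePath hj.somePath_mem
    exact ⟨ψ, _, hj.somePath_mem, hψ⟩
  · rintro t ψ ⟨γ, -, hγ⟩ j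
    exact (hγ j).analyticAt
  · rintro t ψ ⟨γ, hγS, hγ⟩ j
    exact (hγ j).solution hu hv hγS (hφs j)
  · rintro t ψ ⟨γ, hγS, hγ⟩
    rw [Continues.wronskian_eq hu hv hγS hφs hγ, hw]
  · rintro t ψ ψ' ⟨γ, hγS, hγ⟩ ⟨γ', hγS', hγ'⟩
    -- Two paths to `t` form a loop at the base point, whose scalar compares the two branches.
    obtain ⟨c, hc⟩ := h.exists_continues_smul (γ'.trans γ.symm)
      (path_trans_notMem hγS' fun s => hγS _)
    have key : ∀ j, ψ' j =ᶠ[𝓝 t] fun s => c * ψ j s := by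
      intro j
      obtain ⟨θ, h1, h2⟩ := (hc _ (hmem j)).exists_of_trans
      have h3 := h1.unique (hγ' j)
      have h4 := h2.symm
      rw [Path.symm_symm] at h4
      have h5 := h4.unique ((hγ j).smul c)
      exact Germ.coe_eq.1 (h3.symm.trans h5)
    refine ⟨c, ?_, key⟩
    have h1 := Continues.wronskian_eq hu hv hγS' hφs hγ'
    rw [wronskian_congr key, wronskian_const_mul,
      Continues.wronskian_eq hu hv hγS hφs hγ, hw, mul_one] at h1
    exact h1
  · rintro t ψ ⟨γ, hγS, hγ⟩
    have ht : t ∉ S := by simpa using hγS 1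
    obtain ⟨r, hr, hball⟩ := Metric.eventually_nhds_iff_ball.1
      ((eventually_all.2 fun j => (hγ j).analyticAt.eventually_analyticAt).and
        (hS.isClosed.isOpen_compl.mem_nhds ht))
    filter_upwards [Metric.ball_mem_nhds t hr] with s hs
    -- Nearby points are reached by prolonging `γ` inside a disc where `ψ` is analytic, so the same
    -- functions remain a branch.
    have hjoin : JoinedIn (Metric.ball t r) t s :=
      ((convex_ball t r).isPathConnected ⟨t, Metric.mem_ball_self hr⟩).joinedIn t
        (Metric.mem_ball_self hr) s hs
    set δ := hjoin.somePath
    have hδ : ∀ q, δ q ∈ Metric.ball t r := hjoin.somePath_mem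
    have hS' := path_trans_notMem (γ := γ) (δ := δ) hγS fun q => (hball _ (hδ q)).2
    obtain ⟨θ, hθ⟩ := hcont (γ.trans δ) hS'
    refine ⟨γ.trans δ, hS', fun j => ?_⟩
    obtain ⟨η, h1, h2⟩ := (hθ j).exists_of_trans
    rw [h1.unique (hγ j)] at h2
    have h3 := h2.unique (continues_of_analyticAt δ fun q => (hball _ (hδ q)).1 j)
    rw [← h3]
    exact hθ j

/-! ### Rationality criterion -/

/-- Liouville's theorem with induction on the growth exponent: `dslope f 0` is again entire and
grows one power more slowly. -/
theorem exists_polynomial_of_growth (n : ℕ) : ∀ {f : ℂ → ℂ}, Differentiable ℂ f →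
    (∃ C : ℝ, ∀ᶠ t in Bornology.cobounded ℂ, ‖f t‖ ≤ C * ‖t‖ ^ n) →
    ∃ P : Polynomial ℂ, ∀ t, f t = P.eval t := by
  induction n with
  | zero =>
    rintro f hf ⟨C, hC⟩
    simp only [pow_zero, mul_one] at hC
    have hb : Bornology.IsBounded (Set.range f) := by
      obtain ⟨R, hR⟩ : ∃ R, ∀ t, R < ‖t‖ → ‖f t‖ ≤ C := by
        have := (Metric.hasBasis_cobounded_compl_closedBall (0 : ℂ)).eventually_iff.1 hC
        obtain ⟨R, -, hR⟩ := this
        exact ⟨R, fun t ht => hR (by simpa using ht)⟩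
      obtain ⟨D, hD⟩ := (isCompact_closedBall (0 : ℂ) R).exists_bound_of_continuousOn
        hf.continuous.continuousOn
      refine isBounded_iff_forall_norm_le.2 ⟨max C D, ?_⟩
      rintro _ ⟨t, rfl⟩
      rcases lt_or_ge R ‖t‖ with h | h
      · exact (hR t h).trans (le_max_left _ _)
      · exact (hD t (by simpa using h)).trans (le_max_right _ _)
    exact ⟨Polynomial.C (f 0), fun t => by
      rw [Polynomial.eval_C]; exact hf.apply_eq_apply_of_bounded hb t 0⟩
  | succ n ih =>
    rintro f hf ⟨C, hC⟩
    have hd : Differentiable ℂ (dslope f 0) := by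
      rw [← differentiableOn_univ] at hf ⊢
      exact (Complex.differentiableOn_dslope univ_mem).2 hf
    obtain ⟨P, hP⟩ := ih hd ⟨C + ‖f 0‖, by
      have h1 : ∀ᶠ t : ℂ in Bornology.cobounded ℂ, 1 ≤ ‖t‖ :=
        tendsto_norm_cobounded_atTop.eventually_ge_atTop 1
      filter_upwards [hC, h1] with t h2 h3
      have h4 := sub_smul_dslope f 0 t
      rw [sub_zero, smul_eq_mul] at h4
      have h5 : ‖t‖ * ‖dslope f 0 t‖ ≤ C * ‖t‖ ^ (n + 1) + ‖f 0‖ := by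
        rw [← norm_mul, h4]
        exact (norm_sub_le _ _).trans (by linarith)
      have h6 : ‖f 0‖ ≤ ‖f 0‖ * ‖t‖ ^ (n + 1) :=
        le_mul_of_one_le_right (norm_nonneg _) (one_le_pow₀ h3)
      refine le_of_mul_le_mul_left ?_ (lt_of_lt_of_le one_pos h3)
      calc _ ≤ _ := h5.trans (by linarith : _ ≤ C * ‖t‖ ^ (n + 1) + ‖f 0‖ * ‖t‖ ^ (n + 1))
        _ = _ := by ring⟩
    refine ⟨Polynomial.C (f 0) + Polynomial.X * P, fun t => ?_⟩
    have h4 := sub_smul_dslope f 0 t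
    rw [sub_zero, smul_eq_mul, hP] at h4
    simp [h4]

/-- `G` is given by a rational function without poles outside `S`. -/
def IsRational (S : Set ℂ) (G : ℂ → ℂ) : Prop :=
  ∃ P Q : Polynomial ℂ, Q ≠ 0 ∧ ∀ t ∉ S, Q.eval t ≠ 0 ∧ G t = P.eval t / Q.eval t

/-- The singular points are removed one at a time by multiplication with a power of `t - p`, until
an entire function of polynomial growth is left. -/
theorem isRational_of_growth (S : Finset ℂ) : ∀ {G : ℂ → ℂ}, (∀ t ∉ S, AnalyticAt ℂ G t) →
    (∀ p ∈ S, ∃ (n : ℕ) (C : ℝ), ∀ᶠ t in 𝓝[≠] p, ‖G t‖ * ‖t - p‖ ^ n ≤ C) →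
    (∃ (n : ℕ) (C : ℝ), ∀ᶠ t in Bornology.cobounded ℂ, ‖G t‖ ≤ C * ‖t‖ ^ n) →
    IsRational S G := by
  classical
  induction S using Finset.induction_on with
  | empty =>
    rintro G h1 - ⟨n, C, h3⟩
    obtain ⟨P, hP⟩ := exists_polynomial_of_growth n
      (fun t => (h1 t (by simp)).differentiableAt) ⟨C, h3⟩
    exact ⟨P, 1, one_ne_zero, fun t _ => by simp [hP]⟩
  | insert p S hp ih =>
    rintro G h1 h2 ⟨m, D, h3⟩
    obtain ⟨n, C, hn⟩ := h2 p (Finset.mem_insert_self p S)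
    -- One power beyond `n` makes the product tend to `0`, which is also its value at `p`; the
    -- singularity is then removable.
    have hG1 : AnalyticAt ℂ (fun t => (t - p) ^ (n + 1) * G t) p := by
      refine Complex.analyticAt_of_differentiable_on_punctured_nhds_of_continuousAt ?_ ?_
      · have : ∀ᶠ t in 𝓝[≠] p, t ∉ S := (S.finite_toSet.isClosed.isOpen_compl.mem_nhds
          (by simpa using hp : p ∈ (S : Set ℂ)ᶜ)) |> fun h => mem_nhdsWithin_of_mem_nhds h
        filter_upwards [this, self_mem_nhdsWithin] with t h4 h5
        have := (h1 t (by simp [h4, show t ≠ p from h5])).differentiableAt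
        fun_prop
      · rw [continuousAt_iff_punctured_nhds]
        simp only [sub_self, ne_eq, Nat.add_eq_zero_iff, one_ne_zero, and_false, not_false_eq_true,
          zero_pow, zero_mul]
        have h5 : Tendsto (fun t : ℂ => C * ‖t - p‖) (𝓝[≠] p) (𝓝 0) := by
          have : ContinuousAt (fun t : ℂ => C * ‖t - p‖) p := by fun_prop
          simpa using this.tendsto.mono_left nhdsWithin_le_nhds
        refine squeeze_zero_norm' ?_ h5
        filter_upwards [hn] with t ht
        rw [norm_mul, norm_pow, pow_succ]
        nlinarith [norm_nonneg (t - p)]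
    have a1 : ∀ t ∉ S, AnalyticAt ℂ (fun t => (t - p) ^ (n + 1) * G t) t := by
      intro t ht
      by_cases htp : t = p
      · rw [htp]; exact hG1
      · have := h1 t (by simp [ht, htp])
        fun_prop
    have a2 : ∀ q ∈ S, ∃ (k : ℕ) (C : ℝ), ∀ᶠ t in 𝓝[≠] q,
        ‖(t - p) ^ (n + 1) * G t‖ * ‖t - q‖ ^ k ≤ C := by
      intro q hq
      obtain ⟨k, C', hk⟩ := h2 q (Finset.mem_insert_of_mem hq)
      refine ⟨k, (‖q - p‖ + 1) ^ (n + 1) * C', ?_⟩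
      have hc : ContinuousAt (fun t : ℂ => ‖t - p‖) q := by fun_prop
      filter_upwards [hk, (hc.eventually_le_const (lt_add_one _)).filter_mono nhdsWithin_le_nhds]
        with t h4 h5
      rw [norm_mul, norm_pow, mul_assoc]
      exact mul_le_mul (pow_le_pow_left₀ (norm_nonneg _) h5 _) h4 (by positivity) (by positivity)
    have a3 : ∃ (k : ℕ) (C : ℝ), ∀ᶠ t in Bornology.cobounded ℂ,
        ‖(t - p) ^ (n + 1) * G t‖ ≤ C * ‖t‖ ^ k := by
      refine ⟨m + (n + 1), D * (1 + ‖p‖) ^ (n + 1), ?_⟩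
      have h4 : ∀ᶠ t : ℂ in Bornology.cobounded ℂ, 1 ≤ ‖t‖ :=
        tendsto_norm_cobounded_atTop.eventually_ge_atTop 1
      filter_upwards [h3, h4] with t h5 h6
      have h7 : ‖t - p‖ ≤ (1 + ‖p‖) * ‖t‖ := by
        refine (norm_sub_le _ _).trans ?_
        nlinarith [norm_nonneg p]
      rw [norm_mul, norm_pow]
      calc _ ≤ ((1 + ‖p‖) * ‖t‖) ^ (n + 1) * (D * ‖t‖ ^ m) :=
            mul_le_mul (pow_le_pow_left₀ (norm_nonneg _) h7 _) h5 (norm_nonneg _) (by positivity)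
        _ = _ := by rw [mul_pow]; ring
    obtain ⟨P, Q, hQ, hPQ⟩ := ih a1 a2 a3
    refine ⟨P, Q * (Polynomial.X - Polynomial.C p) ^ (n + 1),
      mul_ne_zero hQ (pow_ne_zero _ (Polynomial.X_sub_C_ne_zero p)), fun t ht => ?_⟩
    have ht1 : t - p ≠ 0 := sub_ne_zero.2 fun h => ht (by simp [h])
    obtain ⟨h4, h5⟩ := hPQ t (fun h => ht (by simp at h; simp [h]))
    have h6 : (t - p) ^ (n + 1) ≠ 0 := pow_ne_zero _ ht1
    simp only [Polynomial.eval_mul, Polynomial.eval_pow, Polynomial.eval_sub, Polynomial.eval_X,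
      Polynomial.eval_C]
    refine ⟨mul_ne_zero h4 h6, ?_⟩
    rw [← div_div, ← h5]
    field_simp

theorem IsRational.sub {S : Set ℂ} {F G : ℂ → ℂ} (hF : IsRational S F) (hG : IsRational S G) :
    IsRational S fun t => F t - G t := by
  obtain ⟨P, Q, hQ, h⟩ := hF
  obtain ⟨P', Q', hQ', h'⟩ := hG
  refine ⟨P * Q' - P' * Q, Q * Q', mul_ne_zero hQ hQ', fun t ht => ?_⟩
  obtain ⟨h1, h2⟩ := h t ht
  obtain ⟨h3, h4⟩ := h' t ht
  simp only [Polynomial.eval_mul, Polynomial.eval_sub]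
  refine ⟨mul_ne_zero h1 h3, ?_⟩
  rw [h2, h4, div_sub_div _ _ h1 h3]
  ring

theorem IsRational.meromorphicAt {S : Set ℂ} (hS : S.Finite) {G : ℂ → ℂ} (hG : IsRational S G)
    (p : ℂ) : MeromorphicAt G p := by
  obtain ⟨P, Q, hQ, h⟩ := hG
  refine ((analyticAt_eval P p).meromorphicAt.div (analyticAt_eval Q p).meromorphicAt).congr ?_
  filter_upwards [nhdsNE_le_cofinite p hS.compl_mem_cofinite] with t ht
  exact ((h t ht).2).symm

/-! ### Growth of solutions -/

/-- Grönwall towards the origin: the differential inequality makes `h r * r ^ K` monotone. -/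
theorem mul_pow_le_of_deriv_le {h h' : ℝ → ℝ} {K : ℕ} {δ : ℝ}
    (hh : ∀ r ∈ Set.Ioc 0 δ, HasDerivAt h (h' r) r) (hK : ∀ r ∈ Set.Ioc 0 δ, |r * h' r| ≤ K * h r)
    {r : ℝ} (hr : r ∈ Set.Ioc 0 δ) : h r * r ^ K ≤ h δ * δ ^ K := by
  have hd : ∀ s ∈ Set.Ioc 0 δ, HasDerivAt (fun s => h s * s ^ K)
      (h' s * s ^ K + h s * (K * s ^ (K - 1))) s := fun s hs =>
    (hh s hs).mul (hasDerivAt_pow K s)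
  have hmono : MonotoneOn (fun s => h s * s ^ K) (Set.Ioc 0 δ) := by
    refine monotoneOn_of_deriv_nonneg (convex_Ioc 0 δ)
      (fun s hs => (hd s hs).continuousAt.continuousWithinAt)
      (fun s hs => (hd s (interior_subset hs)).differentiableAt.differentiableWithinAt)
      fun s hs => ?_
    have hs' := interior_subset hs
    rw [(hd s hs').deriv]
    have h1 := (abs_le.1 (hK s hs')).1
    have hs0 : 0 < s := hs'.1
    refine nonneg_of_mul_nonneg_right (a := s) ?_ hs0
    have h2 : s * (h' s * s ^ K + h s * (K * s ^ (K - 1))) = s ^ K * (s * h' s + K * h s) := by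
      rcases K with _ | K
      · simp
      · simp only [Nat.add_sub_cancel, pow_succ]; ring
    rw [h2]
    exact mul_nonneg (pow_nonneg hs0.le _) (by linarith)
  exact hmono hr ⟨hr.1.trans_le hr.2, le_rfl⟩ hr.2

/-- Grönwall towards infinity: the same inequality makes `h r / r ^ K` antitone. -/
theorem le_mul_pow_of_deriv_le {h h' : ℝ → ℝ} {K : ℕ} {R : ℝ} (hR : 0 < R)
    (hh : ∀ r ∈ Set.Ici R, HasDerivAt h (h' r) r) (hK : ∀ r ∈ Set.Ici R, |r * h' r| ≤ K * h r)
    {r : ℝ} (hr : r ∈ Set.Ici R) : h r / r ^ K ≤ h R / R ^ K := by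
  have hpos : ∀ s ∈ Set.Ici R, 0 < s := fun s hs => hR.trans_le hs
  have hd : ∀ s ∈ Set.Ici R, HasDerivAt (fun s => h s / s ^ K)
      ((h' s * s ^ K - h s * (K * s ^ (K - 1))) / (s ^ K) ^ 2) s := fun s hs =>
    (hh s hs).div (hasDerivAt_pow K s) (pow_ne_zero _ (hpos s hs).ne')
  have hanti : AntitoneOn (fun s => h s / s ^ K) (Set.Ici R) := by
    refine antitoneOn_of_deriv_nonpos (convex_Ici R)
      (fun s hs => (hd s hs).continuousAt.continuousWithinAt)
      (fun s hs => (hd s (interior_subset hs)).differentiableAt.differentiableWithinAt)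
      fun s hs => ?_
    have hs' := interior_subset hs
    rw [(hd s hs').deriv]
    have h1 := (abs_le.1 (hK s hs')).2
    have hs0 : 0 < s := hpos s hs'
    refine div_nonpos_of_nonpos_of_nonneg ?_ (by positivity)
    refine nonpos_of_mul_nonpos_right (a := s) ?_ hs0
    have h2 : s * (h' s * s ^ K - h s * (K * s ^ (K - 1))) = s ^ K * (s * h' s - K * h s) := by
      rcases K with _ | K
      · simp
      · simp only [Nat.add_sub_cancel, pow_succ]; ring
    rw [h2]
    exact mul_nonpos_of_nonneg_of_nonpos (pow_nonneg hs0.le _) (by linarith)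
  exact hanti Set.self_mem_Ici hr hr

/-- The size of the 2-jet of `f` at `t`, scaled by the distance to `p`. -/
def jetEnergy (p : ℂ) (f : ℂ → ℂ) (t : ℂ) : ℝ :=
  ‖f t‖ ^ 2 + ‖(t - p) * deriv f t‖ ^ 2 + ‖(t - p) ^ 2 * deriv (deriv f) t‖ ^ 2


/-- Let `a0`, `a1`, `a2` be the scaled jet at `t = p + rθ`. Then `r d/dr` sends them to `a1`, `a1 +
a2` and `2 a2 + (rθ)² u a1 + (rθ)³ v a0`, a system with bounded coefficients at a regular
singularity. The constant `5 + 2 K` results from estimating the cross terms by squares. -/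
theorem exists_hasDerivAt_jetEnergy {u v f : ℂ → ℂ} {p θ : ℂ} {r K : ℝ}
    (hf : AnalyticAt ℂ f (p + r * θ)) (h : oper u v f (p + r * θ) = 0)
    (hu : ‖(r * θ) ^ 2 * u (p + r * θ)‖ ≤ K) (hv : ‖(r * θ) ^ 3 * v (p + r * θ)‖ ≤ K) :
    ∃ e', HasDerivAt (fun s : ℝ => jetEnergy p f (p + s * θ)) e' r ∧
      |r * e'| ≤ (5 + 2 * K) * jetEnergy p f (p + r * θ) := by
  set t := p + r * θ with ht
  have hline : ∀ g : ℂ → ℂ, AnalyticAt ℂ g t →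
      HasDerivAt (fun w : ℂ => g (p + w * θ)) (deriv g t * θ) (r : ℂ) := by
    intro g hg
    have h1 : HasDerivAt (fun w : ℂ => p + w * θ) θ (r : ℂ) := by
      simpa using ((hasDerivAt_id (r : ℂ)).mul_const θ).const_add p
    exact (hg.differentiableAt.hasDerivAt).comp (r : ℂ) h1
  have hw : HasDerivAt (fun w : ℂ => w * θ) θ (r : ℂ) := by
    simpa using (hasDerivAt_id (r : ℂ)).mul_const θ
  have d0 := (hline f hf).comp_ofReal
  have d1 := (hw.mul (hline _ hf.deriv)).comp_ofReal
  have d2 := ((hw.pow 2).mul (hline _ hf.deriv.deriv)).comp_ofReal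
  set a0 := f t with ha0
  set a1 := (r * θ) * deriv f t with ha1
  set a2 := (r * θ) ^ 2 * deriv (deriv f) t with ha2
  have hE := (d0.norm_sq.add d1.norm_sq).add d2.norm_sq
  refine ⟨_, hE.congr_of_eventuallyEq (.of_forall fun s => ?_), ?_⟩
  · simp [jetEnergy]
  have hE0 : jetEnergy p f t = ‖a0‖ ^ 2 + ‖a1‖ ^ 2 + ‖a2‖ ^ 2 := by simp [jetEnergy, ha1, ha2, ht, ha0]
  have inner_le : ∀ {a b c : ℂ}, (r : ℂ) * b = c → |r * (2 * inner ℝ a b)| ≤ 2 * ‖a‖ * ‖c‖ := by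
    intro a b c hc
    have h1 : r * (2 * inner ℝ a b) = 2 * inner ℝ a c := by
      rw [← hc, ← Complex.real_smul, real_inner_smul_right]; ring
    rw [h1, abs_mul, abs_two, mul_assoc]
    exact mul_le_mul_of_nonneg_left (abs_real_inner_le_norm a c) two_pos.le
  have hthird : deriv (deriv (deriv f)) t = u t * deriv f t + v t * f t := by
    rw [oper] at h
    linear_combination h
  rw [hE0, mul_add, mul_add]
  have b0 := inner_le (a := a0) (b := deriv f t * θ) (c := a1) (by rw [ha1]; ring)
  have b1 := inner_le (a := a1) (b := θ * deriv f t + (r * θ) * (deriv (deriv f) t * θ))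
    (c := a1 + a2) (by rw [ha1, ha2]; ring)
  have b2 := inner_le (a := a2) (b := ((2 : ℕ) : ℂ) * (r * θ) ^ (2 - 1) * θ * deriv (deriv f) t +
      (r * θ) ^ 2 * (deriv (deriv (deriv f)) t * θ))
    (c := 2 * a2 + ((r * θ) ^ 2 * u t) * a1 + ((r * θ) ^ 3 * v t) * a0)
    (by rw [hthird, ha1, ha2, ha0]; push_cast; ring)
  have n1 : ‖a1 + a2‖ ≤ ‖a1‖ + ‖a2‖ := norm_add_le _ _
  have n2 : ‖2 * a2 + ((r * θ) ^ 2 * u t) * a1 + ((r * θ) ^ 3 * v t) * a0‖ ≤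
      2 * ‖a2‖ + K * ‖a1‖ + K * ‖a0‖ := by
    refine (norm_add₃_le).trans ?_
    rw [norm_mul, norm_mul _ a1, norm_mul _ a0, Complex.norm_ofNat]
    gcongr
  have hK : 0 ≤ K := (norm_nonneg _).trans hu
  refine (abs_add_three _ _ _).trans ((add_le_add (add_le_add b0 b1) b2).trans ?_)
  have p0 := norm_nonneg a0
  have p1 := norm_nonneg a1
  have p2 := norm_nonneg a2
  have m1 := mul_le_mul_of_nonneg_left n1 (mul_nonneg two_pos.le p1)
  have m2 := mul_le_mul_of_nonneg_left n2 (mul_nonneg two_pos.le p2)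
  have q1 := mul_nonneg hK (sq_nonneg (‖a2‖ - ‖a1‖))
  have q2 := mul_nonneg hK (sq_nonneg (‖a2‖ - ‖a0‖))
  have q3 := mul_nonneg hK (sq_nonneg ‖a0‖)
  have q4 := mul_nonneg hK (sq_nonneg ‖a1‖)
  nlinarith [sq_nonneg (‖a0‖ - ‖a1‖), sq_nonneg (‖a1‖ - ‖a2‖)]

section

/-! ### Single-valued functions built from a system of branches -/

/-- A linear combination of functions. -/
def comb (v : Fin 3 → ℂ) (ψ : Fin 3 → ℂ → ℂ) (t : ℂ) : ℂ := ∑ j, v j * ψ j t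

theorem analyticAt_iterate_deriv {f : ℂ → ℂ} {t : ℂ} (hf : AnalyticAt ℂ f t) (i : ℕ) :
    AnalyticAt ℂ (deriv^[i] f) t := by
  induction i generalizing f with
  | zero => exact hf
  | succ i ih => exact ih hf.deriv

theorem iterate_deriv_congr {f g : ℂ → ℂ} {t : ℂ} (h : f =ᶠ[𝓝 t] g) (i : ℕ) :
    deriv^[i] f =ᶠ[𝓝 t] deriv^[i] g := by
  induction i generalizing f g with
  | zero => exact h
  | succ i ih => exact ih h.deriv

theorem iterate_deriv_const_mul (c : ℂ) (f : ℂ → ℂ) (i : ℕ) :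
    deriv^[i] (fun s => c * f s) = fun s => c * deriv^[i] f s := by
  induction i generalizing f with
  | zero => rfl
  | succ i ih =>
    have : deriv (fun s => c * f s) = fun s => c * deriv f s := by
      ext s; exact deriv_const_mul_field c
    rw [Function.iterate_succ_apply, this, ih, Function.iterate_succ_apply]

theorem analyticAt_comb {v : Fin 3 → ℂ} {ψ : Fin 3 → ℂ → ℂ} {t : ℂ}
    (hψ : ∀ j, AnalyticAt ℂ (ψ j) t) : AnalyticAt ℂ (comb v ψ) t :=
  Finset.analyticAt_fun_sum _ fun j _ => analyticAt_const.mul (hψ j)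

theorem deriv_comb {v : Fin 3 → ℂ} {ψ : Fin 3 → ℂ → ℂ} {t : ℂ}
    (hψ : ∀ j, AnalyticAt ℂ (ψ j) t) :
    deriv (comb v ψ) =ᶠ[𝓝 t] comb v fun j => deriv (ψ j) := by
  filter_upwards [eventually_all.2 fun j => (hψ j).eventually_analyticAt] with s hs
  exact (HasDerivAt.fun_sum fun j _ => (hs j).differentiableAt.hasDerivAt.const_mul (v j)).deriv

theorem iterate_deriv_comb {v : Fin 3 → ℂ} (i : ℕ) {ψ : Fin 3 → ℂ → ℂ} {t : ℂ}
    (hψ : ∀ j, AnalyticAt ℂ (ψ j) t) :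
    deriv^[i] (comb v ψ) =ᶠ[𝓝 t] comb v fun j => deriv^[i] (ψ j) := by
  induction i generalizing ψ with
  | zero => exact .rfl
  | succ i ih =>
    exact (iterate_deriv_congr (deriv_comb hψ) i).trans (ih fun j => (hψ j).deriv)

theorem oper_comb {u v : ℂ → ℂ} {ψ : Fin 3 → ℂ → ℂ} {t : ℂ} (hψ : ∀ j, AnalyticAt ℂ (ψ j) t)
    (h : ∀ j, oper u v (ψ j) t = 0) (c : Fin 3 → ℂ) : oper u v (comb c ψ) t = 0 := by
  have h1 := (iterate_deriv_comb (v := c) 1 hψ).eq_of_nhds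
  have h3 := (iterate_deriv_comb (v := c) 3 hψ).eq_of_nhds
  simp only [Function.iterate_succ, Function.iterate_zero, Function.comp, id] at h1 h3
  have e : oper u v (comb c ψ) t = ∑ j, c j * oper u v (ψ j) t := by
    rw [oper, h1, h3]
    simp only [comb, Finset.mul_sum, ← Finset.sum_sub_distrib, oper]
    exact Finset.sum_congr rfl fun j _ => by ring
  rw [e]
  exact Finset.sum_eq_zero fun j _ => by rw [h j, mul_zero]

/-- Some branch at `t`. -/
def branch (Br : ℂ → (Fin 3 → ℂ → ℂ) → Prop) (t : ℂ) : Fin 3 → ℂ → ℂ := Classical.epsilon (Br t)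

/-- Products of three derivatives of linear combinations of the branches. -/
def triple (Br : ℂ → (Fin 3 → ℂ → ℂ) → Prop) (a : Fin 3 → (Fin 3 → ℂ) × ℕ) (t : ℂ) : ℂ :=
  ∏ k, comb (a k).1 (fun j => deriv^[(a k).2] (branch Br t j)) t

/-- The total size of the 2-jets of the branches, scaled by the distance to `p`. -/
def energy (Br : ℂ → (Fin 3 → ℂ → ℂ) → Prop) (p t : ℂ) : ℝ := ∑ j, jetEnergy p (branch Br t j) t

theorem continuousAt_jetEnergy {p : ℂ} {f : ℂ → ℂ} {t : ℂ} (hf : AnalyticAt ℂ f t) :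
    ContinuousAt (jetEnergy p f) t := by
  have h0 := hf.continuousAt
  have h1 := hf.deriv.continuousAt
  have h2 := hf.deriv.deriv.continuousAt
  unfold jetEnergy
  fun_prop

theorem jetEnergy_nonneg (p : ℂ) (f : ℂ → ℂ) (t : ℂ) : 0 ≤ jetEnergy p f t := by
  unfold jetEnergy; positivity

namespace BranchSystem

variable {u v : ℂ → ℂ} {S : Set ℂ} {Br : ℂ → (Fin 3 → ℂ → ℂ) → Prop}

theorem branch_of_exists {t : ℂ} {ψ : Fin 3 → ℂ → ℂ} (h : Br t ψ) : Br t (branch Br t) :=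
  Classical.epsilon_spec ⟨ψ, h⟩

theorem branch_spec (H : BranchSystem u v S Br) {t : ℂ} (ht : t ∉ S) : Br t (branch Br t) :=
  Classical.epsilon_spec (H.exists_branch t ht)

/-- A change of branch multiplies each of the three factors by the same `c`, and `c ^ 3 = 1`. This
is why products of exactly three factors are used. -/
theorem triple_eq (H : BranchSystem u v S Br) {t : ℂ} {ψ : Fin 3 → ℂ → ℂ} (hψ : Br t ψ)
    (a : Fin 3 → (Fin 3 → ℂ) × ℕ) :
    triple Br a t = ∏ k, comb (a k).1 (fun j => deriv^[(a k).2] (ψ j)) t := by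
  obtain ⟨c, hc, h⟩ := H.unique hψ (branch_of_exists hψ)
  have e : ∀ k, comb (a k).1 (fun j => deriv^[(a k).2] (branch Br t j)) t =
      c * comb (a k).1 (fun j => deriv^[(a k).2] (ψ j)) t := fun k => by
    simp only [comb, Finset.mul_sum]
    refine Finset.sum_congr rfl fun j _ => ?_
    rw [(iterate_deriv_congr (h j) (a k).2).eq_of_nhds, iterate_deriv_const_mul]
    ring
  simp only [triple, e, Finset.prod_mul_distrib, Finset.prod_const, Finset.card_univ,
    Fintype.card_fin, hc, one_mul]

theorem eventually_triple_eq (H : BranchSystem u v S Br) {t : ℂ} {ψ : Fin 3 → ℂ → ℂ} (hψ : Br t ψ)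
    (a : Fin 3 → (Fin 3 → ℂ) × ℕ) :
    triple Br a =ᶠ[𝓝 t] fun s => ∏ k, comb (a k).1 (fun j => deriv^[(a k).2] (ψ j)) s :=
  (H.eventually hψ).mono fun _ hs => H.triple_eq hs a

theorem analyticAt_triple (H : BranchSystem u v S Br) {t : ℂ} (ht : t ∉ S)
    (a : Fin 3 → (Fin 3 → ℂ) × ℕ) : AnalyticAt ℂ (triple Br a) t := by
  have hψ := H.branch_spec ht
  refine AnalyticAt.congr ?_ (H.eventually_triple_eq hψ a).symm
  exact Finset.analyticAt_fun_prod _ fun k _ =>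
    analyticAt_comb fun j => analyticAt_iterate_deriv (H.analyticAt hψ j) _

/-- Branches differ by a scalar of modulus one, so the energy is single-valued. -/
theorem energy_eq (H : BranchSystem u v S Br) {t : ℂ} {ψ : Fin 3 → ℂ → ℂ} (hψ : Br t ψ) (p : ℂ) :
    energy Br p t = ∑ j, jetEnergy p (ψ j) t := by
  obtain ⟨c, hc, h⟩ := H.unique hψ (branch_of_exists hψ)
  have hc1 : ‖c‖ = 1 := by
    have := congrArg norm hc
    rw [norm_pow, norm_one] at this
    exact (pow_eq_one_iff_of_nonneg (norm_nonneg c) (by norm_num)).1 this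
  refine Finset.sum_congr rfl fun j _ => ?_
  have e0 := (h j).eq_of_nhds
  have e1 := (iterate_deriv_congr (h j) 1).eq_of_nhds
  have e2 := (iterate_deriv_congr (h j) 2).eq_of_nhds
  rw [iterate_deriv_const_mul] at e1 e2
  simp only [Function.iterate_succ, Function.iterate_zero, Function.comp, id] at e1 e2
  change branch Br t j t = _ at e0
  change deriv (branch Br t j) t = _ at e1
  change deriv (deriv (branch Br t j)) t = _ at e2
  rw [jetEnergy, jetEnergy, e0, e1, e2]
  simp [hc1]

theorem eventually_energy_eq (H : BranchSystem u v S Br) {t : ℂ} {ψ : Fin 3 → ℂ → ℂ}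
    (hψ : Br t ψ) (p : ℂ) : energy Br p =ᶠ[𝓝 t] fun s => ∑ j, jetEnergy p (ψ j) s :=
  (H.eventually hψ).mono fun _ hs => H.energy_eq hs p

theorem continuousAt_energy (H : BranchSystem u v S Br) {t : ℂ} (ht : t ∉ S) (p : ℂ) :
    ContinuousAt (energy Br p) t := by
  have hψ := H.branch_spec ht
  refine ContinuousAt.congr ?_ (H.eventually_energy_eq hψ p).symm
  exact tendsto_finsetSum _ fun j _ => continuousAt_jetEnergy (H.analyticAt hψ j)

theorem exists_hasDerivAt_energy (H : BranchSystem u v S Br) {p θ : ℂ} {r K : ℝ}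
    (ht : p + r * θ ∉ S) (hu : ‖(r * θ) ^ 2 * u (p + r * θ)‖ ≤ K)
    (hv : ‖(r * θ) ^ 3 * v (p + r * θ)‖ ≤ K) :
    ∃ e', HasDerivAt (fun s : ℝ => energy Br p (p + s * θ)) e' r ∧
      |r * e'| ≤ (5 + 2 * K) * energy Br p (p + r * θ) := by
  have hψ := H.branch_spec ht
  choose e he hb using fun j => exists_hasDerivAt_jetEnergy (H.analyticAt hψ j)
    (H.solution hψ j).self_of_nhds hu hv
  refine ⟨∑ j, e j, (HasDerivAt.fun_sum fun j _ => he j).congr_of_eventuallyEq ?_, ?_⟩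
  · have hc : ContinuousAt (fun s : ℝ => p + s * θ) r := by fun_prop
    exact hc.eventually (H.eventually_energy_eq hψ p)
  · rw [Finset.mul_sum, energy, Finset.mul_sum]
    exact (Finset.abs_sum_le_sum_abs _ _).trans (Finset.sum_le_sum fun j _ => hb j)

theorem energy_nonneg (p t : ℂ) : 0 ≤ energy Br p t :=
  Finset.sum_nonneg fun _ _ => jetEnergy_nonneg p _ t

/-- The Grönwall estimate is applied on each ray from `p`. Since the energy is single-valued and
continuous, compactness of a small circle gives one initial bound for all directions. -/
theorem exists_energy_bound (H : BranchSystem u v S Br) {p : ℂ} {K : ℝ}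
    (hp : ∀ᶠ t in 𝓝[≠] p, t ∉ S ∧ ‖(t - p) ^ 2 * u t‖ ≤ K ∧ ‖(t - p) ^ 3 * v t‖ ≤ K) :
    ∃ (n : ℕ) (C : ℝ), ∀ᶠ t in 𝓝[≠] p, energy Br p t * ‖t - p‖ ^ n ≤ C := by
  obtain ⟨δ, hδ, hball⟩ := Metric.eventually_nhds_iff_ball.1 (eventually_nhdsWithin_iff.1 hp)
  set ε := δ / 2 with hε
  have hε0 : 0 < ε := by positivity
  have hmem : ∀ {θ : ℂ}, ‖θ‖ = 1 → ∀ r ∈ Set.Ioc 0 ε, p + r * θ ∉ S ∧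
      ‖(r * θ) ^ 2 * u (p + r * θ)‖ ≤ K ∧ ‖(r * θ) ^ 3 * v (p + r * θ)‖ ≤ K := by
    intro θ hθ r hr
    have := hball (p + r * θ) (by
      rw [mem_ball_iff_norm, add_sub_cancel_left, norm_mul, hθ, mul_one, Complex.norm_real,
        Real.norm_of_nonneg hr.1.le]
      linarith [hr.2]) (by
      have h1 : (r : ℂ) ≠ 0 := by exact_mod_cast hr.1.ne'
      have h2 : θ ≠ 0 := by rintro rfl; simp at hθ
      simp [h1, h2])
    simpa using this
  have hcomp : ContinuousOn (energy Br p) (Metric.sphere p ε) := fun t ht => by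
    have h1 : ‖t - p‖ = ε := mem_sphere_iff_norm.1 ht
    refine (H.continuousAt_energy (hball t ?_ ?_).1 p).continuousWithinAt
    · rw [mem_ball_iff_norm, h1]; linarith
    · rintro rfl
      simp at h1; linarith
  obtain ⟨M, hM⟩ := (isCompact_sphere p ε).exists_bound_of_continuousOn hcomp
  obtain ⟨n, hn⟩ := exists_nat_ge (5 + 2 * K)
  refine ⟨n, M * ε ^ n, ?_⟩
  filter_upwards [nhdsWithin_le_nhds (Metric.closedBall_mem_nhds p hε0), self_mem_nhdsWithin]
    with t h1 h2
  have h3 : 0 < ‖t - p‖ := norm_pos_iff.2 (sub_ne_zero.2 h2)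
  set θ := (t - p) / ‖t - p‖ with hθ
  have hθ1 : ‖θ‖ = 1 := by
    rw [hθ, norm_div, Complex.norm_real, norm_norm, div_self h3.ne']
  have hpt : p + ((‖t - p‖ : ℝ) : ℂ) * θ = t := by
    have : ((‖t - p‖ : ℝ) : ℂ) ≠ 0 := by exact_mod_cast h3.ne'
    rw [hθ]; field_simp; ring
  have hr : ‖t - p‖ ∈ Set.Ioc 0 ε := ⟨h3, mem_closedBall_iff_norm.1 h1⟩
  -- The derivative is given the default value `0` outside the interval, so that it can be chosen as
  -- a function on all of `ℝ`.
  have hex : ∀ r : ℝ, ∃ e', r ∈ Set.Ioc 0 ε →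
      HasDerivAt (fun s : ℝ => energy Br p (p + s * θ)) e' r ∧
      |r * e'| ≤ (5 + 2 * K) * energy Br p (p + r * θ) := by
    intro r
    by_cases hr : r ∈ Set.Ioc 0 ε
    · obtain ⟨k1, k2, k3⟩ := hmem hθ1 r hr
      obtain ⟨e', he⟩ := H.exists_hasDerivAt_energy k1 k2 k3
      exact ⟨e', fun _ => he⟩
    · exact ⟨0, fun h => absurd h hr⟩
  choose e' he' using hex
  have key := mul_pow_le_of_deriv_le (K := n) (fun r hr => (he' r hr).1)
    (fun r hr => (he' r hr).2.trans (mul_le_mul_of_nonneg_right hn (energy_nonneg _ _))) hr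
  rw [hpt] at key
  refine key.trans (mul_le_mul_of_nonneg_right ?_ (by positivity))
  exact (le_abs_self _).trans (hM _ (by
    rw [mem_sphere_iff_norm, add_sub_cancel_left, norm_mul, hθ1, mul_one, Complex.norm_real,
      Real.norm_of_nonneg hε0.le]))

theorem exists_energy_bound_cobounded (H : BranchSystem u v S Br) {K : ℝ}
    (hp : ∀ᶠ t in Bornology.cobounded ℂ, t ∉ S ∧ ‖t ^ 2 * u t‖ ≤ K ∧ ‖t ^ 3 * v t‖ ≤ K) :
    ∃ (n : ℕ) (C : ℝ), ∀ᶠ t in Bornology.cobounded ℂ, energy Br 0 t ≤ C * ‖t‖ ^ n := by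
  obtain ⟨R₀, -, hR₀⟩ := (Metric.hasBasis_cobounded_compl_closedBall (0 : ℂ)).eventually_iff.1 hp
  set R := max R₀ 0 + 1 with hR
  have hRpos : 0 < R := by positivity
  have hlt : R₀ < R := (le_max_left _ _).trans_lt (lt_add_one _)
  have hmem' : ∀ {t : ℂ}, R ≤ ‖t‖ → t ∉ S ∧ ‖t ^ 2 * u t‖ ≤ K ∧ ‖t ^ 3 * v t‖ ≤ K := fun {t} ht =>
    hR₀ (by simpa using hlt.trans_le ht)
  have hmem : ∀ {θ : ℂ}, ‖θ‖ = 1 → ∀ r ∈ Set.Ici R, 0 + r * θ ∉ S ∧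
      ‖(r * θ) ^ 2 * u (0 + r * θ)‖ ≤ K ∧ ‖(r * θ) ^ 3 * v (0 + r * θ)‖ ≤ K := by
    intro θ hθ r hr
    simp only [zero_add]
    refine hmem' ?_
    rw [norm_mul, hθ, mul_one, Complex.norm_real]
    exact (Set.mem_Ici.1 hr).trans (le_abs_self r)
  have hcomp : ContinuousOn (energy Br 0) (Metric.sphere 0 R) := fun t ht =>
    (H.continuousAt_energy (hmem' (by simpa using (mem_sphere_zero_iff_norm.1 ht).ge)).1
      0).continuousWithinAt
  obtain ⟨M, hM⟩ := (isCompact_sphere (0 : ℂ) R).exists_bound_of_continuousOn hcomp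
  obtain ⟨n, hn⟩ := exists_nat_ge (5 + 2 * K)
  refine ⟨n, M / R ^ n, ?_⟩
  filter_upwards [tendsto_norm_cobounded_atTop.eventually_ge_atTop R] with t h1
  have h3 : 0 < ‖t‖ := hRpos.trans_le h1
  set θ := t / ‖t‖ with hθ
  have hθ1 : ‖θ‖ = 1 := by
    rw [hθ, norm_div, Complex.norm_real, norm_norm, div_self h3.ne']
  have hpt : 0 + ((‖t‖ : ℝ) : ℂ) * θ = t := by
    have : ((‖t‖ : ℝ) : ℂ) ≠ 0 := by exact_mod_cast h3.ne'
    rw [hθ]; field_simp; ring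
  have hex : ∀ r : ℝ, ∃ e', r ∈ Set.Ici R →
      HasDerivAt (fun s : ℝ => energy Br 0 (0 + s * θ)) e' r ∧
      |r * e'| ≤ (5 + 2 * K) * energy Br 0 (0 + r * θ) := by
    intro r
    by_cases hr : r ∈ Set.Ici R
    · obtain ⟨k1, k2, k3⟩ := hmem hθ1 r hr
      obtain ⟨e', he⟩ := H.exists_hasDerivAt_energy k1 k2 k3
      exact ⟨e', fun _ => he⟩
    · exact ⟨0, fun h => absurd h hr⟩
  choose e' he' using hex
  have key := le_mul_pow_of_deriv_le (K := n) hRpos (fun r hr => (he' r hr).1)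
    (fun r hr => (he' r hr).2.trans (mul_le_mul_of_nonneg_right hn (energy_nonneg _ _))) h1
  rw [hpt] at key
  rw [div_le_iff₀ (by positivity)] at key
  refine key.trans (mul_le_mul_of_nonneg_right ?_ (by positivity))
  refine div_le_div_of_nonneg_right ?_ (by positivity)
  exact (le_abs_self _).trans (hM _ (by
    rw [mem_sphere_zero_iff_norm, zero_add, norm_mul, hθ1, mul_one, Complex.norm_real,
      Real.norm_of_nonneg hRpos.le]))

theorem norm_pow_mul_le_energy (p t : ℂ) (j : Fin 3) {i : ℕ} (hi : i ≤ 1) :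
    ‖t - p‖ ^ i * ‖deriv^[i] (branch Br t j) t‖ ≤ 1 + energy Br p t := by
  have h1 : jetEnergy p (branch Br t j) t ≤ energy Br p t :=
    Finset.single_le_sum (f := fun j => jetEnergy p (branch Br t j) t)
      (fun j _ => jetEnergy_nonneg p _ t) (Finset.mem_univ j)
  have h2 : (‖t - p‖ ^ i * ‖deriv^[i] (branch Br t j) t‖) ^ 2 ≤ jetEnergy p (branch Br t j) t := by
    unfold jetEnergy
    interval_cases i
    · simp only [pow_zero, one_mul, Function.iterate_zero, id]
      nlinarith [sq_nonneg ‖(t - p) * deriv (branch Br t j) t‖,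
        sq_nonneg ‖(t - p) ^ 2 * deriv (deriv (branch Br t j)) t‖]
    · simp only [pow_one, Function.iterate_one, ← norm_mul]
      nlinarith [sq_nonneg ‖branch Br t j t‖,
        sq_nonneg ‖(t - p) ^ 2 * deriv (deriv (branch Br t j)) t‖]
  -- From a bound on `x ^ 2` to one on `x`, by `x ≤ 1 + x ^ 2`.
  nlinarith [sq_nonneg (‖t - p‖ ^ i * ‖deriv^[i] (branch Br t j) t‖ - 1)]

theorem norm_comb_le {t : ℂ} (a : Fin 3 → ℂ) {ψ : Fin 3 → ℂ → ℂ} {B : ℝ}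
    (hB : ∀ j, ‖ψ j t‖ ≤ B) : ‖comb a ψ t‖ ≤ (∑ j, ‖a j‖) * B := by
  rw [comb, Finset.sum_mul]
  refine (norm_sum_le _ _).trans (Finset.sum_le_sum fun j _ => ?_)
  rw [norm_mul]
  exact mul_le_mul_of_nonneg_left (hB j) (norm_nonneg _)

theorem isRational_triple {S : Finset ℂ} (H : BranchSystem u v S Br)
    (hp : ∀ p ∈ S, ∃ K : ℝ, ∀ᶠ t in 𝓝[≠] p, ‖(t - p) ^ 2 * u t‖ ≤ K ∧ ‖(t - p) ^ 3 * v t‖ ≤ K)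
    (hinf : ∃ K : ℝ, ∀ᶠ t in Bornology.cobounded ℂ, ‖t ^ 2 * u t‖ ≤ K ∧ ‖t ^ 3 * v t‖ ≤ K)
    {a : Fin 3 → (Fin 3 → ℂ) × ℕ} (ha : ∀ k, (a k).2 ≤ 1) : IsRational S (triple Br a) := by
  have hSc : ∀ᶠ t in cofinite, t ∉ (S : Set ℂ) := S.finite_toSet.compl_mem_cofinite
  refine isRational_of_growth S (fun t ht => H.analyticAt_triple (by simpa using ht) a) ?_ ?_
  · intro p hpS
    obtain ⟨K, hK⟩ := hp p hpS
    have hS' := hSc.filter_mono (nhdsNE_le_cofinite p)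
    obtain ⟨n, C, hC⟩ := H.exists_energy_bound (hS'.and hK)
    -- For each of the three factors, `n` powers absorb the energy and one absorbs the scaling of a
    -- first derivative.
    refine ⟨(n + 1) * 3, ∏ k, (∑ j, ‖(a k).1 j‖) * (1 + C), ?_⟩
    filter_upwards [hC, nhdsWithin_le_nhds (Metric.closedBall_mem_nhds p one_pos),
      self_mem_nhdsWithin] with t h1 h3 h4
    have hd0 : 0 < ‖t - p‖ := norm_pos_iff.2 (sub_ne_zero.2 h4)
    have hd1 : ‖t - p‖ ≤ 1 := mem_closedBall_iff_norm.1 h3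
    have hkey : ∀ k, ‖comb (a k).1 (fun j => deriv^[(a k).2] (branch Br t j)) t‖ * ‖t - p‖ ^ (n + 1) ≤
        (∑ j, ‖(a k).1 j‖) * (1 + C) := by
      intro k
      have := norm_comb_le (t := t) (a k).1
        (ψ := fun j => deriv^[(a k).2] (branch Br t j)) (B := (1 + C) / ‖t - p‖ ^ (n + 1))
        fun j => by
          rw [le_div_iff₀ (by positivity)]
          have e1 := norm_pow_mul_le_energy (Br := Br) p t j (ha k)
          have e2 : ‖t - p‖ ≤ ‖t - p‖ ^ (a k).2 := by
            have := ha k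
            generalize (a k).2 = i at this
            interval_cases i <;> simp [hd1]
          have e3 : ‖t - p‖ ^ n ≤ 1 := pow_le_one₀ hd0.le hd1
          calc _ = ‖t - p‖ * ‖deriv^[(a k).2] (branch Br t j) t‖ * ‖t - p‖ ^ n := by ring
            _ ≤ ‖t - p‖ ^ (a k).2 * ‖deriv^[(a k).2] (branch Br t j) t‖ * ‖t - p‖ ^ n := by gcongr
            _ ≤ (1 + energy Br p t) * ‖t - p‖ ^ n := by gcongr
            _ ≤ 1 + C := by linarith
      rw [mul_div_assoc', le_div_iff₀ (by positivity)] at this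
      exact this
    rw [triple, norm_prod, pow_mul]
    calc _ = ∏ k, (‖comb (a k).1 (fun j => deriv^[(a k).2] (branch Br t j)) t‖ * ‖t - p‖ ^ (n + 1)) := by
          rw [Finset.prod_mul_distrib, Finset.prod_const, Finset.card_univ, Fintype.card_fin]
      _ ≤ _ := Finset.prod_le_prod (fun k _ => by positivity) fun k _ => hkey k
  · obtain ⟨K, hK⟩ := hinf
    have hS' := hSc.filter_mono (Bornology.le_cofinite ℂ)
    obtain ⟨n, C, hC⟩ := H.exists_energy_bound_cobounded (hS'.and hK)
    refine ⟨n * 3, ∏ k, (∑ j, ‖(a k).1 j‖) * (1 + C), ?_⟩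
    filter_upwards [hC, tendsto_norm_cobounded_atTop.eventually_ge_atTop 1] with t h1 h3
    have hkey : ∀ k, ‖comb (a k).1 (fun j => deriv^[(a k).2] (branch Br t j)) t‖ ≤
        (∑ j, ‖(a k).1 j‖) * (1 + C) * ‖t‖ ^ n := by
      intro k
      rw [mul_assoc]
      refine norm_comb_le (a k).1 fun j => ?_
      have e1 := norm_pow_mul_le_energy (Br := Br) 0 t j (ha k)
      rw [sub_zero] at e1
      have e2 : 1 ≤ ‖t‖ ^ (a k).2 := one_le_pow₀ h3
      have e3 : 1 ≤ ‖t‖ ^ n := one_le_pow₀ h3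
      nlinarith [norm_nonneg (deriv^[(a k).2] (branch Br t j) t)]
    rw [triple, norm_prod, pow_mul]
    calc _ ≤ ∏ k, ((∑ j, ‖(a k).1 j‖) * (1 + C) * ‖t‖ ^ n) :=
          Finset.prod_le_prod (fun k _ => norm_nonneg _) fun k _ => hkey k
      _ = _ := by
          rw [Finset.prod_mul_distrib, Finset.prod_const, Finset.card_univ, Fintype.card_fin]

end BranchSystem

end

section

/-! ### Vanishing orders in finite-dimensional spaces of meromorphic functions -/

section Order

variable {E : Type*} [AddCommGroup E] [Module ℂ E] {T : E →ₗ[ℂ] (ℂ → ℂ)} {p : ℂ}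

/-- The vectors whose image has order greater than `m` at `p`. -/
def higherOrder (T : E →ₗ[ℂ] (ℂ → ℂ)) (p : ℂ) (hT : ∀ v, MeromorphicAt (T v) p) (m : ℤ) :
    Submodule ℂ E where
  carrier := {v | (m : WithTop ℤ) < meromorphicOrderAt (T v) p}
  zero_mem' := by
    simp
  add_mem' := by
    intro a b ha hb
    have := meromorphicOrderAt_add (hT a) (hT b)
    rw [← map_add] at this
    exact (lt_min ha hb).trans_le this
  smul_mem' := by
    intro c a ha
    rcases eq_or_ne c 0 with rfl | hc
    · simp
    · have h1 : T (c • a) = (fun _ => c) * T a := by ext t; simp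
      have h2 := meromorphicOrderAt_mul_of_ne_zero (f := T a) (g := fun _ => c) (x := p)
        analyticAt_const hc
      rw [Set.mem_ofPred_eq, h1, h2]
      exact ha

theorem mem_higherOrder {hT : ∀ v, MeromorphicAt (T v) p} {m : ℤ} {v : E} :
    v ∈ higherOrder T p hT m ↔ (m : WithTop ℤ) < meromorphicOrderAt (T v) p := Iff.rfl

/-- `k` is the quotient of the coefficients of `(s - p) ^ m`, so the subtraction cancels that term.
-/
theorem exists_sub_smul_mem_higherOrder (hT : ∀ v, MeromorphicAt (T v) p) {m : ℤ} {v w : E}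
    (hv : meromorphicOrderAt (T v) p = m) (hw : (m : WithTop ℤ) ≤ meromorphicOrderAt (T w) p) :
    ∃ k : ℂ, w - k • v ∈ higherOrder T p hT m := by
  have hz : MeromorphicAt (fun s : ℂ => (s - p) ^ (-m)) p := by fun_prop
  have hord : ∀ x, meromorphicOrderAt (fun s => (s - p) ^ (-m) * T x s) p =
      (-m : ℤ) + meromorphicOrderAt (T x) p := fun x => by
    rw [fun_meromorphicOrderAt_mul hz (hT x), fun_meromorphicOrderAt_zpow_id_sub_const]
  have hm : ∀ x, MeromorphicAt (fun s => (s - p) ^ (-m) * T x s) p := fun x => hz.mul (hT x)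
  obtain ⟨a, ha0, ha⟩ := (tendsto_ne_zero_iff_meromorphicOrderAt_eq_zero (hm v)).2
    (by rw [hord, hv, ← WithTop.coe_add, neg_add_cancel]; rfl)
  obtain ⟨b, hb⟩ := (tendsto_nhds_iff_meromorphicOrderAt_nonneg (hm w)).2 (by
    rw [hord]
    calc (0 : WithTop ℤ) = ((-m : ℤ) : WithTop ℤ) + (m : ℤ) := by
          rw [← WithTop.coe_add, neg_add_cancel]; rfl
      _ ≤ _ := by gcongr)
  refine ⟨b / a, ?_⟩
  have h1 : Tendsto (fun s => (s - p) ^ (-m) * T (w - (b / a) • v) s) (𝓝[≠] p) (𝓝 0) := by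
    have h2 := hb.sub (ha.const_mul (b / a))
    rw [div_mul_cancel₀ _ ha0, sub_self] at h2
    refine h2.congr fun s => ?_
    simp
    ring
  have h3 := (tendsto_zero_iff_meromorphicOrderAt_pos (hm _)).1 h1
  rw [hord] at h3
  rw [mem_higherOrder]
  by_contra h4
  rw [not_lt] at h4
  have : ((-m : ℤ) : WithTop ℤ) + meromorphicOrderAt (T (w - (b / a) • v)) p ≤ 0 := by
    calc _ ≤ ((-m : ℤ) : WithTop ℤ) + (m : ℤ) := by gcongr
      _ = 0 := by rw [← WithTop.coe_add, neg_add_cancel]; rfl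
  exact absurd h3 (not_lt.2 this)

/-- Passing to vectors of order above the smallest one loses at most one dimension, because two
vectors of that order agree up to a multiple and higher order terms; it also removes one element of
`s`. -/
theorem finrank_le_card_of_order_mem [FiniteDimensional ℂ E] (hT : ∀ v, MeromorphicAt (T v) p)
    (n : ℕ) : ∀ {s : Finset ℤ}, s.card = n → ∀ {V : Submodule ℂ E},
      (∀ v ∈ V, v ≠ 0 → ∃ m ∈ s, meromorphicOrderAt (T v) p = (m : ℤ)) →
      Module.finrank ℂ V ≤ n := by
  induction n with
  | zero =>
    intro s hs V hV
    rw [Finset.card_eq_zero] at hs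
    subst hs
    have : V = ⊥ := (Submodule.eq_bot_iff V).2 fun v hv => by
      by_contra h0
      obtain ⟨m, hm, -⟩ := hV v hv h0
      simp at hm
    rw [this, finrank_bot]
  | succ n ih =>
    intro s hs V hV
    have hne : s.Nonempty := Finset.card_pos.1 (by omega)
    set m₀ := s.min' hne with hm₀
    set W := higherOrder T p hT m₀
    have hU : Module.finrank ℂ (V ⊓ W : Submodule ℂ E) ≤ n := by
      refine ih (s := s.erase m₀) (by rw [Finset.card_erase_of_mem (s.min'_mem hne)]; omega) ?_
      intro v hv hv0
      obtain ⟨m, hm, hmo⟩ := hV v hv.1 hv0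
      refine ⟨m, Finset.mem_erase.2 ⟨?_, hm⟩, hmo⟩
      rintro rfl
      have := mem_higherOrder.1 hv.2
      rw [hmo] at this
      exact lt_irrefl _ this
    by_cases hVW : V ≤ W
    · rw [inf_eq_left.2 hVW] at hU
      omega
    · obtain ⟨v₀, hv₀, hv₀W⟩ := SetLike.not_le_iff_exists.1 hVW
      have hv00 : v₀ ≠ 0 := fun h => hv₀W (h ▸ W.zero_mem)
      have hle : ∀ v ∈ V, v ≠ 0 → (m₀ : WithTop ℤ) ≤ meromorphicOrderAt (T v) p := by
        intro v hv hv0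
        obtain ⟨m, hm, hmo⟩ := hV v hv hv0
        rw [hmo]
        exact_mod_cast s.min'_le m hm
      have hord : meromorphicOrderAt (T v₀) p = m₀ :=
        le_antisymm (not_lt.1 hv₀W) (hle v₀ hv₀ hv00)
      have hsup : V ≤ (V ⊓ W) ⊔ Submodule.span ℂ {v₀} := by
        intro v hv
        rcases eq_or_ne v 0 with rfl | hv0
        · exact Submodule.zero_mem _
        · obtain ⟨k, hk⟩ := exists_sub_smul_mem_higherOrder hT hord (hle v hv hv0)
          rw [← sub_add_cancel v (k • v₀)]
          exact Submodule.add_mem_sup ⟨V.sub_mem hv (V.smul_mem k hv₀), hk⟩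
            (Submodule.smul_mem _ _ (Submodule.mem_span_singleton_self v₀))
      calc Module.finrank ℂ V ≤ _ := Submodule.finrank_mono hsup
        _ ≤ _ := Submodule.finrank_add_le_finrank_add_finrank _ _
        _ ≤ n + 1 := add_le_add hU (finrank_span_singleton hv00).le

/-- A vector of minimal order at finitely many points simultaneously. -/
theorem exists_order_eq_min [FiniteDimensional ℂ E] {ι : Type*} [Finite ι] (q : ι → ℂ)
    (hT : ∀ i v, MeromorphicAt (T v) (q i)) (s : ι → Finset ℤ) (m₀ : ι → ℤ)
    (hm₀ : ∀ i, m₀ i ∈ s i ∧ ∀ m ∈ s i, m₀ i ≤ m) (hcard : ∀ i, (s i).card ≤ Module.finrank ℂ E)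
    (hpos : 0 < Module.finrank ℂ E)
    (hs : ∀ i v, v ≠ 0 → ∃ m ∈ s i, meromorphicOrderAt (T v) (q i) = (m : ℤ)) :
    ∃ v : E, v ≠ 0 ∧ ∀ i, meromorphicOrderAt (T v) (q i) = m₀ i := by
  classical
  have := Fintype.ofFinite ι
  set W := fun i => higherOrder T (q i) (hT i) (m₀ i)
  -- If every vector had order above `m₀ i`, fewer than `(s i).card` orders would occur, too few for
  -- the dimension.
  have hW : ∀ i, W i ≠ ⊤ := by
    intro i htop
    have := finrank_le_card_of_order_mem (hT i) _ (s := (s i).erase (m₀ i)) rfl (V := ⊤) ?_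
    · rw [finrank_top, Finset.card_erase_of_mem (hm₀ i).1] at this
      have := hcard i
      omega
    · intro v _ hv0
      obtain ⟨m, hm, hmo⟩ := hs i v hv0
      refine ⟨m, Finset.mem_erase.2 ⟨?_, hm⟩, hmo⟩
      rintro rfl
      have h1 : v ∈ W i := htop ▸ Submodule.mem_top
      have h2 := mem_higherOrder.1 h1
      rw [hmo] at h2
      exact lt_irrefl _ h2
  have hbot : (⊥ : Submodule ℂ E) ≠ ⊤ := by
    intro h
    have : Module.finrank ℂ (⊤ : Submodule ℂ E) = 0 := by rw [← h, finrank_bot]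
    rw [finrank_top] at this
    omega
  -- Finitely many proper subspaces do not cover a space over an infinite field. Including `⊥` makes
  -- the vector found nonzero.
  have hun := Subspace.biUnion_ne_univ_of_top_notMem (k := ℂ) (E := E)
    (s := insert ⊥ (Finset.univ.image W)) (by
      rw [Finset.mem_insert, not_or]
      exact ⟨hbot.symm, by simpa using hW⟩)
  obtain ⟨v, hv⟩ := (Set.ne_univ_iff_exists_notMem _).1 hun
  simp only [Finset.mem_insert, Finset.mem_image, Finset.mem_univ, true_and, Set.mem_iUnion,
    not_exists, SetLike.mem_coe] at hv
  have hv0 : v ≠ 0 := fun h => hv ⊥ (.inl rfl) (by simp [h])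
  refine ⟨v, hv0, fun i => ?_⟩
  obtain ⟨m, hm, hmo⟩ := hs i v hv0
  have h1 : ¬ (m₀ i : WithTop ℤ) < meromorphicOrderAt (T v) (q i) := hv (W i) (.inr ⟨i, rfl⟩)
  refine le_antisymm (not_lt.1 h1) ?_
  rw [hmo]
  exact_mod_cast (hm₀ i).2 m hm

end Order

end

/-! ### Factorizations from solutions -/

theorem MiuraEqs.congr {u v a b c a' b' c' : ℂ → ℂ} {t : ℂ} (h : MiuraEqs u v a b c t)
    (ha : a' =ᶠ[𝓝 t] a) (hb : b' =ᶠ[𝓝 t] b) (hc : c' =ᶠ[𝓝 t] c) : MiuraEqs u v a' b' c' t := by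
  simpa only [MiuraEqs, ha.eq_of_nhds, hb.eq_of_nhds, hc.eq_of_nhds, hb.deriv_eq, hc.deriv_eq,
    hc.deriv.deriv_eq] using h

/-- Both sides of the coefficient relations are continuous at every admissible point, so finitely
many exceptions are harmless. -/
theorem isMiura_of_eventually_miuraEqs {u v : ℂ → ℂ} {S : Set ℂ} {χ : Fin 3 → RatFunc ℂ}
    (hu : ∀ t ∉ S, AnalyticAt ℂ u t) (hv : ∀ t ∉ S, AnalyticAt ℂ v t)
    (h : ∀ᶠ t in cofinite, MiuraEqs u v (ev (χ 0)) (ev (χ 1)) (ev (χ 2)) t) : IsMiura u v S χ := by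
  intro t ht hden f hf
  have h0 := analyticAt_ev (hden 0)
  have h1 := analyticAt_ev (hden 1)
  have h2 := analyticAt_ev (hden 2)
  have c0 := h0.continuousAt
  have c1 := h1.continuousAt
  have c2 := h2.continuousAt
  have d1 := h1.deriv.continuousAt
  have d2 := h2.deriv.continuousAt
  have dd2 := h2.deriv.deriv.continuousAt
  have h' := h.filter_mono (nhdsNE_le_cofinite t)
  have key : MiuraEqs u v (ev (χ 0)) (ev (χ 1)) (ev (χ 2)) t := by
    refine ⟨?_, ?_, ?_⟩
    · exact eq_of_eventuallyEq_nhdsNE (by fun_prop) (by fun_prop) (h'.mono fun s hs => hs.1)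
    · exact eq_of_eventuallyEq_nhdsNE (hu t ht).continuousAt (by fun_prop)
        (h'.mono fun s hs => hs.2.1)
    · exact eq_of_eventuallyEq_nhdsNE (hv t ht).continuousAt (by fun_prop)
        (h'.mono fun s hs => hs.2.2)
  exact key.oper_eq h1 h2 hf

/-- Two solutions `f` and `g` with Wronskian `W` give the factorization
`(∂ + W'/W)(∂ - W'/W + f'/f)(∂ - f'/f)`. -/
theorem miuraEqs_of_solutions {u v f g W : ℂ → ℂ} {t : ℂ} (hf : AnalyticAt ℂ f t)
    (hg : AnalyticAt ℂ g t) (hfs : ∀ᶠ s in 𝓝 t, oper u v f s = 0)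
    (hgs : ∀ᶠ s in 𝓝 t, oper u v g s = 0) (hW : W =ᶠ[𝓝 t] fun s => f s * deriv g s - deriv f s * g s)
    (hf0 : f t ≠ 0) (hW0 : W t ≠ 0) :
    MiuraEqs u v (fun s => -logDeriv W s) (fun s => logDeriv W s - logDeriv f s) (logDeriv f) t := by
  have hWa : AnalyticAt ℂ W t := ((hf.mul hg.deriv).sub (hf.deriv.mul hg)).congr hW.symm
  have hW1 : deriv W =ᶠ[𝓝 t] fun s => f s * deriv (deriv g) s - deriv (deriv f) s * g s := by
    refine hW.deriv.trans ?_
    filter_upwards [hf.eventually_analyticAt, hg.eventually_analyticAt] with s h1 h2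
    refine (((h1.differentiableAt.hasDerivAt).mul (h2.deriv.differentiableAt.hasDerivAt)).sub
      ((h1.deriv.differentiableAt.hasDerivAt).mul (h2.differentiableAt.hasDerivAt))).deriv.trans ?_
    ring
  -- The equation eliminates the third derivatives, and the terms in `v` cancel. This determines `u`
  -- from the logarithmic derivatives; `v` then follows from the Riccati form.
  have hW2 : deriv (deriv W) t = deriv f t * deriv (deriv g) t - deriv (deriv f) t * deriv g t +
      u t * W t := by
    rw [hW1.deriv_eq, ((hf.differentiableAt.hasDerivAt.fun_mul
      hg.deriv.deriv.differentiableAt.hasDerivAt).fun_sub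
      (hf.deriv.deriv.differentiableAt.hasDerivAt.fun_mul hg.differentiableAt.hasDerivAt)).deriv,
      hW.eq_of_nhds]
    have e1 := hfs.self_of_nhds
    have e2 := hgs.self_of_nhds
    simp only [oper] at e1 e2
    linear_combination f t * e2 - g t * e1
  have hlW : AnalyticAt ℂ (logDeriv W) t := hWa.deriv.div hWa hW0
  have hlf : AnalyticAt ℂ (logDeriv f) t := hf.deriv.div hf hf0
  have e0 : deriv (fun s => logDeriv W s - logDeriv f s) t =
      deriv (logDeriv W) t - deriv (logDeriv f) t :=
    deriv_sub hlW.differentiableAt hlf.differentiableAt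
  have elog : ∀ {F : ℂ → ℂ}, AnalyticAt ℂ F t → F t ≠ 0 →
      deriv (logDeriv F) t = deriv (deriv F) t / F t - (deriv F t / F t) ^ 2 := by
    intro F hF hF0
    refine (hF.deriv.differentiableAt.hasDerivAt.div hF.differentiableAt.hasDerivAt hF0).deriv.trans ?_
    field_simp
  have hu : u t = deriv (logDeriv W) t + deriv (logDeriv f) t + logDeriv W t ^ 2 -
      logDeriv W t * logDeriv f t + logDeriv f t ^ 2 := by
    rw [elog hWa hW0, elog hf hf0, logDeriv_apply, logDeriv_apply, hW2, hW1.eq_of_nhds]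
    have := hW.eq_of_nhds
    field_simp
    linear_combination -(W t * f t * deriv (deriv f) t) * this
  have hric := oper_eq_of_logDeriv (u := u) (v := v) hf hf0
  rw [hfs.self_of_nhds, eq_comm, mul_eq_zero, or_iff_right hf0] at hric
  refine ⟨by ring, ?_, ?_⟩
  · rw [e0, hu]; ring
  · rw [e0]
    linear_combination -hric - logDeriv f t * hu

/-- Cramer's rule for the matrix of 2-jets, whose determinant is the Wronskian; the multipliers are
its cofactors. -/
theorem eq_zero_of_comb_jet {ψ : Fin 3 → ℂ → ℂ} {t : ℂ} (hw : wronskian ψ t = 1) {v : Fin 3 → ℂ}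
    (h0 : comb v ψ t = 0) (h1 : comb v (fun j => deriv (ψ j)) t = 0)
    (h2 : comb v (fun j => deriv (deriv (ψ j))) t = 0) : v = 0 := by
  simp only [comb, Fin.sum_univ_three] at h0 h1 h2
  simp only [wronskian] at hw
  ext j
  fin_cases j
  · simp only [Fin.zero_eta, Pi.zero_apply]
    linear_combination -v 0 * hw
      + h0 * (deriv (ψ 1) t * deriv (deriv (ψ 2)) t - deriv (deriv (ψ 1)) t * deriv (ψ 2) t)
      - h1 * (ψ 1 t * deriv (deriv (ψ 2)) t - deriv (deriv (ψ 1)) t * ψ 2 t)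
      + h2 * (ψ 1 t * deriv (ψ 2) t - deriv (ψ 1) t * ψ 2 t)
  · simp only [Fin.mk_one, Pi.zero_apply]
    linear_combination -v 1 * hw
      + h0 * (deriv (deriv (ψ 0)) t * deriv (ψ 2) t - deriv (ψ 0) t * deriv (deriv (ψ 2)) t)
      + h1 * (ψ 0 t * deriv (deriv (ψ 2)) t - deriv (deriv (ψ 0)) t * ψ 2 t)
      + h2 * (deriv (ψ 0) t * ψ 2 t - ψ 0 t * deriv (ψ 2) t)
  · simp only [Fin.reduceFinMk, Pi.zero_apply]
    linear_combination -v 2 * hw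
      + h0 * (deriv (ψ 0) t * deriv (deriv (ψ 1)) t - deriv (deriv (ψ 0)) t * deriv (ψ 1) t)
      + h1 * (deriv (deriv (ψ 0)) t * ψ 1 t - ψ 0 t * deriv (deriv (ψ 1)) t)
      + h2 * (ψ 0 t * deriv (ψ 1) t - deriv (ψ 0) t * ψ 1 t)

theorem eq_zero_of_comb_eventuallyEq_zero {ψ : Fin 3 → ℂ → ℂ} {t : ℂ}
    (hA : ∀ j, AnalyticAt ℂ (ψ j) t) (hw : wronskian ψ t = 1) {a : Fin 3 → ℂ}
    (h0 : comb a ψ =ᶠ[𝓝 t] fun _ => 0) : a = 0 := by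
  have e1 := (iterate_deriv_comb (v := a) 1 hA).symm.trans (iterate_deriv_congr h0 1)
  have e2 := (iterate_deriv_comb (v := a) 2 hA).symm.trans (iterate_deriv_congr h0 2)
  refine eq_zero_of_comb_jet hw h0.eq_of_nhds ?_ ?_
  · simpa using e1.eq_of_nhds
  · simpa using e2.eq_of_nhds

theorem IsRational.eventually_ne_zero {S : Set ℂ} {G : ℂ → ℂ} (hS : S.Finite) (hG : IsRational S G)
    {t : ℂ} (ht : t ∉ S) (h0 : G t ≠ 0) : ∀ᶠ s in cofinite, G s ≠ 0 := by
  obtain ⟨P, Q, hQ, h⟩ := hG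
  have hP : P ≠ 0 := by
    rintro rfl
    exact h0 (by rw [(h t ht).2]; simp)
  filter_upwards [hS.compl_mem_cofinite, eventually_eval_ne_zero hP] with s h1 h2
  rw [(h s h1).2]
  exact div_ne_zero h2 (h s h1).1

theorem IsRational.exists_ev_eq_logDeriv {S : Set ℂ} {G : ℂ → ℂ} (hS : S.Finite)
    (hG : IsRational S G) (h0 : ∀ᶠ s in cofinite, G s ≠ 0) :
    ∃ L : RatFunc ℂ, ev L =ᶠ[cofinite] logDeriv G := by
  obtain ⟨P, Q, hQ, h⟩ := hG
  have hP : P ≠ 0 := by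
    rintro rfl
    obtain ⟨t, h1, h2⟩ := (h0.and hS.compl_mem_cofinite).exists
    exact h1 (by rw [(h t h2).2]; simp)
  refine ⟨_, (ev_div_algebraMap (P.derivative * Q - P * Q.derivative) (P * Q)
    (mul_ne_zero hP hQ)).trans ?_⟩
  filter_upwards [hS.compl_mem_cofinite, eventually_eval_ne_zero hP, eventually_eval_ne_zero hQ]
    with t h1 h2 h3
  have e : G =ᶠ[𝓝 t] fun s => P.eval s / Q.eval s := by
    filter_upwards [hS.isClosed.isOpen_compl.mem_nhds h1] with s hs using (h s hs).2
  rw [logDeriv_apply, e.deriv_eq, e.eq_of_nhds,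
    ((P.hasDerivAt t).fun_div (Q.hasDerivAt t) h3).deriv]
  simp only [Polynomial.eval_mul, Polynomial.eval_sub]
  field_simp

theorem exists_meromorphicOrderAt_eq {G : ℂ → ℂ} {p : ℂ}
    (hm : MeromorphicAt G p) (h0 : ∀ᶠ s in cofinite, G s ≠ 0) :
    ∃ m : ℤ, meromorphicOrderAt G p = m := by
  have : meromorphicOrderAt G p ≠ ⊤ :=
    (meromorphicOrderAt_ne_top_iff_eventually_ne_zero hm).2 (h0.filter_mono (nhdsNE_le_cofinite p))
  exact ⟨_, (WithTop.coe_untop _ this).symm⟩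

section

/-! ### From trivial monodromy to a factorization -/

/-- The cube of a linear combination of the branches. -/
def cube (Br : ℂ → (Fin 3 → ℂ → ℂ) → Prop) (v : Fin 3 → ℂ) : ℂ → ℂ := triple Br fun _ => (v, 0)

/-- The Wronskian of two linear combinations of the branches, times the first of them. -/
def wronskianMul (Br : ℂ → (Fin 3 → ℂ → ℂ) → Prop) (v w : Fin 3 → ℂ) (t : ℂ) : ℂ :=
  triple Br ![(v, 0), (w, 1), (v, 0)] t - triple Br ![(v, 1), (w, 0), (v, 0)] t

/-- `triple` is linear in its first vector. -/
def tripleLeft (Br : ℂ → (Fin 3 → ℂ → ℂ) → Prop) (e : Fin 3 → ℂ) :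
    (Fin 3 → ℂ) →ₗ[ℂ] (ℂ → ℂ) where
  toFun v := triple Br ![(v, 0), (e, 0), (e, 0)]
  map_add' v w := by
    ext t
    simp only [triple, comb, Fin.prod_univ_three, Fin.sum_univ_three, Pi.add_apply,
      Matrix.cons_val]
    ring
  map_smul' c v := by
    ext t
    simp only [triple, comb, Fin.prod_univ_three, Fin.sum_univ_three, Pi.smul_apply, smul_eq_mul,
      Matrix.cons_val, RingHom.id_apply]
    ring

/-- `wronskianMul` as a linear map in its second argument. -/
def wronskianMulRight (Br : ℂ → (Fin 3 → ℂ → ℂ) → Prop) (v : Fin 3 → ℂ) :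
    (Fin 3 → ℂ) →ₗ[ℂ] (ℂ → ℂ) where
  toFun := wronskianMul Br v
  map_add' v w := by
    ext t
    simp only [wronskianMul, triple, comb, Fin.prod_univ_three, Fin.sum_univ_three, Pi.add_apply,
      Matrix.cons_val]
    ring
  map_smul' c v := by
    ext t
    simp only [wronskianMul, triple, comb, Fin.prod_univ_three, Fin.sum_univ_three, Pi.smul_apply,
      smul_eq_mul, Matrix.cons_val, RingHom.id_apply]
    ring

/-- The cube of a solution is not linear in its coefficient vector, while `tripleLeft` is. This
identity carries knowledge of orders from one to the other. -/
theorem tripleLeft_pow_three (Br : ℂ → (Fin 3 → ℂ → ℂ) → Prop) (e v : Fin 3 → ℂ) :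
    tripleLeft Br e v ^ 3 = cube Br v * cube Br e ^ 2 := by
  ext t
  simp only [tripleLeft, cube, triple, Fin.prod_univ_three, Pi.pow_apply, Pi.mul_apply,
    LinearMap.coe_mk, AddHom.coe_mk, Matrix.cons_val]
  ring

namespace BranchSystem

variable {u v : ℂ → ℂ} {S : Set ℂ} {Br : ℂ → (Fin 3 → ℂ → ℂ) → Prop} {a b : Fin 3 → ℂ}

theorem eventually_comb_ne_zero (H : BranchSystem u v S Br) {t : ℂ} {ψ : Fin 3 → ℂ → ℂ}
    (hψ : Br t ψ) (ha : a ≠ 0) : ∀ᶠ s in 𝓝[≠] t, comb a ψ s ≠ 0 := by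
  refine (analyticAt_comb (H.analyticAt hψ)).eventually_eq_zero_or_eventually_ne_zero.resolve_left
    fun h => ha (eq_zero_of_comb_eventuallyEq_zero (H.analyticAt hψ) (H.wronskian_eq_one hψ) h)

theorem eventually_cube_eq (H : BranchSystem u v S Br) {t : ℂ} {ψ : Fin 3 → ℂ → ℂ} (hψ : Br t ψ)
    (a : Fin 3 → ℂ) : cube Br a =ᶠ[𝓝 t] fun s => comb a ψ s ^ 3 := by
  refine (H.eventually_triple_eq hψ _).trans (.of_forall fun s => ?_)
  simp

theorem eventually_wronskianMul_eq (H : BranchSystem u v S Br) {t : ℂ} {ψ : Fin 3 → ℂ → ℂ}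
    (hψ : Br t ψ) (a b : Fin 3 → ℂ) : wronskianMul Br a b =ᶠ[𝓝 t] fun s =>
      (comb a ψ s * deriv (comb b ψ) s - deriv (comb a ψ) s * comb b ψ s) * comb a ψ s := by
  filter_upwards [H.eventually_triple_eq hψ ![(a, 0), (b, 1), (a, 0)],
    H.eventually_triple_eq hψ ![(a, 1), (b, 0), (a, 0)], deriv_comb (v := a) (H.analyticAt hψ),
    deriv_comb (v := b) (H.analyticAt hψ)] with s h1 h2 h3 h4
  rw [wronskianMul, h1, h2, h3, h4]
  simp [Fin.prod_univ_three]
  ring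

/-- All products of branches of order at most one are rational. -/
def IsRationalSystem (S : Set ℂ) (Br : ℂ → (Fin 3 → ℂ → ℂ) → Prop) : Prop :=
  ∀ a : Fin 3 → (Fin 3 → ℂ) × ℕ, (∀ k, (a k).2 ≤ 1) → IsRational S (triple Br a)

theorem isRational_cube (R : IsRationalSystem S Br) (a : Fin 3 → ℂ) : IsRational S (cube Br a) :=
  R _ fun _ => zero_le_one

theorem isRational_wronskianMul (R : IsRationalSystem S Br) (a b : Fin 3 → ℂ) :
    IsRational S (wronskianMul Br a b) :=
  (R _ fun k => by fin_cases k <;> simp).sub (R _ fun k => by fin_cases k <;> simp)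

theorem cube_ne_zero (H : BranchSystem u v S Br) (R : IsRationalSystem S Br) (hS : S.Finite)
    (ha : a ≠ 0) : ∀ᶠ t in cofinite, cube Br a t ≠ 0 := by
  obtain ⟨x, hx⟩ := hS.infinite_compl.nonempty
  have hψ := H.branch_spec hx
  obtain ⟨t, h1, h2, h3⟩ := ((H.eventually_comb_ne_zero hψ ha).and
    (((H.eventually_cube_eq hψ a).filter_mono nhdsWithin_le_nhds).and
      (mem_nhdsWithin_of_mem_nhds (hS.isClosed.isOpen_compl.mem_nhds hx)))).exists
  exact (isRational_cube R a).eventually_ne_zero hS h3 (by rw [h2]; exact pow_ne_zero 3 h1)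

/-- If the Wronskian of `f` and `g` vanished identically, `g/f` would be constant. With `k` its
value at a point where `f ≠ 0`, the equations `W = W' = 0` annihilate the 2-jet of `g - k f`, so `b
= k • a`. -/
theorem wronskianMul_ne_zero (H : BranchSystem u v S Br) (R : IsRationalSystem S Br)
    (hS : S.Finite) (ha : a ≠ 0) (hb : b ∉ Submodule.span ℂ {a}) :
    ∀ᶠ t in cofinite, wronskianMul Br a b t ≠ 0 := by
  obtain ⟨t, h0, ht⟩ := ((H.cube_ne_zero R hS ha).and hS.compl_mem_cofinite).exists
  have hψ := H.branch_spec ht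
  set ψ := branch Br t
  have hA := H.analyticAt hψ
  rw [(H.eventually_cube_eq hψ a).eq_of_nhds] at h0
  have hf0 : comb a ψ t ≠ 0 := fun h => h0 (by simp [h])
  by_contra hne
  have hzero : ∀ s ∉ S, wronskianMul Br a b s = 0 := fun s hs => by
    by_contra h
    exact hne ((isRational_wronskianMul R a b).eventually_ne_zero hS hs h)
  have hf : AnalyticAt ℂ (comb a ψ) t := analyticAt_comb hA
  have hg : AnalyticAt ℂ (comb b ψ) t := analyticAt_comb hA
  have hW : (fun s => comb a ψ s * deriv (comb b ψ) s - deriv (comb a ψ) s * comb b ψ s)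
      =ᶠ[𝓝 t] fun _ => 0 := by
    filter_upwards [hS.isClosed.isOpen_compl.mem_nhds ht, H.eventually_wronskianMul_eq hψ a b,
      hf.continuousAt.eventually_ne hf0] with s h1 h2 h3
    rw [hzero s h1] at h2
    exact (mul_eq_zero.1 h2.symm).resolve_right h3
  have hW1 := hW.deriv_eq
  rw [((hf.differentiableAt.hasDerivAt.fun_mul hg.deriv.differentiableAt.hasDerivAt).fun_sub
    (hf.deriv.differentiableAt.hasDerivAt.fun_mul hg.differentiableAt.hasDerivAt)).deriv,
    deriv_const] at hW1
  have hW0 := hW.eq_of_nhds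
  have d1 := fun c : Fin 3 → ℂ => (iterate_deriv_comb (v := c) 1 hA).eq_of_nhds
  have d2 := fun c : Fin 3 → ℂ => (iterate_deriv_comb (v := c) 2 hA).eq_of_nhds
  simp only [Function.iterate_succ, Function.iterate_zero, Function.comp, id] at d1 d2
  simp only [d1, d2] at hW0 hW1
  set k := comb b ψ t / comb a ψ t with hk
  have hkf : k * comb a ψ t = comb b ψ t := div_mul_cancel₀ _ hf0
  have hlin : ∀ φ : Fin 3 → ℂ → ℂ, comb (b - k • a) φ t = comb b φ t - k * comb a φ t := fun φ => by
    simp only [comb, Fin.sum_univ_three, Pi.sub_apply, Pi.smul_apply, smul_eq_mul]; ring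
  have := eq_zero_of_comb_jet (H.wronskian_eq_one hψ) (v := b - k • a) (by rw [hlin, hkf, sub_self])
    (by
      rw [hlin]
      refine (mul_eq_zero.1 (?_ : comb a ψ t * _ = 0)).resolve_left hf0
      linear_combination hW0 - comb a (fun j => deriv (ψ j)) t * hkf)
    (by
      rw [hlin]
      refine (mul_eq_zero.1 (?_ : comb a ψ t * _ = 0)).resolve_left hf0
      linear_combination hW1 - comb a (fun j => deriv (deriv (ψ j))) t * hkf)
  exact hb (Submodule.mem_span_singleton.2 ⟨k, (sub_eq_zero.1 this).symm⟩)

theorem eventually_logDeriv_cube_eq (H : BranchSystem u v S Br) {t : ℂ} {ψ : Fin 3 → ℂ → ℂ}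
    (hψ : Br t ψ) (a : Fin 3 → ℂ) :
    logDeriv (cube Br a) =ᶠ[𝓝 t] fun s => 3 * logDeriv (comb a ψ) s := by
  have h := H.eventually_cube_eq hψ a
  filter_upwards [h.eventuallyEq_nhds, (analyticAt_comb (v := a) (H.analyticAt hψ)).eventually_analyticAt]
    with s h1 h2
  rw [logDeriv_apply, h1.deriv_eq, h1.eq_of_nhds]
  have := logDeriv_fun_pow h2.differentiableAt 3
  rw [logDeriv_apply] at this
  rw [this]; norm_num

/-- One third of the logarithmic derivative of `f ^ 3` is `f'/f`, now as a globally defined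
function. The variable `g` abbreviates it. -/
theorem riccati_cube (H : BranchSystem u v S Br) (R : IsRationalSystem S Br) (hS : S.Finite)
    (ha : a ≠ 0) : ∀ᶠ t in cofinite, ∀ g : ℂ → ℂ, g = (fun s => logDeriv (cube Br a) s / 3) →
      deriv (deriv g) t + 3 * g t * deriv g t + g t ^ 3 - u t * g t - v t = 0 := by
  filter_upwards [H.cube_ne_zero R hS ha, hS.compl_mem_cofinite] with t h0 ht g hg
  have hψ := H.branch_spec ht
  have hA := H.analyticAt hψ
  have hgf : g =ᶠ[𝓝 t] logDeriv (comb a (branch Br t)) := by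
    filter_upwards [H.eventually_logDeriv_cube_eq hψ a] with s hs
    rw [hg]; simp only [hs]; ring
  rw [(H.eventually_cube_eq hψ a).eq_of_nhds] at h0
  have hf0 : comb a (branch Br t) t ≠ 0 := fun h => h0 (by simp [h])
  have := oper_eq_of_logDeriv (u := u) (v := v) (analyticAt_comb (v := a) hA) hf0
  rw [oper_comb hA (fun j => (H.solution hψ j).self_of_nhds), eq_comm, mul_eq_zero,
    or_iff_right hf0] at this
  rw [hgf.eq_of_nhds, hgf.deriv_eq, hgf.deriv.deriv_eq]
  exact this

/-- The factorization attached to `f`, `g`, rewritten through the single-valued functions `f ^ 3`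
and `W f`: `f'/f` is one third of the first logarithmic derivative, and `W'/W` is the second minus
`f'/f`. -/
theorem eventually_miuraEqs (H : BranchSystem u v S Br) (R : IsRationalSystem S Br) (hS : S.Finite)
    (ha : a ≠ 0) (hb : b ∉ Submodule.span ℂ {a}) :
    ∀ᶠ t in cofinite, MiuraEqs u v
      (fun s => logDeriv (cube Br a) s / 3 - logDeriv (wronskianMul Br a b) s)
      (fun s => logDeriv (wronskianMul Br a b) s - 2 * (logDeriv (cube Br a) s / 3))
      (fun s => logDeriv (cube Br a) s / 3) t := by
  filter_upwards [H.wronskianMul_ne_zero R hS ha hb, H.cube_ne_zero R hS ha,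
    hS.compl_mem_cofinite] with t h1 h2 ht
  have hψ := H.branch_spec ht
  set ψ := branch Br t
  have hA := H.analyticAt hψ
  have hw := H.eventually_wronskianMul_eq hψ a b
  rw [(H.eventually_cube_eq hψ a).eq_of_nhds] at h2
  have hf0 : comb a ψ t ≠ 0 := fun h => h2 (by simp [h])
  rw [hw.eq_of_nhds] at h1
  have hf : AnalyticAt ℂ (comb a ψ) t := analyticAt_comb hA
  have hg : AnalyticAt ℂ (comb b ψ) t := analyticAt_comb hA
  set W := fun s => comb a ψ s * deriv (comb b ψ) s - deriv (comb a ψ) s * comb b ψ s with hWdef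
  have hW : AnalyticAt ℂ W t := (hf.mul hg.deriv).sub (hf.deriv.mul hg)
  have hsol : ∀ c, ∀ᶠ s in 𝓝 t, oper u v (comb c ψ) s = 0 := fun c => by
    filter_upwards [eventually_all.2 fun j => (hA j).eventually_analyticAt,
      eventually_all.2 (H.solution hψ)] with s k1 k2
    exact oper_comb k1 k2 c
  have key := miuraEqs_of_solutions hf hg (hsol a) (hsol b) (W := W) .rfl hf0 (left_ne_zero_of_mul h1)
  have hc : (fun s => logDeriv (cube Br a) s / 3) =ᶠ[𝓝 t] logDeriv (comb a ψ) := by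
    filter_upwards [H.eventually_logDeriv_cube_eq hψ a] with s hs
    rw [hs]; ring
  have hlw : logDeriv (wronskianMul Br a b) =ᶠ[𝓝 t] fun s => logDeriv W s + logDeriv (comb a ψ) s := by
    filter_upwards [hw.eventuallyEq_nhds, hW.eventually_analyticAt, hf.eventually_analyticAt,
      hW.continuousAt.eventually_ne (left_ne_zero_of_mul h1), hf.continuousAt.eventually_ne hf0]
      with s k1 k2 k3 k4 k5
    rw [← logDeriv_mul s k4 k5 k2.differentiableAt k3.differentiableAt, logDeriv_apply,
      k1.deriv_eq, k1.eq_of_nhds, logDeriv_apply]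
  refine key.congr ?_ ?_ hc
  · filter_upwards [hc, hlw] with s k1 k2
    rw [k1, k2]; ring
  · filter_upwards [hc, hlw] with s k1 k2
    rw [k1, k2]; ring

end BranchSystem

end

/-! ### Residues of the factors and generic choice of the solutions. -/

section

theorem eventually_eventuallyEq_nhds {f g : ℂ → ℂ} (h : f =ᶠ[cofinite] g) :
    ∀ᶠ t in cofinite, f =ᶠ[𝓝 t] g := by
  have hfin : {t | f t = g t}ᶜ.Finite := h
  filter_upwards [h] with t ht
  have := hfin.isClosed.isOpen_compl.mem_nhds (show t ∈ {t | f t = g t}ᶜᶜ by simpa using ht)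
  rwa [compl_compl] at this

theorem residue_unique {g A B : ℂ → ℂ} {p : ℂ} (hA : AnalyticAt ℂ A p) (hB : AnalyticAt ℂ B p)
    (ha : g =ᶠ[𝓝[≠] p] fun s => A s / (s - p)) (hb : g =ᶠ[𝓝[≠] p] fun s => B s / (s - p)) :
    A p = B p := by
  refine eq_of_eventuallyEq_nhdsNE hA.continuousAt hB.continuousAt ?_
  filter_upwards [ha, hb, self_mem_nhdsWithin] with s h1 h2 h3
  have h4 : s - p ≠ 0 := sub_ne_zero.2 h3
  rw [h1] at h2
  field_simp at h2
  exact h2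

theorem exists_ev_eq_linear_combination (L M : RatFunc ℂ) (c d : ℂ) :
    ∃ R : RatFunc ℂ, ev R =ᶠ[cofinite] fun t => c * ev L t + d * ev M t := by
  refine ⟨RatFunc.C c * L + RatFunc.C d * M, ?_⟩
  filter_upwards [ev_add (RatFunc.C c * L) (RatFunc.C d * M), ev_mul (RatFunc.C c) L,
    ev_mul (RatFunc.C d) M] with t h1 h2 h3
  have hC : ∀ x, ev (RatFunc.C x) t = x := fun x => by simp [ev]
  rw [h1, h2, h3, hC, hC]

namespace BranchSystem

variable {u v : ℂ → ℂ} {S : Set ℂ} {Br : ℂ → (Fin 3 → ℂ → ℂ) → Prop} {a b : Fin 3 → ℂ}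

theorem exists_order_cube (H : BranchSystem u v S Br) (R : IsRationalSystem S Br) (hS : S.Finite)
    (ha : a ≠ 0) {U V : ℂ → ℂ} {p : ℂ} (hU : AnalyticAt ℂ U p)
    (hV : AnalyticAt ℂ V p) (hu : u =ᶠ[𝓝[≠] p] fun s => U s / (s - p) ^ 2)
    (hv : v =ᶠ[𝓝[≠] p] fun s => V s / (s - p) ^ 3) :
    ∃ m : ℤ, meromorphicOrderAt (cube Br a) p = m ∧
      (m / 3 : ℂ) * (m / 3 - 1) * (m / 3 - 2) - U p * (m / 3) - V p = 0 := by
  have hmer := (isRational_cube R a).meromorphicAt hS p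
  obtain ⟨m, hm⟩ := exists_meromorphicOrderAt_eq hmer (H.cube_ne_zero R hS ha)
  refine ⟨m, hm, ?_⟩
  obtain ⟨A, hA, hAm, hlog⟩ := exists_logDeriv_eq hmer hm
  have := indicial_of_riccati hU hV hu hv (A := fun s => A s / 3) (by fun_prop)
    (g := fun s => logDeriv (cube Br a) s / 3) (hlog.mono fun s hs => by
      simp only [hs]; ring) (((H.riccati_cube R hS ha).filter_mono (nhdsNE_le_cofinite p)).mono
        fun s hs => hs _ rfl)
  simpa only [hAm] using this

/-- Orders of `f ^ 3` and of `W f` translate into residues of the last two factors. These suffice,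
since the residues sum to zero. -/
theorem exists_isMiura (H : BranchSystem u v S Br) (R : IsRationalSystem S Br) (hS : S.Finite)
    (hu : ∀ t ∉ S, AnalyticAt ℂ u t) (hv : ∀ t ∉ S, AnalyticAt ℂ v t)
    (ha : a ≠ 0) (hb : b ∉ Submodule.span ℂ {a}) :
    ∃ χ : Fin 3 → RatFunc ℂ, IsMiura u v S χ ∧ ∀ (p : ℂ) (m : ℤ) (r : Fin 3 → ℂ),
      meromorphicOrderAt (cube Br a) p = m → HasResidue χ p r → r 2 = m / 3 ∧
        ∃ n : ℤ, meromorphicOrderAt (wronskianMul Br a b) p = n ∧ r 1 = n - 2 * (m / 3) := by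
  have hw0 := H.wronskianMul_ne_zero R hS ha hb
  obtain ⟨L, hL⟩ := (isRational_cube R a).exists_ev_eq_logDeriv hS (H.cube_ne_zero R hS ha)
  obtain ⟨M, hM⟩ := (isRational_wronskianMul R a b).exists_ev_eq_logDeriv hS hw0
  obtain ⟨χ₀, h₀⟩ := exists_ev_eq_linear_combination L M (1 / 3) (-1)
  obtain ⟨χ₁, h₁⟩ := exists_ev_eq_linear_combination L M (-2 / 3) 1
  obtain ⟨χ₂, h₂⟩ := exists_ev_eq_linear_combination L M (1 / 3) 0
  have e0 : ev χ₀ =ᶠ[cofinite]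
      fun s => logDeriv (cube Br a) s / 3 - logDeriv (wronskianMul Br a b) s := by
    filter_upwards [hL, hM, h₀] with t k1 k2 k3
    rw [k3, k1, k2]; ring
  have e1 : ev χ₁ =ᶠ[cofinite]
      fun s => logDeriv (wronskianMul Br a b) s - 2 * (logDeriv (cube Br a) s / 3) := by
    filter_upwards [hL, hM, h₁] with t k1 k2 k3
    rw [k3, k1, k2]; ring
  have e2 : ev χ₂ =ᶠ[cofinite] fun s => logDeriv (cube Br a) s / 3 := by
    filter_upwards [hL, hM, h₂] with t k1 k2 k3
    rw [k3, k1, k2]; ring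
  refine ⟨![χ₀, χ₁, χ₂], isMiura_of_eventually_miuraEqs hu hv ?_, ?_⟩
  · filter_upwards [H.eventually_miuraEqs R hS ha hb, eventually_eventuallyEq_nhds e0,
      eventually_eventuallyEq_nhds e1, eventually_eventuallyEq_nhds e2] with t k k0 k1 k2
    exact k.congr k0 k1 k2
  · intro p m r hm hr
    obtain ⟨A, hA, hAm, hlog⟩ := exists_logDeriv_eq ((isRational_cube R a).meromorphicAt hS p) hm
    have hwm := (isRational_wronskianMul R a b).meromorphicAt hS p
    obtain ⟨n, hn⟩ := exists_meromorphicOrderAt_eq hwm hw0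
    obtain ⟨B, hB, hBn, hlog'⟩ := exists_logDeriv_eq hwm hn
    obtain ⟨C₂, hC₂, k2, r2⟩ := hr 2
    obtain ⟨C₁, hC₁, k1, r1⟩ := hr 1
    refine ⟨?_, n, hn, ?_⟩
    · rw [← r2, residue_unique (B := fun s => A s / 3) hC₂ (by fun_prop) k2, hAm]
      filter_upwards [hlog, e2.filter_mono (nhdsNE_le_cofinite p)] with s k3 k4
      change ev χ₂ s = _
      rw [k4, k3]; ring
    · rw [← r1, residue_unique (B := fun s => B s - 2 * (A s / 3)) hC₁ (by fun_prop) k1, hAm, hBn]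
      filter_upwards [hlog, hlog', e1.filter_mono (nhdsNE_le_cofinite p)] with s k3 k4 k5
      change ev χ₁ s = _
      rw [k5, k3, k4]; ring

end BranchSystem

variable {N : ℕ} {z : Fin N → ℂ} {lam : Fin N → Fin 3 → ℂ} {μ ν κ : Fin N → ℂ}

theorem exists_isRationalSystem (hz : Function.Injective z)
    (huv : RegularSingularAtInfty (coeffU z lam μ) (coeffV z lam ν κ))
    (h : TrivialProjectiveMonodromy (coeffU z lam μ) (coeffV z lam ν κ) (Set.range z)) :
    ∃ Br, BranchSystem (coeffU z lam μ) (coeffV z lam ν κ) (Set.range z) Br ∧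
      BranchSystem.IsRationalSystem (Set.range z) Br := by
  classical
  obtain ⟨Br, H⟩ := exists_branchSystem (Set.finite_range z) (fun t ht => analyticAt_coeffU ht)
    (fun t ht => analyticAt_coeffV ht) h
  refine ⟨Br, H, fun a ha => ?_⟩
  have hS : ((Finset.univ.image z : Finset ℂ) : Set ℂ) = Set.range z := by simp
  rw [← hS] at H ⊢
  refine H.isRational_triple ?_ ?_ ha
  · intro p _
    obtain ⟨U, hU, hu, -⟩ := exists_coeffU_eq (lam := lam) (μ := μ) hz p
    obtain ⟨V, hV, hv, -⟩ := exists_coeffV_eq (lam := lam) (ν := ν) (κ := κ) hz p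
    obtain ⟨K, hK⟩ := bounded_of_continuousAt hU.continuousAt .rfl
    obtain ⟨K', hK'⟩ := bounded_of_continuousAt hV.continuousAt .rfl
    refine ⟨max K K', ?_⟩
    filter_upwards [hu, hv, hK, hK', self_mem_nhdsWithin] with t h1 h2 h3 h4 h5
    have h6 : t - p ≠ 0 := sub_ne_zero.2 h5
    rw [h1, h2, mul_div_cancel₀ _ (pow_ne_zero 2 h6), mul_div_cancel₀ _ (pow_ne_zero 3 h6)]
    exact ⟨h3.trans (le_max_left _ _), h4.trans (le_max_right _ _)⟩
  · obtain ⟨K, hK⟩ := huv.1.bound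
    obtain ⟨K', hK'⟩ := huv.2.bound
    refine ⟨max K K', ?_⟩
    filter_upwards [hK, hK', tendsto_norm_cobounded_atTop.eventually_gt_atTop 0] with t h1 h2 h3
    constructor
    · rw [norm_inv, norm_pow, ← div_eq_mul_inv, le_div_iff₀ (by positivity)] at h1
      rw [norm_mul, norm_pow, mul_comm]
      exact h1.trans (le_max_left _ _)
    · rw [norm_inv, norm_pow, ← div_eq_mul_inv, le_div_iff₀ (by positivity)] at h2
      rw [norm_mul, norm_pow, mul_comm]
      exact h2.trans (le_max_right _ _)

theorem tripleLeft_order {Br : ℂ → (Fin 3 → ℂ → ℂ) → Prop} {e a : Fin 3 → ℂ} {p : ℂ} {m k : ℤ}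
    (hT : MeromorphicAt (tripleLeft Br e a) p) (ha : MeromorphicAt (cube Br a) p)
    (he : MeromorphicAt (cube Br e) p) (hm : meromorphicOrderAt (cube Br a) p = m)
    (hk : meromorphicOrderAt (cube Br e) p = k) :
    ∃ n : ℤ, meromorphicOrderAt (tripleLeft Br e a) p = n ∧ 3 * n = m + 2 * k := by
  have h := congrArg (meromorphicOrderAt · p) (tripleLeft_pow_three Br e a)
  rw [meromorphicOrderAt_pow hT, meromorphicOrderAt_mul ha (he.pow 2), meromorphicOrderAt_pow he,
    hm, hk] at h
  cases hn : meromorphicOrderAt (tripleLeft Br e a) p with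
  | top =>
    rw [hn] at h
    exact absurd h (by simp; exact_mod_cast WithTop.coe_ne_top.symm)
  | coe n =>
    rw [hn] at h
    refine ⟨n, rfl, WithTop.coe_injective ?_⟩
    rw [WithTop.coe_mul, WithTop.coe_add, WithTop.coe_mul]
    exact h

/-- Residues at `z i` are already known up to `σ`. Minimality of the order of `f` gives `σ⁻¹ 2 = 2`,
and minimality of the order of `W f` then excludes the transposition. -/
theorem exists_isMiura_of_trivialProjectiveMonodromy (hz : Function.Injective z)
    (hlam : ∀ i, IsDominantIntegral (lam i))
    (huv : RegularSingularAtInfty (coeffU z lam μ) (coeffV z lam ν κ))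
    (h : TrivialProjectiveMonodromy (coeffU z lam μ) (coeffV z lam ν κ) (Set.range z)) :
    ∃ χ : Fin 3 → RatFunc ℂ, IsMiura (coeffU z lam μ) (coeffV z lam ν κ) (Set.range z) χ ∧
      HasDiagonalForm z lam χ := by
  classical
  obtain ⟨Br, H, R⟩ := exists_isRationalSystem hz huv h
  have hS := Set.finite_range z
  have hsum := fun i => (hlam i).sum_eq_zero
  choose n₁ n₂ hn using hlam
  have l0 : ∀ i, lam i 0 = (2 * n₁ i + n₂ i) / 3 := fun i => by
    simp [hn i, omega1, omega2]; ring
  have l1 : ∀ i, lam i 1 = (n₂ i - n₁ i) / 3 := fun i => by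
    simp [hn i, omega1, omega2]; ring
  have l2 : ∀ i, lam i 2 = -(n₁ i + 2 * n₂ i) / 3 := fun i => by
    simp [hn i, omega1, omega2]; ring
  -- The exponents of the equation at `z i` are `lam i 2 + d` with the listed `d`; for the cube they
  -- are tripled, hence integers.
  have hord : ∀ i (a : Fin 3 → ℂ), a ≠ 0 →
      ∃ d ∈ ({0, (n₂ i : ℤ) + 1, (n₁ i : ℤ) + n₂ i + 2} : Finset ℤ),
      meromorphicOrderAt (cube Br a) (z i) = ((-(n₁ i + 2 * n₂ i) + 3 * d : ℤ) : WithTop ℤ) := by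
    intro i a ha
    obtain ⟨U, hU, hu, hU0⟩ := exists_coeffU_eq (lam := lam) (μ := μ) hz (z i)
    obtain ⟨V, hV, hv, hV0⟩ := exists_coeffV_eq (lam := lam) (ν := ν) (κ := κ) hz (z i)
    obtain ⟨m, hm, hind⟩ := H.exists_order_cube R hS ha hU hV hu hv
    rw [hU0, hV0, localWeight_apply hz, indicial _ (hsum i), mul_eq_zero, mul_eq_zero, l0, l1, l2] at hind
    rcases hind with (h1 | h1) | h1
    · refine ⟨0, by simp, ?_⟩
      rw [hm]
      congr 1
      have : (m : ℂ) = ((-(n₁ i + 2 * n₂ i) + 3 * 0 : ℤ) : ℂ) := by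
        push_cast; linear_combination 3 * h1
      exact_mod_cast this
    · refine ⟨(n₂ i : ℤ) + 1, by simp, ?_⟩
      rw [hm]
      congr 1
      have : (m : ℂ) = ((-(n₁ i + 2 * n₂ i) + 3 * (n₂ i + 1) : ℤ) : ℂ) := by
        push_cast; linear_combination 3 * h1
      exact_mod_cast this
    · refine ⟨(n₁ i : ℤ) + n₂ i + 2, by simp, ?_⟩
      rw [hm]
      congr 1
      have : (m : ℂ) = ((-(n₁ i + 2 * n₂ i) + 3 * (n₁ i + n₂ i + 2) : ℤ) : ℂ) := by
        push_cast; linear_combination 3 * h1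
      exact_mod_cast this
  have hcm := fun a i => (BranchSystem.isRational_cube R a).meromorphicAt hS (z i)
  obtain ⟨a, ha, hao⟩ : ∃ a : Fin 3 → ℂ, a ≠ 0 ∧ ∀ i,
      meromorphicOrderAt (cube Br a) (z i) = ((-(n₁ i + 2 * n₂ i) : ℤ) : WithTop ℤ) := by
    -- An auxiliary solution. Multiplication by its square makes every solution single-valued and
    -- shifts all exponents at `z i` by the same amount, namely twice the exponent of `e`.
    set e : Fin 3 → ℂ := Pi.single 0 1 with he
    have he0 : e ≠ 0 := by simp [he]
    choose k hk hko using fun i => hord i e he0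
    have hT : ∀ i v, MeromorphicAt (tripleLeft Br e v) (z i) := fun i v =>
      (R _ fun k => by fin_cases k <;> simp).meromorphicAt hS (z i)
    obtain ⟨a, ha, hao⟩ := exists_order_eq_min (T := tripleLeft Br e) z hT
      (fun i => ({0, (n₂ i : ℤ) + 1, (n₁ i : ℤ) + n₂ i + 2} : Finset ℤ).image
        fun d => -(n₁ i + 2 * n₂ i) + 2 * k i + d)
      (fun i => -(n₁ i + 2 * n₂ i) + 2 * k i)
      (fun i => ⟨by simp, fun m hm => by
        simp only [Finset.mem_image, Finset.mem_insert, Finset.mem_singleton] at hm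
        omega⟩)
      (fun i => by
        rw [Module.finrank_fin_fun]
        exact Finset.card_image_le.trans Finset.card_le_three)
      (by simp)
      (fun i v hv => by
        obtain ⟨d, hd, hdo⟩ := hord i v hv
        obtain ⟨n, hn, hn3⟩ := tripleLeft_order (hT i v) (hcm v i) (hcm e i) hdo (hko i)
        exact ⟨n, Finset.mem_image.2 ⟨d, hd, by omega⟩, hn⟩)
    refine ⟨a, ha, fun i => ?_⟩
    obtain ⟨d, hd, hdo⟩ := hord i a ha
    obtain ⟨n, hn, hn3⟩ := tripleLeft_order (hT i a) (hcm a i) (hcm e i) hdo (hko i)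
    rw [hao i, WithTop.coe_inj] at hn
    have : d = 0 := by omega
    rw [hdo, this]; simp
  -- Adding a multiple of `a` to `b` does not change the Wronskian, so `b` ranges over a complement;
  -- its dimension 2 equals the number of possible orders of `W f`.
  obtain ⟨E, hE⟩ := Submodule.exists_isCompl (Submodule.span ℂ {a})
  have hE2 : Module.finrank ℂ E = 2 := by
    have := Submodule.finrank_add_eq_of_isCompl hE
    rw [finrank_span_singleton ha, Module.finrank_fin_fun] at this
    omega
  have hEs : ∀ b : E, b ≠ 0 → (b : Fin 3 → ℂ) ∉ Submodule.span ℂ {a} := fun b hb hmem =>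
    hb (by simpa using Submodule.disjoint_def.1 hE.disjoint b hmem b.2)
  have hfac : ∀ b : E, b ≠ 0 → ∃ χ : Fin 3 → RatFunc ℂ,
      IsMiura (coeffU z lam μ) (coeffV z lam ν κ) (Set.range z) χ ∧
      ∀ i, ∃ d : ℤ, meromorphicOrderAt (wronskianMul Br a b) (z i) =
          ((-(n₁ i + n₂ i) + d : ℤ) : WithTop ℤ) ∧
        (d = 0 ∧ HasResidue χ (z i) (lam i) ∨ d = n₁ i + 1) := by
    intro b hb
    obtain ⟨χ, hχ, hres⟩ := H.exists_isMiura R hS (fun t ht => analyticAt_coeffU ht)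
      (fun t ht => analyticAt_coeffV ht) ha (hEs b hb)
    refine ⟨χ, hχ, fun i => ?_⟩
    obtain ⟨σ, hσ⟩ := hχ.exists_hasResidue hz hsum (z i)
    rw [localWeight_apply hz] at hσ
    obtain ⟨r2, n, hno, r1⟩ := hres _ _ _ (hao i) hσ
    -- By dominance consecutive entries of `lam i + rhoBar` differ by the positive integers `n₁ i +
    -- 1` and `n₂ i + 1`, so the smallest entry occurs only in the last place.
    have hσ2 : σ⁻¹ 2 = 2 := by
      simp only [weylDot, weyl, Pi.sub_apply, Pi.add_apply] at r2
      generalize σ⁻¹ 2 = x at r2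
      fin_cases x
      · simp only [Fin.zero_eta, rhoBar, Matrix.cons_val, l0] at r2
        have : ((n₁ i + n₂ i + 2 : ℕ) : ℂ) = 0 := by
          push_cast at r2 ⊢; linear_combination r2
        norm_cast at this
      · simp only [Fin.mk_one, rhoBar, Matrix.cons_val, l1] at r2
        have : ((n₂ i + 1 : ℕ) : ℂ) = 0 := by
          push_cast at r2 ⊢; linear_combination r2
        norm_cast at this
      · rfl
    have hσ1 : σ⁻¹ 1 = 1 ∨ σ⁻¹ 1 = 0 := by
      have : σ⁻¹ 1 ≠ 2 := fun h => by
        have := (σ⁻¹).injective (h.trans hσ2.symm)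
        simp at this
      generalize σ⁻¹ 1 = x at this
      fin_cases x <;> simp at this ⊢
    refine ⟨n + (n₁ i + n₂ i), by rw [hno]; congr 1; ring, ?_⟩
    simp only [weylDot, weyl, Pi.sub_apply, Pi.add_apply] at r1
    rcases hσ1 with h1 | h1
    · left
      have hσid : σ = 1 := by
        have key : ∀ τ : Equiv.Perm (Fin 3), τ 2 = 2 → τ 1 = 1 → τ = 1 := by decide
        exact inv_eq_one.1 (key _ hσ2 h1)
      subst hσid
      refine ⟨?_, by
        have e : weylDot 1 (lam i) = lam i := by ext k; simp [weylDot, weyl]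
        rwa [e] at hσ⟩
      simp only [h1, rhoBar, Matrix.cons_val, l1] at r1
      have : (n : ℂ) = ((-(n₁ i + n₂ i) : ℤ) : ℂ) := by
        push_cast at r1 ⊢; linear_combination -r1
      have : n = -(n₁ i + n₂ i) := by exact_mod_cast this
      omega
    · right
      simp only [h1, rhoBar, Matrix.cons_val, l0] at r1
      have : (n : ℂ) = ((1 - n₂ i : ℤ) : ℂ) := by
        push_cast at r1 ⊢; linear_combination -r1
      have : n = 1 - n₂ i := by exact_mod_cast this
      omega
  -- The second order exceeds the first by `n₁ i + 1 > 0`, so attaining the minimum means that the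
  -- residue is `lam i`.
  obtain ⟨b, hb, hbo⟩ := exists_order_eq_min (T := (wronskianMulRight Br a).comp E.subtype) z
    (fun i v => (BranchSystem.isRational_wronskianMul R a v).meromorphicAt hS (z i))
    (fun i => {-(n₁ i + n₂ i : ℤ), -(n₁ i + n₂ i : ℤ) + (n₁ i + 1)})
    (fun i => -(n₁ i + n₂ i : ℤ))
    (fun i => ⟨by simp, fun m hm => by
      simp only [Finset.mem_insert, Finset.mem_singleton] at hm
      omega⟩)
    (fun i => by rw [hE2]; exact Finset.card_le_two)
    (by omega)
    (fun i b hb => by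
      obtain ⟨χ, -, h2⟩ := hfac b hb
      obtain ⟨d, hd, h3⟩ := h2 i
      refine ⟨_, ?_, hd⟩
      rcases h3 with ⟨rfl, -⟩ | rfl <;> simp)
  obtain ⟨χ, hχ, h2⟩ := hfac b hb
  refine ⟨χ, hχ, hχ.hasDiagonalForm hz hsum huv fun i => ?_⟩
  obtain ⟨d, hd, h3⟩ := h2 i
  have h4 : meromorphicOrderAt (wronskianMul Br a b) (z i) = _ := hbo i
  rw [hd, WithTop.coe_inj] at h4
  rcases h3 with ⟨-, h3⟩ | h3
  · exact h3
  · omega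

end

/-! ### Primitives of meromorphic functions -/

theorem eventually_nhdsNE_eventually_nhds {P : ℂ → Prop} {p : ℂ} (h : ∀ᶠ t in 𝓝[≠] p, P t) :
    ∀ᶠ t in 𝓝[≠] p, ∀ᶠ s in 𝓝 t, P s := by
  filter_upwards [eventually_eventually_nhdsWithin.2 h, self_mem_nhdsWithin] with t h1 h2
  rwa [isOpen_compl_singleton.nhdsWithin_eq h2] at h1

theorem eventuallyEq_deriv_nhdsNE {f g : ℂ → ℂ} {p : ℂ} (h : f =ᶠ[𝓝[≠] p] g) :
    deriv f =ᶠ[𝓝[≠] p] deriv g :=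
  (eventually_nhdsNE_eventually_nhds h).mono fun _ ht => EventuallyEq.deriv_eq ht

/-- On a punctured neighbourhood: a function of finite order has that order as residue of its
logarithmic derivative, which is zero here. Hence there is no pole, and the extension over `p` is
constant on a disc. -/
theorem eventually_const_of_deriv_eq_zero {h : ℂ → ℂ} {p : ℂ} (hm : MeromorphicAt h p)
    (h0 : deriv h =ᶠ[𝓝[≠] p] fun _ => 0) : ∃ c, h =ᶠ[𝓝[≠] p] fun _ => c := by
  have hord : 0 ≤ meromorphicOrderAt h p := by
    cases hn : meromorphicOrderAt h p with
    | top => exact le_top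
    | coe n =>
      obtain ⟨A, hA, hAn, hlog⟩ := exists_logDeriv_eq hm hn
      have hA0 : A p = 0 := eq_of_eventuallyEq_nhdsNE hA.continuousAt
        (g := fun _ => 0) continuousAt_const (by
          filter_upwards [hlog, h0, self_mem_nhdsWithin] with s h1 h2 h3
          have h4 : s - p ≠ 0 := sub_ne_zero.2 h3
          rw [logDeriv_apply, h2, zero_div, eq_comm, div_eq_zero_iff] at h1
          exact h1.resolve_right h4)
      rw [hAn] at hA0
      have : n = 0 := by exact_mod_cast hA0
      simp [this]
  obtain ⟨g, hg, hhg⟩ := hm.meromorphicOrderAt_nonneg_iff.1 hord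
  have hg1 : ∀ᶠ t in 𝓝[≠] p, deriv g t = 0 := by
    filter_upwards [eventuallyEq_deriv_nhdsNE hhg, h0] with t h1 h2
    rw [← h1, h2]
  have hg2 : ∀ᶠ t in 𝓝 p, deriv g t = 0 := by
    refine hg.deriv.eventually_eq_zero_or_eventually_ne_zero.resolve_right fun h => ?_
    obtain ⟨t, k1, k2⟩ := (h.and hg1).exists
    exact k1 k2
  obtain ⟨r, hr, hball⟩ := Metric.eventually_nhds_iff_ball.1 (hg.eventually_analyticAt.and hg2)
  refine ⟨g p, hhg.trans ?_⟩
  filter_upwards [nhdsWithin_le_nhds (Metric.ball_mem_nhds p hr)] with s hs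
  exact Metric.isOpen_ball.is_const_of_deriv_eq_zero (convex_ball p r).isPreconnected
    (fun t ht => (hball t ht).1.differentiableAt.differentiableWithinAt)
    (fun t ht => (hball t ht).2) hs (Metric.mem_ball_self hr)

/-- The polar part is split off one term at a time. That `q` is analytic everywhere except at `p`
allows its subtraction without creating new singularities. -/
theorem exists_principalPart {p : ℂ} (n : ℕ) : ∀ {F h : ℂ → ℂ}, AnalyticAt ℂ h p →
    (F =ᶠ[𝓝[≠] p] fun s => h s / (s - p) ^ n) →
    ∃ q k : ℂ → ℂ, (∀ t ≠ p, AnalyticAt ℂ q t) ∧ MeromorphicAt q p ∧ AnalyticAt ℂ k p ∧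
      F =ᶠ[𝓝[≠] p] fun s => q s + k s := by
  induction n with
  | zero =>
    intro F h hh hF
    exact ⟨fun _ => 0, h, fun _ _ => analyticAt_const, by fun_prop, hh, by simpa using hF⟩
  | succ n ih =>
    intro F h hh hF
    have hd : AnalyticAt ℂ (dslope h p) p := by
      obtain ⟨q, hq⟩ := hh
      exact hq.has_fpower_series_dslope_fslope.analyticAt
    obtain ⟨q, k, hq, hqm, hk, hqk⟩ := ih (F := fun s => dslope h p s / (s - p) ^ n) hd .rfl
    refine ⟨fun s => h p / (s - p) ^ (n + 1) + q s, k, fun t ht => ?_, by fun_prop, hk, ?_⟩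
    · have : t - p ≠ 0 := sub_ne_zero.2 ht
      have := hq t ht
      fun_prop (disch := simpa)
    · filter_upwards [hF, hqk, self_mem_nhdsWithin] with s h1 h2 h3
      have h4 : s - p ≠ 0 := sub_ne_zero.2 h3
      have h5 := sub_smul_dslope h p s
      rw [smul_eq_mul] at h5
      rw [h1, add_assoc, ← h2]
      field_simp
      linear_combination -(s - p) ^ n * h5

/-- A meromorphic function with local primitives has a global primitive. -/
theorem exists_primitive (T : Finset ℂ) : ∀ {G : ℂ → ℂ}, (∀ t ∉ T, AnalyticAt ℂ G t) →
    (∀ p ∈ T, ∃ F, MeromorphicAt F p ∧ deriv F =ᶠ[𝓝[≠] p] G) →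
    ∃ A : ℂ → ℂ, (∀ p, MeromorphicAt A p) ∧ ∀ t ∉ T, AnalyticAt ℂ A t ∧ deriv A t = G t := by
  classical
  induction T using Finset.induction_on with
  | empty =>
    intro G hG _
    obtain ⟨A, hA⟩ := Differentiable.isExactOn_univ
      (f := G) fun t => (hG t (by simp)).differentiableAt
    have hd : Differentiable ℂ A := fun t => (hA t trivial).differentiableAt
    exact ⟨A, fun p => (hd.analyticAt p).meromorphicAt,
      fun t _ => ⟨hd.analyticAt t, (hA t trivial).deriv⟩⟩
  | insert p T hp ih =>
    intro G hG hF
    obtain ⟨F, hFm, hFd⟩ := hF p (Finset.mem_insert_self p T)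
    obtain ⟨n, hn⟩ := hFm
    obtain ⟨q, k, hq, hqm, hk, hqk⟩ := exists_principalPart (F := F) n hn (by
      filter_upwards [self_mem_nhdsWithin] with s h3
      have h4 : s - p ≠ 0 := sub_ne_zero.2 h3
      rw [smul_eq_mul, mul_div_cancel_left₀ _ (pow_ne_zero n h4)])
    have hdF : G =ᶠ[𝓝[≠] p] fun s => deriv q s + deriv k s := by
      filter_upwards [hFd, eventuallyEq_deriv_nhdsNE hqk, self_mem_nhdsWithin,
        hk.eventually_analyticAt.filter_mono nhdsWithin_le_nhds] with s h1 h2 h3 h4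
      rw [← h1, h2]
      exact ((hq s h3).differentiableAt.hasDerivAt.add h4.differentiableAt.hasDerivAt).deriv
    -- Subtracting the derivative of the polar part makes `G` extend over `p`, with the value `deriv
    -- k p`, and leaves one singular point fewer.
    set G' : ℂ → ℂ := Function.update (fun t => G t - deriv q t) p (deriv k p) with hG'
    have hne : ∀ t ≠ p, G' t = G t - deriv q t := fun t ht => Function.update_of_ne ht _ _
    have hnear : ∀ t ≠ p, G' =ᶠ[𝓝 t] fun s => G s - deriv q s := fun t ht => by
      filter_upwards [isOpen_compl_singleton.mem_nhds ht] with s hs using hne s hs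
    have hp' : G' =ᶠ[𝓝 p] deriv k := by
      have : ∀ᶠ s in 𝓝[≠] p, G' s = deriv k s := by
        filter_upwards [hdF, self_mem_nhdsWithin] with s h1 h2
        rw [hne s h2, h1]; ring
      rw [eventually_nhdsWithin_iff] at this
      filter_upwards [this] with s hs
      by_cases h : s = p
      · rw [h, hG', Function.update_self]
      · exact hs h
    obtain ⟨A, hAm, hA⟩ := ih (G := G') (fun t ht => by
      by_cases h : t = p
      · subst h
        exact hk.deriv.congr hp'.symm
      · exact ((hG t (by simp [h, ht])).sub (hq t h).deriv).congr (hnear t h).symm) (fun t ht => by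
      have h : t ≠ p := fun h => hp (h ▸ ht)
      obtain ⟨B, hB, hBd⟩ := hF t (Finset.mem_insert_of_mem ht)
      refine ⟨fun s => B s - q s, hB.sub (hq t h).meromorphicAt, ?_⟩
      filter_upwards [hBd, (hnear t h).filter_mono nhdsWithin_le_nhds,
        hB.eventually_analyticAt, (hq t h).eventually_analyticAt.filter_mono nhdsWithin_le_nhds]
        with s h1 h2 h3 h4
      rw [h2, ← h1]
      exact (h3.differentiableAt.hasDerivAt.sub h4.differentiableAt.hasDerivAt).deriv)
    refine ⟨fun s => A s + q s, fun t => ?_, fun t ht => ?_⟩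
    · by_cases h : t = p
      · subst h; exact (hAm t).add hqm
      · exact (hAm t).add (hq t h).meromorphicAt
    · rw [Finset.mem_insert, not_or] at ht
      obtain ⟨h1, h2⟩ := hA t ht.2
      refine ⟨h1.add (hq t ht.1), ?_⟩
      rw [(h1.differentiableAt.hasDerivAt.fun_add (hq t ht.1).differentiableAt.hasDerivAt).deriv, h2,
        hne t ht.1]
      ring

/-- The vectors whose image vanishes near `p`. -/
def germKer {E : Type*} [AddCommGroup E] [Module ℂ E] (T : E →ₗ[ℂ] (ℂ → ℂ)) (p : ℂ) :
    Submodule ℂ E where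
  carrier := {v | T v =ᶠ[𝓝[≠] p] fun _ => 0}
  zero_mem' := by
    rw [Set.mem_ofPred_eq, map_zero]
    rfl
  add_mem' := by
    intro a b ha hb
    change T (a + b) =ᶠ[𝓝[≠] p] fun _ => 0
    filter_upwards [ha, hb] with t h1 h2
    simp [h1, h2]
  smul_mem' := by
    intro c a ha
    change T (c • a) =ᶠ[𝓝[≠] p] fun _ => 0
    filter_upwards [ha] with t h1
    simp [h1]

/-- A linear map whose values are germs of constants has rank at most one. -/
theorem finrank_le_finrank_inf_germKer {E : Type*} [AddCommGroup E] [Module ℂ E]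
    [FiniteDimensional ℂ E] {T : E →ₗ[ℂ] (ℂ → ℂ)} {p : ℂ} {K : Submodule ℂ E}
    (hK : ∀ v ∈ K, ∃ c, T v =ᶠ[𝓝[≠] p] fun _ => c) :
    Module.finrank ℂ K ≤ Module.finrank ℂ (K ⊓ germKer T p : Submodule ℂ E) + 1 := by
  by_cases h : K ≤ germKer T p
  · rw [inf_eq_left.2 h]; omega
  · obtain ⟨v, hv, hvT⟩ := SetLike.not_le_iff_exists.1 h
    obtain ⟨c, hc⟩ := hK v hv
    have hc0 : c ≠ 0 := fun h0 => hvT (show T v =ᶠ[𝓝[≠] p] fun _ => 0 by rwa [h0] at hc)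
    have hv0 : v ≠ 0 := fun h => hvT (h ▸ Submodule.zero_mem _)
    have hsup : K ≤ (K ⊓ germKer T p) ⊔ Submodule.span ℂ {v} := by
      intro w hw
      obtain ⟨d, hd⟩ := hK w hw
      rw [← sub_add_cancel w ((d / c) • v)]
      refine Submodule.add_mem_sup ⟨K.sub_mem hw (K.smul_mem _ hv), ?_⟩
        (Submodule.smul_mem _ _ (Submodule.mem_span_singleton_self v))
      change T (w - (d / c) • v) =ᶠ[𝓝[≠] p] fun _ => 0
      filter_upwards [hc, hd] with t h1 h2
      simp [h1, h2, hc0]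
    calc Module.finrank ℂ K ≤ _ := Submodule.finrank_mono hsup
      _ ≤ _ := Submodule.finrank_add_le_finrank_add_finrank _ _
      _ ≤ _ := add_le_add le_rfl (finrank_span_singleton hv0).le

section

/-! ### Integrating a factorized operator -/

/-- Variation of constants: conjugation by a solution `Φ` of `Φ' = g Φ` turns `∂ - g` into `∂`. -/
theorem factorOp_mul {g Φ h : ℂ → ℂ} {t : ℂ} (hΦ : DifferentiableAt ℂ Φ t)
    (hh : DifferentiableAt ℂ h t) (hg : deriv Φ t = g t * Φ t) :
    factorOp g (fun s => Φ s * h s) t = Φ t * deriv h t := by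
  rw [factorOp, (hΦ.hasDerivAt.fun_mul hh.hasDerivAt).deriv, hg]
  ring

theorem deriv_div_eq_factorOp {g Φ y : ℂ → ℂ} {t : ℂ} (hΦ : DifferentiableAt ℂ Φ t)
    (hy : DifferentiableAt ℂ y t) (h0 : Φ t ≠ 0) (hg : deriv Φ t = g t * Φ t) :
    deriv (fun s => y s / Φ s) t = factorOp g y t / Φ t := by
  rw [factorOp, (hy.hasDerivAt.fun_div hΦ.hasDerivAt h0).deriv, hg]
  field_simp

theorem factorOp_congr_nhdsNE {g f f' : ℂ → ℂ} {p : ℂ} (h : f =ᶠ[𝓝[≠] p] f') :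
    factorOp g f =ᶠ[𝓝[≠] p] factorOp g f' := by
  filter_upwards [h, eventuallyEq_deriv_nhdsNE h] with t h1 h2
  rw [factorOp, factorOp, h1, h2]

theorem _root_.MeromorphicAt.factorOp {g f : ℂ → ℂ} {p : ℂ} (hg : MeromorphicAt g p)
    (hf : MeromorphicAt f p) : MeromorphicAt (factorOp g f) p :=
  hf.deriv.sub (hg.mul hf)

/-- A factorization `∂³ - u ∂ - v = (∂ - a)(∂ - b)(∂ - c)` near `p`, with meromorphic `Φ₀, Φ₁, Φ₂`
annihilated by the factors `∂ - c`, `∂ - b`, `∂ - a`. -/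
structure Frame (u v a b c Φ₀ Φ₁ Φ₂ : ℂ → ℂ) (p : ℂ) : Prop where
  meromorphicAt_b : MeromorphicAt b p
  meromorphicAt_c : MeromorphicAt c p
  meromorphicAt_zero : MeromorphicAt Φ₀ p
  meromorphicAt_one : MeromorphicAt Φ₁ p
  meromorphicAt_two : MeromorphicAt Φ₂ p
  miuraEqs : ∀ᶠ t in 𝓝[≠] p, MiuraEqs u v a b c t
  eventually_zero : ∀ᶠ t in 𝓝[≠] p, Φ₀ t ≠ 0 ∧ deriv Φ₀ t = c t * Φ₀ t
  eventually_one : ∀ᶠ t in 𝓝[≠] p, Φ₁ t ≠ 0 ∧ deriv Φ₁ t = b t * Φ₁ t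
  eventually_two : ∀ᶠ t in 𝓝[≠] p, Φ₂ t ≠ 0 ∧ deriv Φ₂ t = a t * Φ₂ t

/-- Iterated primitives: `A' = Φ₁/Φ₀`, `B' = Φ₂/Φ₁`, `C' = (Φ₁/Φ₀) B`. -/
structure IteratedPrimitives (Φ₀ Φ₁ Φ₂ A B C : ℂ → ℂ) (p : ℂ) : Prop where
  meromorphicAt_A : MeromorphicAt A p
  meromorphicAt_B : MeromorphicAt B p
  meromorphicAt_C : MeromorphicAt C p
  deriv_A : deriv A =ᶠ[𝓝[≠] p] fun t => Φ₁ t / Φ₀ t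
  deriv_B : deriv B =ᶠ[𝓝[≠] p] fun t => Φ₂ t / Φ₁ t
  deriv_C : deriv C =ᶠ[𝓝[≠] p] fun t => Φ₁ t / Φ₀ t * B t

theorem eventually_deriv_linear_combination {F G : ℂ → ℂ} {p : ℂ} (hF : MeromorphicAt F p)
    (hG : MeromorphicAt G p) (k l : ℂ) : deriv (fun s => k * F s + l * G s) =ᶠ[𝓝[≠] p]
      fun s => k * deriv F s + l * deriv G s := by
  filter_upwards [hF.eventually_analyticAt, hG.eventually_analyticAt] with t h1 h2
  exact ((h1.differentiableAt.hasDerivAt.const_mul k).fun_add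
    (h2.differentiableAt.hasDerivAt.const_mul l)).deriv

/-- `comb` as a linear map in the coefficients. -/
def combLin (y : Fin 3 → ℂ → ℂ) : (Fin 3 → ℂ) →ₗ[ℂ] (ℂ → ℂ) where
  toFun w := comb w y
  map_add' a b := by
    ext t; simp only [comb, Fin.sum_univ_three, Pi.add_apply]; ring
  map_smul' k a := by
    ext t
    simp only [comb, Fin.sum_univ_three, Pi.smul_apply, smul_eq_mul, RingHom.id_apply]; ring

theorem meromorphicAt_comb {y : Fin 3 → ℂ → ℂ} {p : ℂ} (hy : ∀ j, MeromorphicAt (y j) p)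
    (w : Fin 3 → ℂ) : MeromorphicAt (comb w y) p :=
  MeromorphicAt.fun_sum fun j _ => (MeromorphicAt.const (w j) p).mul (hy j)

theorem deriv_comb_nhdsNE {y y' : Fin 3 → ℂ → ℂ} {r : ℂ → ℂ} {p : ℂ}
    (hy : ∀ j, MeromorphicAt (y j) p) (h : ∀ j, deriv (y j) =ᶠ[𝓝[≠] p] fun t => r t * y' j t)
    (w : Fin 3 → ℂ) : deriv (comb w y) =ᶠ[𝓝[≠] p] fun t => r t * comb w y' t := by
  filter_upwards [eventually_all.2 fun j => (hy j).eventually_analyticAt, eventually_all.2 h]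
    with t h1 h2
  rw [(deriv_comb h1).eq_of_nhds, comb, comb, Finset.mul_sum]
  exact Finset.sum_congr rfl fun j _ => by rw [h2]; ring

namespace Frame

variable {u v a b c Φ₀ Φ₁ Φ₂ : ℂ → ℂ} {p : ℂ}

theorem oper_eq_zero (H : Frame u v a b c Φ₀ Φ₁ Φ₂ p) {A B C : ℂ → ℂ}
    (I : IteratedPrimitives Φ₀ Φ₁ Φ₂ A B C p) (k : Fin 3 → ℂ) :
    ∀ᶠ t in 𝓝[≠] p, oper u v (fun s => Φ₀ s * (k 0 + k 1 * A s + k 2 * C s)) t = 0 := by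
  set y := fun s => Φ₀ s * (k 0 + k 1 * A s + k 2 * C s) with hy
  have e1 : factorOp c y =ᶠ[𝓝[≠] p] fun s => Φ₁ s * (k 1 + k 2 * B s) := by
    filter_upwards [H.eventually_zero, H.meromorphicAt_zero.eventually_analyticAt,
      I.meromorphicAt_A.eventually_analyticAt, I.meromorphicAt_C.eventually_analyticAt,
      I.deriv_A, I.deriv_C] with t h1 h2 h3 h4 h5 h6
    have hd := ((h3.differentiableAt.hasDerivAt.const_mul (k 1)).const_add (k 0)).fun_add
      (h4.differentiableAt.hasDerivAt.const_mul (k 2))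
    rw [factorOp_mul h2.differentiableAt hd.differentiableAt h1.2, hd.deriv, h5, h6]
    have := h1.1
    field_simp
  have e2 : factorOp b (factorOp c y) =ᶠ[𝓝[≠] p] fun s => Φ₂ s * k 2 := by
    refine (factorOp_congr_nhdsNE e1).trans ?_
    filter_upwards [H.eventually_one, H.meromorphicAt_one.eventually_analyticAt,
      I.meromorphicAt_B.eventually_analyticAt, I.deriv_B] with t h1 h2 h3 h4
    have hd := (h3.differentiableAt.hasDerivAt.const_mul (k 2)).const_add (k 1)
    rw [factorOp_mul h2.differentiableAt hd.differentiableAt h1.2, hd.deriv, h4]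
    have := h1.1
    field_simp
  have e3 : factorOp a (factorOp b (factorOp c y)) =ᶠ[𝓝[≠] p] fun _ => 0 := by
    refine (factorOp_congr_nhdsNE e2).trans ?_
    filter_upwards [H.eventually_two, H.meromorphicAt_two.eventually_analyticAt] with t h1 h2
    rw [factorOp_mul h2.differentiableAt (differentiableAt_const _) h1.2]
    simp
  filter_upwards [e3, H.miuraEqs, H.meromorphicAt_b.eventually_analyticAt,
    H.meromorphicAt_c.eventually_analyticAt, H.meromorphicAt_zero.eventually_analyticAt,
    I.meromorphicAt_A.eventually_analyticAt, I.meromorphicAt_C.eventually_analyticAt]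
    with t h1 h2 h3 h4 h5 h6 h7
  rw [h2.oper_eq h3 h4 (by fun_prop), h1]

/-- The coordinates `f / Φ₀`, `(∂ - c) f / Φ₁` and `(∂ - b)(∂ - c) f / Φ₂` of a function. -/
def coord (b c Φ₀ Φ₁ Φ₂ f : ℂ → ℂ) : Fin 3 → ℂ → ℂ :=
  ![fun t => f t / Φ₀ t, fun t => factorOp c f t / Φ₁ t,
    fun t => factorOp b (factorOp c f) t / Φ₂ t]

theorem meromorphicAt_coord (H : Frame u v a b c Φ₀ Φ₁ Φ₂ p) {f : ℂ → ℂ} (hf : AnalyticAt ℂ f p)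
    (k : Fin 3) : MeromorphicAt (coord b c Φ₀ Φ₁ Φ₂ f k) p := by
  have h1 := H.meromorphicAt_c.factorOp hf.meromorphicAt
  fin_cases k
  · exact hf.meromorphicAt.div H.meromorphicAt_zero
  · exact h1.div H.meromorphicAt_one
  · exact (H.meromorphicAt_b.factorOp h1).div H.meromorphicAt_two

theorem deriv_coord (H : Frame u v a b c Φ₀ Φ₁ Φ₂ p) {f : ℂ → ℂ} (hf : AnalyticAt ℂ f p)
    (hs : ∀ᶠ t in 𝓝 p, oper u v f t = 0) :
    (deriv (coord b c Φ₀ Φ₁ Φ₂ f 0) =ᶠ[𝓝[≠] p] fun t => Φ₁ t / Φ₀ t * coord b c Φ₀ Φ₁ Φ₂ f 1 t) ∧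
    (deriv (coord b c Φ₀ Φ₁ Φ₂ f 1) =ᶠ[𝓝[≠] p] fun t => Φ₂ t / Φ₁ t * coord b c Φ₀ Φ₁ Φ₂ f 2 t) ∧
    deriv (coord b c Φ₀ Φ₁ Φ₂ f 2) =ᶠ[𝓝[≠] p] fun _ => 0 := by
  have m1 := H.meromorphicAt_c.factorOp hf.meromorphicAt
  have m2 := H.meromorphicAt_b.factorOp m1
  refine ⟨?_, ?_, ?_⟩
  · filter_upwards [H.eventually_zero, H.eventually_one, H.meromorphicAt_zero.eventually_analyticAt,
      hf.eventually_analyticAt.filter_mono nhdsWithin_le_nhds] with t h1 h2 h3 h4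
    have k1 := h1.1
    have k2 := h2.1
    refine (deriv_div_eq_factorOp h3.differentiableAt h4.differentiableAt h1.1 h1.2).trans ?_
    simp only [coord, Matrix.cons_val]
    field_simp
  · filter_upwards [H.eventually_one, H.eventually_two, H.meromorphicAt_one.eventually_analyticAt,
      m1.eventually_analyticAt] with t h1 h2 h3 h4
    have k1 := h1.1
    have k2 := h2.1
    refine (deriv_div_eq_factorOp h3.differentiableAt h4.differentiableAt h1.1 h1.2).trans ?_
    simp only [coord, Matrix.cons_val]
    field_simp
  · filter_upwards [H.eventually_two, H.meromorphicAt_two.eventually_analyticAt,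
      m2.eventually_analyticAt, H.miuraEqs, H.meromorphicAt_b.eventually_analyticAt,
      H.meromorphicAt_c.eventually_analyticAt, hs.filter_mono nhdsWithin_le_nhds,
      hf.eventually_analyticAt.filter_mono nhdsWithin_le_nhds] with t h1 h2 h3 h4 h5 h6 h7 h8
    refine (deriv_div_eq_factorOp h2.differentiableAt h3.differentiableAt h1.1 h1.2).trans ?_
    rw [← h4.oper_eq h5 h6 h8, h7, zero_div]

/-- Every solution is a combination of the iterated primitives. -/
theorem exists_eq_of_solution (H : Frame u v a b c Φ₀ Φ₁ Φ₂ p) {A B C : ℂ → ℂ}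
    (I : IteratedPrimitives Φ₀ Φ₁ Φ₂ A B C p) {f : ℂ → ℂ} (hf : AnalyticAt ℂ f p)
    (hs : ∀ᶠ t in 𝓝 p, oper u v f t = 0) :
    ∃ k : Fin 3 → ℂ, f =ᶠ[𝓝[≠] p] fun s => Φ₀ s * (k 0 + k 1 * A s + k 2 * C s) := by
  have hm := H.meromorphicAt_coord hf
  obtain ⟨d0, d1, d2⟩ := H.deriv_coord hf hs
  -- The system for the coordinates is triangular and is integrated from the last coordinate
  -- upwards, each integration producing one constant.
  obtain ⟨k2, hk2⟩ := eventually_const_of_deriv_eq_zero (hm 2) d2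
  obtain ⟨k1, hk1⟩ := eventually_const_of_deriv_eq_zero
    (h := fun s => 1 * coord b c Φ₀ Φ₁ Φ₂ f 1 s + (-k2) * B s)
    (((MeromorphicAt.const _ _).mul (hm 1)).add ((MeromorphicAt.const _ _).mul I.meromorphicAt_B)) (by
      refine (eventually_deriv_linear_combination (hm 1) I.meromorphicAt_B _ _).trans ?_
      filter_upwards [d1, I.deriv_B, hk2] with t h1 h2 h3
      rw [h1, h2, h3]; ring)
  have hAC : MeromorphicAt (fun s => k1 * A s + k2 * C s) p :=
    ((MeromorphicAt.const _ _).mul I.meromorphicAt_A).add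
      ((MeromorphicAt.const _ _).mul I.meromorphicAt_C)
  obtain ⟨k0, hk0⟩ := eventually_const_of_deriv_eq_zero
    (h := fun s => 1 * coord b c Φ₀ Φ₁ Φ₂ f 0 s + (-1) * (k1 * A s + k2 * C s))
    (((MeromorphicAt.const _ _).mul (hm 0)).add ((MeromorphicAt.const _ _).mul hAC)) (by
      refine (eventually_deriv_linear_combination (hm 0) hAC _ _).trans ?_
      filter_upwards [d0, I.deriv_A, I.deriv_C, hk1, eventually_deriv_linear_combination
        I.meromorphicAt_A I.meromorphicAt_C k1 k2] with t h1 h2 h3 h4 h5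
      rw [h5, h1, h2, h3]
      linear_combination (Φ₁ t / Φ₀ t) * h4)
  refine ⟨![k0, k1, k2], ?_⟩
  filter_upwards [hk0, H.eventually_zero] with t h1 h2
  have h3 := h2.1
  simp only [coord, Matrix.cons_val] at h1 ⊢
  field_simp at h1
  linear_combination h1

/-- Near a regular point of the operator, iterated primitives exist. -/
theorem exists_iteratedPrimitives (H : Frame u v a b c Φ₀ Φ₁ Φ₂ p) (hu : AnalyticAt ℂ u p)
    (hv : AnalyticAt ℂ v p) : ∃ A B C, IteratedPrimitives Φ₀ Φ₁ Φ₂ A B C p := by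
  choose ψ hψa hψs hψ0 hψ1 hψ2 using fun j : Fin 3 => exists_solution hu hv (Pi.single j 1)
  have hw : wronskian ψ p = 1 := by
    simp [wronskian, hψ0, hψ1, hψ2]
  set y : Fin 3 → Fin 3 → ℂ → ℂ := fun k j => coord b c Φ₀ Φ₁ Φ₂ (ψ j) k with hy
  have hm : ∀ k w, MeromorphicAt (comb w (y k)) p := fun k w =>
    meromorphicAt_comb (fun j => H.meromorphicAt_coord (hψa j) k) w
  have hd0 : ∀ w, deriv (comb w (y 0)) =ᶠ[𝓝[≠] p] fun t => Φ₁ t / Φ₀ t * comb w (y 1) t :=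
    fun w => deriv_comb_nhdsNE (fun j => H.meromorphicAt_coord (hψa j) 0)
    (fun j => (H.deriv_coord (hψa j) (hψs j)).1) w
  have hd1 : ∀ w, deriv (comb w (y 1)) =ᶠ[𝓝[≠] p] fun t => Φ₂ t / Φ₁ t * comb w (y 2) t :=
    fun w => deriv_comb_nhdsNE (fun j => H.meromorphicAt_coord (hψa j) 1)
    (fun j => (H.deriv_coord (hψa j) (hψs j)).2.1) w
  have hd2 : ∀ w, deriv (comb w (y 2)) =ᶠ[𝓝[≠] p] fun _ => 0 := fun w =>
    (deriv_comb_nhdsNE (r := fun _ => 0) (y' := fun _ _ => 0)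
      (fun j => H.meromorphicAt_coord (hψa j) 2)
      (fun j => ((H.deriv_coord (hψa j) (hψs j)).2.2).trans (.of_forall fun t => by simp)) w).trans
      (.of_forall fun t => by simp)
  -- Solutions are filtered by the successive vanishing of their last coordinates. Each step loses
  -- at most one dimension and three steps exhaust a 3-dimensional space, so each loses exactly one.
  -- Hence some solution has last coordinates `(k, 0)` with `k ≠ 0`, and another has last coordinate
  -- `l ≠ 0`; normalized, their remaining coordinates are `A` and `C`, `B`.
  set K₂ := (⊤ : Submodule ℂ (Fin 3 → ℂ)) ⊓ germKer (combLin (y 2)) p with hK₂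
  set K₁ := K₂ ⊓ germKer (combLin (y 1)) p with hK₁
  have f2 : Module.finrank ℂ (⊤ : Submodule ℂ (Fin 3 → ℂ)) ≤ Module.finrank ℂ K₂ + 1 :=
    finrank_le_finrank_inf_germKer fun w _ =>
      eventually_const_of_deriv_eq_zero (hm 2 w) (hd2 w)
  have f1 : Module.finrank ℂ K₂ ≤ Module.finrank ℂ K₁ + 1 :=
    finrank_le_finrank_inf_germKer fun w hw' => by
      have h2 : comb w (y 2) =ᶠ[𝓝[≠] p] fun _ => 0 := hw'.2
      exact eventually_const_of_deriv_eq_zero (hm 1 w) (by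
        filter_upwards [hd1 w, h2] with t k1 k2
        exact k1.trans (by rw [k2, mul_zero]))
  have f0 : Module.finrank ℂ K₁ ≤ Module.finrank ℂ (K₁ ⊓ germKer (combLin (y 0)) p :
      Submodule ℂ (Fin 3 → ℂ)) + 1 :=
    finrank_le_finrank_inf_germKer fun w hw' => by
      have h2 : comb w (y 1) =ᶠ[𝓝[≠] p] fun _ => 0 := hw'.2
      exact eventually_const_of_deriv_eq_zero (hm 0 w) (by
        filter_upwards [hd0 w, h2] with t k1 k2
        exact k1.trans (by rw [k2, mul_zero]))
  have hbot : (K₁ ⊓ germKer (combLin (y 0)) p : Submodule ℂ (Fin 3 → ℂ)) = ⊥ := by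
    refine (Submodule.eq_bot_iff _).2 fun w hw' => ?_
    have h0 : comb w (y 0) =ᶠ[𝓝[≠] p] fun _ => 0 := hw'.2
    have h1 : ∀ᶠ t in 𝓝[≠] p, comb w ψ t = 0 := by
      filter_upwards [h0, H.eventually_zero] with t k1 k2
      have k3 : comb w (y 0) t = comb w ψ t / Φ₀ t := by
        simp only [comb, hy, coord, Matrix.cons_val, Finset.sum_div, mul_div_assoc]
      rw [k3, div_eq_zero_iff] at k1
      exact k1.resolve_right k2.1
    refine eq_zero_of_comb_eventuallyEq_zero hψa hw ?_
    refine (analyticAt_comb hψa).eventually_eq_zero_or_eventually_ne_zero.resolve_right fun h => ?_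
    obtain ⟨t, k1, k2⟩ := (h.and h1).exists
    exact k1 k2
  rw [hbot, finrank_bot] at f0
  rw [finrank_top, Module.finrank_fin_fun] at f2
  obtain ⟨w₁, hw₁, hw₁'⟩ : ∃ w ∈ K₂, w ∉ germKer (combLin (y 1)) p := by
    by_contra! h
    have : K₁ = K₂ := inf_eq_left.2 h
    rw [this] at f0
    omega
  obtain ⟨w₂, hw₂⟩ : ∃ w, w ∉ germKer (combLin (y 2)) p := by
    by_contra! h
    have : K₂ = ⊤ := by
      rw [hK₂, top_inf_eq, eq_top_iff]
      exact fun w _ => h w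
    rw [this, finrank_top, Module.finrank_fin_fun] at f1
    omega
  have h2 : comb w₁ (y 2) =ᶠ[𝓝[≠] p] fun _ => 0 := hw₁.2
  obtain ⟨k, hk⟩ := eventually_const_of_deriv_eq_zero (hm 1 w₁) (by
    filter_upwards [hd1 w₁, h2] with t k1 k2
    exact k1.trans (by rw [k2, mul_zero]))
  have hk0 : k ≠ 0 := fun h => hw₁' (show comb w₁ (y 1) =ᶠ[𝓝[≠] p] fun _ => 0 by rwa [h] at hk)
  obtain ⟨l, hl⟩ := eventually_const_of_deriv_eq_zero (hm 2 w₂) (hd2 w₂)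
  have hl0 : l ≠ 0 := fun h => hw₂ (show comb w₂ (y 2) =ᶠ[𝓝[≠] p] fun _ => 0 by rwa [h] at hl)
  refine ⟨fun t => comb w₁ (y 0) t / k, fun t => comb w₂ (y 1) t / l, fun t => comb w₂ (y 0) t / l,
    (hm 0 w₁).div (.const _ _), (hm 1 w₂).div (.const _ _), (hm 0 w₂).div (.const _ _), ?_, ?_, ?_⟩
  · filter_upwards [hd0 w₁, hk] with t k1 k2
    rw [deriv_div_const, k1, k2, mul_div_cancel_right₀ _ hk0]
  · filter_upwards [hd1 w₂, hl] with t k1 k2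
    rw [deriv_div_const, k1, k2, mul_div_cancel_right₀ _ hl0]
  · filter_upwards [hd0 w₂] with t k1
    rw [deriv_div_const, k1]
    ring

end Frame

end

section

/-! ### Products of powers and their continuation -/

section Products

variable {ι : Type*} (s : Finset ι) (q : ι → ℂ) (e : ι → ℤ)

/-- The rational function `∏ᵢ (t - qᵢ) ^ eᵢ`. -/
def zpowProd (t : ℂ) : ℂ := ∏ i ∈ s, (t - q i) ^ e i

variable {s q e}

theorem meromorphicAt_zpowProd (p : ℂ) : MeromorphicAt (zpowProd s q e) p :=
  MeromorphicAt.fun_prod fun i _ => by fun_prop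

theorem analyticAt_zpowProd {t : ℂ} (h : ∀ i ∈ s, 0 ≤ e i ∨ q i ≠ t) :
    AnalyticAt ℂ (zpowProd s q e) t := by
  refine Finset.analyticAt_fun_prod _ fun i hi => ?_
  have h1 : AnalyticAt ℂ (fun t => t - q i) t := by fun_prop
  rcases h i hi with h2 | h2
  · exact h1.fun_zpow_nonneg h2
  · exact h1.fun_zpow (sub_ne_zero.2 h2.symm)

theorem zpowProd_ne_zero {t : ℂ} (h : ∀ i ∈ s, q i ≠ t) : zpowProd s q e t ≠ 0 :=
  Finset.prod_ne_zero_iff.2 fun i hi => zpow_ne_zero _ (sub_ne_zero.2 (h i hi).symm)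

theorem deriv_zpowProd {t : ℂ} (h : ∀ i ∈ s, q i ≠ t) :
    deriv (zpowProd s q e) t = (∑ i ∈ s, e i / (t - q i)) * zpowProd s q e t := by
  have hd : ∀ i ∈ s, DifferentiableAt ℂ (fun t => (t - q i) ^ e i) t := fun i hi =>
    DifferentiableAt.zpow (by fun_prop) (.inl (sub_ne_zero.2 (h i hi).symm))
  have h1 := logDeriv_prod (f := fun i t => (t - q i) ^ e i) (x := t)
    (fun i hi => zpow_ne_zero (e i) (sub_ne_zero.2 (h i hi).symm)) hd
  have h2 : ∀ i ∈ s, logDeriv (fun t => (t - q i) ^ e i) t = e i / (t - q i) := fun i hi => by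
    rw [logDeriv_fun_zpow (by fun_prop)]
    simp [logDeriv_apply, div_eq_mul_inv]
  rw [Finset.sum_congr rfl h2, logDeriv_apply] at h1
  rw [← h1]
  exact (div_mul_cancel₀ _ (zpowProd_ne_zero h)).symm

end Products

theorem deriv_mul_of_deriv_eq {f g : ℂ → ℂ} {a b t : ℂ} (hf : DifferentiableAt ℂ f t)
    (hg : DifferentiableAt ℂ g t) (h1 : deriv f t = a * f t) (h2 : deriv g t = b * g t) :
    deriv (fun s => f s * g s) t = (a + b) * (f t * g t) := by
  rw [(hf.hasDerivAt.fun_mul hg.hasDerivAt).deriv, h1, h2]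
  ring

section Branch

variable {N : ℕ} (a z : Fin N → ℂ)

/-- The branch of `∏ᵢ (t - zᵢ) ^ aᵢ` near a point where `lᵢ` is a logarithm of `t - zᵢ`. -/
def powerBranch (l : Fin N → ℂ) (t : ℂ) : ℂ :=
  Complex.exp (∑ i, a i * (l i + Complex.log ((t - z i) * Complex.exp (-l i))))

variable {a z}

theorem powerBranch_ne_zero (l : Fin N → ℂ) (t : ℂ) : powerBranch a z l t ≠ 0 :=
  Complex.exp_ne_zero _

theorem eventually_mem_slitPlane {l : Fin N → ℂ} {p : ℂ} (hl : ∀ i, Complex.exp (l i) = p - z i) :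
    ∀ᶠ t in 𝓝 p, ∀ i, (t - z i) * Complex.exp (-l i) ∈ Complex.slitPlane := by
  refine eventually_all.2 fun i => ?_
  have hc : ContinuousAt (fun t => (t - z i) * Complex.exp (-l i)) p := by fun_prop
  refine hc.eventually_mem (Complex.isOpen_slitPlane.mem_nhds ?_)
  rw [← hl i, ← Complex.exp_add, add_neg_cancel, Complex.exp_zero]
  exact Complex.one_mem_slitPlane

theorem hasDerivAt_powerBranch {l : Fin N → ℂ} {t : ℂ}
    (h : ∀ i, (t - z i) * Complex.exp (-l i) ∈ Complex.slitPlane) :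
    HasDerivAt (powerBranch a z l) ((∑ i, a i / (t - z i)) * powerBranch a z l t) t := by
  have h1 : ∀ i, HasDerivAt
      (fun t => a i * (l i + Complex.log ((t - z i) * Complex.exp (-l i)))) (a i / (t - z i)) t := by
    intro i
    have h0 : t - z i ≠ 0 := left_ne_zero_of_mul (Complex.slitPlane_ne_zero (h i))
    have hlin : HasDerivAt (fun t => (t - z i) * Complex.exp (-l i)) (1 * Complex.exp (-l i)) t :=
      ((hasDerivAt_id t).sub_const (z i)).mul_const _
    refine (((hlin.clog (h i)).const_add (l i)).const_mul (a i)).congr_deriv ?_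
    have := Complex.exp_ne_zero (-l i)
    field_simp
  exact (HasDerivAt.fun_sum fun i (_ : i ∈ Finset.univ) => h1 i).cexp.congr_deriv (mul_comm _ _)

theorem analyticAt_powerBranch {l : Fin N → ℂ} {p : ℂ} (hl : ∀ i, Complex.exp (l i) = p - z i) :
    AnalyticAt ℂ (powerBranch a z l) p := by
  rw [Complex.analyticAt_iff_eventually_differentiableAt]
  filter_upwards [eventually_mem_slitPlane hl] with t ht
  exact (hasDerivAt_powerBranch ht).differentiableAt

/-- Path lifting for the covering `exp` of the punctured plane. -/
theorem exists_continuous_log {x y w : ℂ} (γ : Path x y) (h : ∀ s, γ s ≠ w) :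
    ∃ l : C(unitInterval, ℂ), ∀ s, Complex.exp (l s) = γ s - w := by
  let γ' : C(unitInterval, {z : ℂ // z ≠ 0}) :=
    ⟨fun s => ⟨γ s - w, sub_ne_zero.2 (h s)⟩, by fun_prop⟩
  obtain ⟨l, hl, -⟩ := Complex.isCoveringMap_exp.exists_path_lifts γ' (Complex.log (γ 0 - w))
    (Subtype.ext (Complex.exp_log (sub_ne_zero.2 (h 0))).symm)
  exact ⟨l, fun s => congrArg Subtype.val (congrFun hl s)⟩

/-- Two choices of logarithm could differ by a multiple of `2πi`. Near `(s, γ s)` the imaginary part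
of the relevant difference stays within `(-π, π)`, which rules this out. -/
theorem eventually_powerBranch_eq {x y : ℂ} {γ : Path x y} {l : Fin N → C(unitInterval, ℂ)}
    (hl : ∀ i s, Complex.exp (l i s) = γ s - z i) (s : unitInterval) :
    ∀ᶠ s' in 𝓝 s, powerBranch a z (fun i => l i s') =ᶠ[𝓝 (γ s')] powerBranch a z fun i => l i s := by
  have h1 : ∀ i, ∀ᶠ x : unitInterval × ℂ in 𝓝 (s, γ s),
      (x.2 - z i) * Complex.exp (-l i s) ≠ 0 ∧
      (Complex.log ((x.2 - z i) * Complex.exp (-l i s)) - (l i x.1 - l i s)).im ∈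
        Set.Ioo (-Real.pi) Real.pi := by
    intro i
    have hval : (γ s - z i) * Complex.exp (-l i s) = 1 := by
      rw [← hl i s, ← Complex.exp_add, add_neg_cancel, Complex.exp_zero]
    have hc0 : ContinuousAt (fun x : unitInterval × ℂ => (x.2 - z i) * Complex.exp (-l i s))
        (s, γ s) := by fun_prop
    have hc : ContinuousAt (fun x : unitInterval × ℂ =>
        (Complex.log ((x.2 - z i) * Complex.exp (-l i s)) - (l i x.1 - l i s)).im) (s, γ s) := by
      refine Complex.continuous_im.continuousAt.comp (ContinuousAt.sub (hc0.clog ?_) ?_)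
      · change (γ s - z i) * Complex.exp (-l i s) ∈ _
        rw [hval]; exact Complex.one_mem_slitPlane
      · have := (l i).continuous
        fun_prop
    refine (hc0.eventually_ne ?_).and (hc.eventually_mem (Ioo_mem_nhds ?_ ?_))
    · simp [hval]
    · simp [hval, Real.pi_pos]
    · simp [hval, Real.pi_pos]
  have h2 := (eventually_all.2 h1).eventually_nhds
  have hc : ContinuousAt (fun s' => (s', γ s')) s := by
    have := γ.continuous
    fun_prop
  filter_upwards [hc.eventually h2] with s' hs'
  have h3 : Tendsto (fun t : ℂ => (s', t)) (𝓝 (γ s')) (𝓝 (s', γ s')) :=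
    (Continuous.prodMk_right s').tendsto _
  filter_upwards [h3.eventually hs'] with t ht
  rw [powerBranch, powerBranch]
  congr 1
  refine Finset.sum_congr rfl fun i _ => ?_
  obtain ⟨k1, k2⟩ := ht i
  have e : (t - z i) * Complex.exp (-l i s') =
      Complex.exp (Complex.log ((t - z i) * Complex.exp (-l i s)) - (l i s' - l i s)) := by
    rw [Complex.exp_sub, Complex.exp_log k1, Complex.exp_sub, Complex.exp_neg, Complex.exp_neg]
    have := Complex.exp_ne_zero (l i s)
    have := Complex.exp_ne_zero (l i s')
    field_simp
  rw [e, Complex.log_exp k2.1 k2.2.le]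
  ring

/-- Equal exponentials make the principal logarithms in the two branches identical, so only the
constants `l i`, `l' i` contribute. -/
theorem powerBranch_eq_mul {l l' : Fin N → ℂ} (h : ∀ i, Complex.exp (l i) = Complex.exp (l' i))
    (t : ℂ) : powerBranch a z l' t = Complex.exp (∑ i, a i * (l' i - l i)) * powerBranch a z l t := by
  rw [powerBranch, powerBranch, ← Complex.exp_add, ← Finset.sum_add_distrib]
  congr 1
  refine Finset.sum_congr rfl fun i _ => ?_
  rw [Complex.exp_neg, Complex.exp_neg, h i]
  ring

end Branch

/-- If every solution is a branch of `∏ᵢ (t - zᵢ) ^ aᵢ` times a single-valued function, the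
projective monodromy is trivial. -/
theorem trivialProjectiveMonodromy_of_powerBranch {u v : ℂ → ℂ} {N : ℕ} {a z : Fin N → ℂ}
    (h : ∀ (x : ℂ) (l : Fin N → ℂ), (∀ i, Complex.exp (l i) = x - z i) → ∀ f, AnalyticAt ℂ f x →
      (∀ᶠ t in 𝓝 x, oper u v f t = 0) → ∃ Q : ℂ → ℂ, (∀ t ∉ Set.range z, AnalyticAt ℂ Q t) ∧
        f =ᶠ[𝓝 x] fun t => powerBranch a z l t * Q t) :
    TrivialProjectiveMonodromy u v (Set.range z) := by
  intro x γ hγ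
  choose l hl using fun i => exists_continuous_log γ (w := z i) fun s hs => hγ s ⟨i, hs.symm⟩
  set c := Complex.exp (∑ i, a i * (l i 1 - l i 0)) with hc
  have hc0 : c ≠ 0 := Complex.exp_ne_zero _
  -- The monodromy is multiplication by the scalar `c`, central in the endomorphism algebra. It
  -- depends on the loop but not on the solution.
  refine ⟨Units.map (algebraMap ℂ (Module.End ℂ (solGerm u v x))).toMonoidHom (Units.mk0 c hc0),
    ?_, ?_⟩
  · rintro ⟨φ, f, hf, hfs, rfl⟩
    obtain ⟨Q, hQ, hfQ⟩ := h x (fun i => l i 0) (fun i => by rw [hl, γ.source]) f hf hfs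
    refine ⟨fun s t => powerBranch a z (fun i => l i s) t * Q t,
      fun s => (analyticAt_powerBranch fun i => hl i s).mul (hQ _ (hγ s)), fun s => ?_,
      (Germ.coe_eq.2 hfQ).symm, ?_⟩
    · filter_upwards [eventually_powerBranch_eq hl s] with s' hs'
      filter_upwards [hs'] with t ht
      rw [ht]
    · have e : ((Units.map (algebraMap ℂ (Module.End ℂ (solGerm u v x))).toMonoidHom
          (Units.mk0 c hc0) : Module.End ℂ (solGerm u v x)) ⟨(f : Germ (𝓝 x) ℂ), f, hf, hfs, rfl⟩ :
          Germ (𝓝 x) ℂ) = ((fun t => c * f t : ℂ → ℂ) : Germ (𝓝 x) ℂ) := rfl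
      refine Eq.trans ?_ e.symm
      refine Germ.coe_eq.2 ?_
      filter_upwards [hfQ] with t ht
      rw [ht, powerBranch_eq_mul (l := fun i => l i 0) (l' := fun i => l i 1) fun i => by
        rw [hl, hl, γ.source, γ.target]]
      ring
  · rw [QuotientGroup.eq_one_iff, Subgroup.mem_center_iff]
    intro g
    refine Units.ext ?_
    exact (Algebra.commutes c (g : Module.End ℂ (solGerm u v x))).symm

end

section

/-! ### From a factorization to trivial monodromy -/

theorem IteratedPrimitives.of_eventually_eq {Φ₀ Φ₁ Φ₂ r₁ r₂ A B C : ℂ → ℂ} {p : ℂ}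
    (hA : MeromorphicAt A p) (hB : MeromorphicAt B p) (hC : MeromorphicAt C p)
    (h0 : ∀ᶠ t in 𝓝[≠] p, Φ₀ t ≠ 0) (h1 : ∀ᶠ t in 𝓝[≠] p, Φ₁ t ≠ 0)
    (e1 : ∀ t, Φ₁ t = Φ₀ t * r₁ t) (e2 : ∀ t, Φ₂ t = Φ₁ t * r₂ t)
    (dA : deriv A =ᶠ[𝓝[≠] p] r₁) (dB : deriv B =ᶠ[𝓝[≠] p] r₂)
    (dC : deriv C =ᶠ[𝓝[≠] p] fun t => r₁ t * B t) : IteratedPrimitives Φ₀ Φ₁ Φ₂ A B C p := by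
  refine ⟨hA, hB, hC, ?_, ?_, ?_⟩
  · filter_upwards [dA, h0] with t k1 k2
    rw [k1, e1, mul_div_cancel_left₀ _ k2]
  · filter_upwards [dB, h1] with t k1 k2
    rw [k1, e2, mul_div_cancel_left₀ _ k2]
  · filter_upwards [dC, h0] with t k1 k2
    rw [k1, e1, mul_div_cancel_left₀ _ k2]

/-- Global iterated primitives, from local frames at the poles of `r₁` and `r₂`. -/
theorem exists_global_iteratedPrimitives {u v a b c r₁ r₂ : ℂ → ℂ} {W : Finset ℂ}
    (hu : ∀ p ∈ W, AnalyticAt ℂ u p) (hv : ∀ p ∈ W, AnalyticAt ℂ v p)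
    (hr₁ : ∀ t ∉ W, AnalyticAt ℂ r₁ t) (hr₂ : ∀ t ∉ W, AnalyticAt ℂ r₂ t)
    (h : ∀ p ∈ W, ∃ Φ : ℂ → ℂ, Frame u v a b c Φ (fun t => Φ t * r₁ t)
      (fun t => Φ t * r₁ t * r₂ t) p) :
    ∃ A B C : ℂ → ℂ, (∀ p, MeromorphicAt A p ∧ MeromorphicAt B p ∧ MeromorphicAt C p) ∧
      deriv A =ᶠ[cofinite] r₁ ∧ deriv B =ᶠ[cofinite] r₂ ∧
      deriv C =ᶠ[cofinite] fun t => r₁ t * B t := by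
  have hloc : ∀ p ∈ W, ∃ A B C : ℂ → ℂ, MeromorphicAt A p ∧ MeromorphicAt B p ∧ MeromorphicAt C p ∧
      deriv A =ᶠ[𝓝[≠] p] r₁ ∧ deriv B =ᶠ[𝓝[≠] p] r₂ ∧
      deriv C =ᶠ[𝓝[≠] p] fun t => r₁ t * B t := by
    intro p hp
    obtain ⟨Φ, H⟩ := h p hp
    obtain ⟨A, B, C, I⟩ := H.exists_iteratedPrimitives (hu p hp) (hv p hp)
    refine ⟨A, B, C, I.meromorphicAt_A, I.meromorphicAt_B, I.meromorphicAt_C, ?_, ?_, ?_⟩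
    · filter_upwards [I.deriv_A, H.eventually_zero] with t k1 k2
      rw [k1, mul_div_cancel_left₀ _ k2.1]
    · filter_upwards [I.deriv_B, H.eventually_one] with t k1 k2
      rw [k1, mul_div_cancel_left₀ _ k2.1]
    · filter_upwards [I.deriv_C, H.eventually_zero] with t k1 k2
      rw [k1, mul_div_cancel_left₀ _ k2.1]
  have hW : ∀ᶠ t in cofinite, t ∉ W := W.finite_toSet.compl_mem_cofinite
  obtain ⟨A, hAm, hA⟩ := exists_primitive W hr₁ fun p hp => by
    obtain ⟨A, -, -, k1, -, -, k2, -, -⟩ := hloc p hp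
    exact ⟨A, k1, k2⟩
  obtain ⟨B, hBm, hB⟩ := exists_primitive W hr₂ fun p hp => by
    obtain ⟨-, B, -, -, k1, -, -, k2, -⟩ := hloc p hp
    exact ⟨B, k1, k2⟩
  have hB' : deriv B =ᶠ[cofinite] r₂ := hW.mono fun t ht => (hB t ht).2
  obtain ⟨C, hCm, hC⟩ := exists_primitive W (G := fun t => r₁ t * B t)
    (fun t ht => (hr₁ t ht).mul (hB t ht).1) fun p hp => by
      obtain ⟨Aₚ, Bₚ, Cₚ, mA, mB, mC, dA, dB, dC⟩ := hloc p hp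
      -- The global `B` and the local `Bₚ` differ by a constant `k`, so `Cₚ + k Aₚ` is a local
      -- primitive of `r₁ B`.
      obtain ⟨k, hk⟩ := eventually_const_of_deriv_eq_zero (h := fun s => 1 * B s + (-1) * Bₚ s)
        (((MeromorphicAt.const _ _).mul (hBm p)).add ((MeromorphicAt.const _ _).mul mB)) (by
          filter_upwards [eventually_deriv_linear_combination (hBm p) mB 1 (-1), dB,
            hB'.filter_mono (nhdsNE_le_cofinite p)] with t h1 h2 h3
          rw [h1, h2, h3]; ring)
      refine ⟨fun s => 1 * Cₚ s + k * Aₚ s,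
        ((MeromorphicAt.const _ _).mul mC).add ((MeromorphicAt.const _ _).mul mA), ?_⟩
      filter_upwards [eventually_deriv_linear_combination mC mA 1 k, hk, dA, dC] with t h1 h2 h3 h4
      rw [h1, h3, h4, ← h2]; ring
  exact ⟨A, B, C, fun p => ⟨hAm p, hBm p, hCm p⟩, hW.mono fun t ht => (hA t ht).2, hB',
    hW.mono fun t ht => (hC t ht).2⟩

/-- A meromorphic function whose product with a nonvanishing function solves the equation extends
analytically over the regular points. -/
theorem exists_analytic_extension {u v Q : ℂ → ℂ} {S : Set ℂ} (hu : ∀ p ∉ S, AnalyticAt ℂ u p)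
    (hv : ∀ p ∉ S, AnalyticAt ℂ v p) (hQ : ∀ p, MeromorphicAt Q p)
    (h : ∀ p ∉ S, ∃ D : ℂ → ℂ, AnalyticAt ℂ D p ∧ D p ≠ 0 ∧
      ∀ᶠ t in 𝓝[≠] p, oper u v (fun s => D s * Q s) t = 0) :
    ∃ Q' : ℂ → ℂ, (∀ p ∉ S, AnalyticAt ℂ Q' p) ∧ ∀ p, Q' =ᶠ[𝓝[≠] p] Q := by
  have hQ' : MeromorphicOn Q Set.univ := fun p _ => hQ p
  refine ⟨toMeromorphicNFOn Q Set.univ, fun p hp => ?_,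
    fun p => hQ'.toMeromorphicNFOn_eq_self_on_nhdsNE trivial⟩
  refine ((meromorphicNFOn_toMeromorphicNFOn Q Set.univ)
    (Set.mem_univ p)).meromorphicOrderAt_nonneg_iff_analyticAt.1 ?_
  rw [meromorphicOrderAt_toMeromorphicNFOn hQ' trivial]
  obtain ⟨D, hD, hD0, hs⟩ := h p hp
  have hm : meromorphicOrderAt (fun s => D s * Q s) p = meromorphicOrderAt Q p :=
    meromorphicOrderAt_mul_of_ne_zero hD hD0
  cases hn : meromorphicOrderAt Q p with
  | top => exact le_top
  | coe n =>
    -- Multiplication by `D` does not change the order, and a solution has order 0, 1 or 2 at a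
    -- regular point.
    have := order_of_solution (hu p hp) (hv p hp) (hD.meromorphicAt.mul (hQ p)) (hm.trans hn) hs
    have : 0 ≤ n := by omega
    exact_mod_cast this

/-- The integral version of `rhoBar`. -/
def rhoInt : Fin 3 → ℤ := ![1, 0, -1]

theorem rhoInt_cast (k : Fin 3) : (rhoInt k : ℂ) = rhoBar k := by
  fin_cases k <;> simp [rhoInt, rhoBar]

variable {N : ℕ} {z : Fin N → ℂ} {lam : Fin N → Fin 3 → ℂ} {μ ν κ : Fin N → ℂ}
  {χ : Fin 3 → RatFunc ℂ}

/-- The residues at the points `w` are differences of entries of `rhoBar`, hence integers. The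
corresponding powers of `t - w` are therefore single-valued. -/
theorem HasDiagonalForm.exists_ev_eq (h : HasDiagonalForm z lam χ) :
    ∃ (J : Finset ((_ : {s : Equiv.Perm (Fin 3) // s ≠ 1}) × ℂ)) (d : Fin 3 → _ → ℤ),
      (∀ x ∈ J, x.2 ∉ Set.range z) ∧ ∀ k, ev (χ k) =ᶠ[cofinite] fun t =>
        (∑ i, lam i k / (t - z i)) + ∑ x ∈ J, (d k x : ℂ) / (t - x.2) := by
  obtain ⟨P, -, hzP, hχ⟩ := h
  refine ⟨Finset.univ.sigma P, fun k x => rhoInt (x.1.1⁻¹ k) - rhoInt k, ?_, fun k => ?_⟩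
  · rintro ⟨s, w⟩ hx ⟨i, hi⟩
    exact hzP s i (hi ▸ (Finset.mem_sigma.1 hx).2)
  · have h1 : ∀ s : {s : Equiv.Perm (Fin 3) // s ≠ 1}, ev (∑ w ∈ P s,
        RatFunc.C (weyl s.1 rhoBar k - rhoBar k) / (RatFunc.X - RatFunc.C w)) =ᶠ[cofinite]
        fun t => ∑ w ∈ P s, (weyl s.1 rhoBar k - rhoBar k) / (t - w) := fun s => by
      filter_upwards [ev_sum (P s) fun w => RatFunc.C (weyl s.1 rhoBar k - rhoBar k) /
        (RatFunc.X - RatFunc.C w), (eventually_all_finset (P s)).2 fun w _ =>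
          ev_simpleFraction (weyl s.1 rhoBar k - rhoBar k) w] with t k1 k2
      rw [k1]
      exact Finset.sum_congr rfl k2
    rw [hχ k]
    filter_upwards [ev_add _ _, ev_sum Finset.univ fun i => RatFunc.C (lam i k) /
      (RatFunc.X - RatFunc.C (z i)), ev_sum Finset.univ fun s => ∑ w ∈ P s,
        RatFunc.C (weyl s.1 rhoBar k - rhoBar k) / (RatFunc.X - RatFunc.C w),
      eventually_all.2 h1, eventually_all.2 fun i => ev_simpleFraction (lam i k) (z i)]
      with t k1 k2 k3 k4 k5
    rw [k1, k2, k3, Finset.sum_sigma]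
    congr 1
    · exact Finset.sum_congr rfl fun i _ => k5 i
    · refine Finset.sum_congr rfl fun s _ => ?_
      rw [k4 s]
      refine Finset.sum_congr rfl fun w _ => ?_
      push_cast
      rw [rhoInt_cast, rhoInt_cast]
      rfl

/-- All multivaluedness is concentrated in the common factor `∏ (t - z i) ^ (lam i 2)`, as the
ratios of the functions annihilated by the three factors are rational. -/
theorem trivialProjectiveMonodromy_of_isMiura (hlam : ∀ i, IsDominantIntegral (lam i))
    (h : IsMiura (coeffU z lam μ) (coeffV z lam ν κ) (Set.range z) χ)
    (hform : HasDiagonalForm z lam χ) :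
    TrivialProjectiveMonodromy (coeffU z lam μ) (coeffV z lam ν κ) (Set.range z) := by
  classical
  obtain ⟨J, d, hJ, hev⟩ := hform.exists_ev_eq
  choose n₁ n₂ hn using hlam
  have l01 : ∀ i, lam i 0 = lam i 1 + n₁ i := fun i => by
    simp [hn i, omega1, omega2]; ring
  have l12 : ∀ i, lam i 1 = lam i 2 + n₂ i := fun i => by
    simp [hn i, omega1, omega2]; ring
  set a : Fin N → ℂ := fun i => lam i 2 with ha
  -- `R` is the rational part of `Φ₀`, and `r₁`, `r₂` are `Φ₁/Φ₀`, `Φ₂/Φ₁`. Their exponents are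
  -- differences of residues of consecutive factors, at `z i` the integers `n₂ i` and `n₁ i`.
  set R := zpowProd J Sigma.snd (d 2) with hR
  set r₁ : ℂ → ℂ := fun t => zpowProd Finset.univ z (fun i => n₂ i) t *
    zpowProd J Sigma.snd (fun x => d 1 x - d 2 x) t with hr₁
  set r₂ : ℂ → ℂ := fun t => zpowProd Finset.univ z (fun i => n₁ i) t *
    zpowProd J Sigma.snd (fun x => d 0 x - d 1 x) t with hr₂
  have hJc : ∀ᶠ t in cofinite, ∀ x ∈ J, x.2 ≠ t := by
    filter_upwards [(J.image Sigma.snd).finite_toSet.compl_mem_cofinite] with t ht x hx hxt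
    exact ht (Finset.mem_coe.2 (Finset.mem_image.2 ⟨x, hx, hxt⟩))
  have hzc : ∀ᶠ t in cofinite, ∀ i ∈ Finset.univ, z i ≠ t := by
    filter_upwards [(Set.finite_range z).compl_mem_cofinite] with t ht i _ hi
    exact ht ⟨i, hi⟩
  have hmr₁ : ∀ p, MeromorphicAt r₁ p := fun p =>
    (meromorphicAt_zpowProd p).mul (meromorphicAt_zpowProd p)
  have hmr₂ : ∀ p, MeromorphicAt r₂ p := fun p =>
    (meromorphicAt_zpowProd p).mul (meromorphicAt_zpowProd p)
  have hu : ∀ p ∉ Set.range z, AnalyticAt ℂ (coeffU z lam μ) p := fun p hp => analyticAt_coeffU hp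
  have hv : ∀ p ∉ Set.range z, AnalyticAt ℂ (coeffV z lam ν κ) p := fun p hp => analyticAt_coeffV hp
  have hframe : ∀ p (l : Fin N → ℂ), (∀ i, Complex.exp (l i) = p - z i) →
      Frame (coeffU z lam μ) (coeffV z lam ν κ) (ev (χ 0)) (ev (χ 1)) (ev (χ 2))
        (fun t => powerBranch a z l t * R t) (fun t => powerBranch a z l t * R t * r₁ t)
        (fun t => powerBranch a z l t * R t * r₁ t * r₂ t) p := by
    intro p l hl
    have hD : MeromorphicAt (powerBranch a z l) p := (analyticAt_powerBranch hl).meromorphicAt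
    have m0 := hD.mul (meromorphicAt_zpowProd (s := J) (q := Sigma.snd) (e := d 2) p)
    have hgood : ∀ᶠ t in 𝓝[≠] p,
        (powerBranch a z l t * R t ≠ 0 ∧ deriv (fun s => powerBranch a z l s * R s) t =
          ev (χ 2) t * (powerBranch a z l t * R t)) ∧
        (powerBranch a z l t * R t * r₁ t ≠ 0 ∧ deriv (fun s => powerBranch a z l s * R s * r₁ s) t =
          ev (χ 1) t * (powerBranch a z l t * R t * r₁ t)) ∧
        (powerBranch a z l t * R t * r₁ t * r₂ t ≠ 0 ∧
          deriv (fun s => powerBranch a z l s * R s * r₁ s * r₂ s) t =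
          ev (χ 0) t * (powerBranch a z l t * R t * r₁ t * r₂ t)) := by
      filter_upwards [(eventually_mem_slitPlane hl).filter_mono nhdsWithin_le_nhds,
        hJc.filter_mono (nhdsNE_le_cofinite p), hzc.filter_mono (nhdsNE_le_cofinite p),
        (hev 0).filter_mono (nhdsNE_le_cofinite p), (hev 1).filter_mono (nhdsNE_le_cofinite p),
        (hev 2).filter_mono (nhdsNE_le_cofinite p)] with t h1 h2 h3 e0 e1 e2
      have dD := hasDerivAt_powerBranch (a := a) h1
      have aJ : ∀ e : _ → ℤ, DifferentiableAt ℂ (zpowProd J Sigma.snd e) t := fun e =>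
        (analyticAt_zpowProd fun x hx => .inr (h2 x hx)).differentiableAt
      have aZ : ∀ e : _ → ℤ, DifferentiableAt ℂ (zpowProd Finset.univ z e) t := fun e =>
        (analyticAt_zpowProd fun x hx => .inr (h3 x hx)).differentiableAt
      have nJ : ∀ e : _ → ℤ, zpowProd J Sigma.snd e t ≠ 0 := fun e => zpowProd_ne_zero h2
      have nZ : ∀ e : _ → ℤ, zpowProd Finset.univ z e t ≠ 0 := fun e => zpowProd_ne_zero h3
      have k0 := deriv_mul_of_deriv_eq dD.differentiableAt (aJ (d 2)) dD.deriv (deriv_zpowProd h2)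
      have g0 := dD.differentiableAt.fun_mul (aJ (d 2))
      have g1 := g0.fun_mul ((aZ fun i => n₂ i).fun_mul (aJ fun x => d 1 x - d 2 x))
      have k1 := deriv_mul_of_deriv_eq g0
        ((aZ fun i => n₂ i).fun_mul (aJ fun x => d 1 x - d 2 x)) k0
        (deriv_mul_of_deriv_eq (aZ _) (aJ _) (deriv_zpowProd h3) (deriv_zpowProd h2))
      have k2 := deriv_mul_of_deriv_eq g1
        ((aZ fun i => n₁ i).fun_mul (aJ fun x => d 0 x - d 1 x)) k1
        (deriv_mul_of_deriv_eq (aZ _) (aJ _) (deriv_zpowProd h3) (deriv_zpowProd h2))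
      have s2 : ev (χ 2) t = (∑ i, a i / (t - z i)) + ∑ x ∈ J, (d 2 x : ℂ) / (t - x.2) := e2
      have s1 : ev (χ 1) t = ev (χ 2) t + ((∑ i, ((n₂ i : ℤ) : ℂ) / (t - z i)) +
          ∑ x ∈ J, ((d 1 x - d 2 x : ℤ) : ℂ) / (t - x.2)) := by
        rw [e1, e2]
        simp only [l12, add_div, Int.cast_natCast, Int.cast_sub, sub_div, Finset.sum_add_distrib,
          Finset.sum_sub_distrib]
        ring
      have s0 : ev (χ 0) t = ev (χ 1) t + ((∑ i, ((n₁ i : ℤ) : ℂ) / (t - z i)) +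
          ∑ x ∈ J, ((d 0 x - d 1 x : ℤ) : ℂ) / (t - x.2)) := by
        rw [e0, e1]
        simp only [l01, add_div, Int.cast_natCast, Int.cast_sub, sub_div, Finset.sum_add_distrib,
          Finset.sum_sub_distrib]
        ring
      have n0 := mul_ne_zero (powerBranch_ne_zero (a := a) (z := z) l t) (nJ (d 2))
      have n1 := mul_ne_zero n0 (mul_ne_zero (nZ fun i => n₂ i) (nJ fun x => d 1 x - d 2 x))
      have n2 := mul_ne_zero n1 (mul_ne_zero (nZ fun i => n₁ i) (nJ fun x => d 0 x - d 1 x))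
      rw [← s2] at k0 k1 k2
      rw [← s1] at k1 k2
      rw [← s0] at k2
      exact ⟨⟨n0, k0⟩, ⟨n1, k1⟩, n2, k2⟩
    exact ⟨meromorphicAt_ev _ p, meromorphicAt_ev _ p, m0, m0.mul (hmr₁ p),
      (m0.mul (hmr₁ p)).mul (hmr₂ p),
      (h.eventually_miuraEqs (Set.finite_range z)).filter_mono (nhdsNE_le_cofinite p),
      hgood.mono fun t ht => ht.1, hgood.mono fun t ht => ht.2.1, hgood.mono fun t ht => ht.2.2⟩
  have hlog : ∀ p ∉ Set.range z, ∀ i, Complex.exp (Complex.log (p - z i)) = p - z i := fun p hp i =>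
    Complex.exp_log (sub_ne_zero.2 fun h => hp ⟨i, h.symm⟩)
  have hWS : ∀ p ∈ J.image Sigma.snd, p ∉ Set.range z := by
    intro p hp
    obtain ⟨x, hx, rfl⟩ := Finset.mem_image.1 hp
    exact hJ x hx
  -- Dominance enters here: exponents `n₂ i, n₁ i ≥ 0` make `r₁`, `r₂` analytic at the `z i`, so
  -- only the points `w` can obstruct integration, and there the operator is regular.
  obtain ⟨A, B, C, hm, dA, dB, dC⟩ := exists_global_iteratedPrimitives (W := J.image Sigma.snd)
    (r₁ := r₁) (r₂ := r₂) (fun p hp => hu p (hWS p hp)) (fun p hp => hv p (hWS p hp))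
    (fun t ht => (analyticAt_zpowProd fun i _ => .inl (by positivity)).mul
      (analyticAt_zpowProd fun x hx => .inr fun hxt => ht (Finset.mem_image.2 ⟨x, hx, hxt⟩)))
    (fun t ht => (analyticAt_zpowProd fun i _ => .inl (by positivity)).mul
      (analyticAt_zpowProd fun x hx => .inr fun hxt => ht (Finset.mem_image.2 ⟨x, hx, hxt⟩)))
    (fun p hp => ⟨_, hframe p _ (hlog p (hWS p hp))⟩)
  have hI : ∀ p (l : Fin N → ℂ), (∀ i, Complex.exp (l i) = p - z i) →
      IteratedPrimitives (fun t => powerBranch a z l t * R t)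
        (fun t => powerBranch a z l t * R t * r₁ t)
        (fun t => powerBranch a z l t * R t * r₁ t * r₂ t) A B C p := fun p l hl =>
    .of_eventually_eq (hm p).1 (hm p).2.1 (hm p).2.2
      ((hframe p l hl).eventually_zero.mono fun _ ht => ht.1)
      ((hframe p l hl).eventually_one.mono fun _ ht => ht.1) (fun _ => rfl) (fun _ => rfl)
      (dA.filter_mono (nhdsNE_le_cofinite p)) (dB.filter_mono (nhdsNE_le_cofinite p))
      (dC.filter_mono (nhdsNE_le_cofinite p))
  refine trivialProjectiveMonodromy_of_powerBranch (a := a) fun x l hl f hf hfs => ?_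
  obtain ⟨k, hk⟩ := (hframe x l hl).exists_eq_of_solution (hI x l hl) hf hfs
  -- The meromorphic factor may take default values or have apparent poles at the points `w`; it is
  -- replaced by its analytic extension off the `z i`.
  obtain ⟨Q, hQa, hQ⟩ := exists_analytic_extension (Q := fun s => R s * (k 0 + k 1 * A s + k 2 * C s))
    hu hv (fun p => (meromorphicAt_zpowProd p).mul (((MeromorphicAt.const _ _).add
      ((MeromorphicAt.const _ _).mul (hm p).1)).add ((MeromorphicAt.const _ _).mul (hm p).2.2)))
    fun p hp => ⟨powerBranch a z fun i => Complex.log (p - z i), analyticAt_powerBranch (hlog p hp),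
      powerBranch_ne_zero _ _, by
        have := (hframe p _ (hlog p hp)).oper_eq_zero (hI p _ (hlog p hp)) k
        simpa only [mul_assoc] using this⟩
  refine ⟨Q, hQa, ?_⟩
  have hx : x ∉ Set.range z := by
    rintro ⟨i, rfl⟩
    have := hl i
    simp at this
  have hana : AnalyticAt ℂ (fun t => powerBranch a z l t * Q t) x :=
    (analyticAt_powerBranch hl).mul (hQa x hx)
  refine (hf.frequently_eq_iff_eventually_eq hana).1 (Eventually.frequently ?_)
  filter_upwards [hk, hQ x] with t k1 k2
  rw [k1, k2]
  ring

end

end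

end SL3Oper

/-! ### The theorem. -/

theorem mainTheorem6 (N : ℕ) (z : Fin N → ℂ) (hz : Function.Injective z)
    (lam : Fin N → Fin 3 → ℂ) (hlam : ∀ i, SL3Oper.IsDominantIntegral (lam i))
    (μ ν κ : Fin N → ℂ)
    (hinfty : SL3Oper.RegularSingularAtInfty
      (SL3Oper.coeffU z lam μ) (SL3Oper.coeffV z lam ν κ)) :
    (SL3Oper.TrivialProjectiveMonodromy
        (SL3Oper.coeffU z lam μ) (SL3Oper.coeffV z lam ν κ) (Set.range z) ↔
      ∃ χ : Fin 3 → RatFunc ℂ,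
        SL3Oper.IsMiura (SL3Oper.coeffU z lam μ) (SL3Oper.coeffV z lam ν κ) (Set.range z) χ ∧
        SL3Oper.HasDiagonalForm z lam χ) ∧
    (∀ χ : Fin 3 → RatFunc ℂ,
      SL3Oper.IsMiura (SL3Oper.coeffU z lam μ) (SL3Oper.coeffV z lam ν κ) (Set.range z) χ →
      ∃ σ : Fin N → Equiv.Perm (Fin 3),
        SL3Oper.HasDiagonalForm z (fun i => SL3Oper.weylDot (σ i) (lam i)) χ) := by
  have hsum := fun i => (hlam i).sum_eq_zero
  refine ⟨⟨SL3Oper.exists_isMiura_of_trivialProjectiveMonodromy hz hlam hinfty, ?_⟩, fun χ hχ => ?_⟩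
  · rintro ⟨χ, hχ, hform⟩
    exact SL3Oper.trivialProjectiveMonodromy_of_isMiura hlam hχ hform
  · choose σ hσ using fun i => hχ.exists_hasResidue hz hsum (z i)
    refine ⟨σ, hχ.hasDiagonalForm hz hsum hinfty fun i => ?_⟩
    have := hσ i
    rwa [SL3Oper.localWeight_apply hz] at this
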